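/- **Theorem** (functional relations for $\zeta_3(\mathbf s,\lambda_1^\vee;SU(4))$ and $\zeta_3(\mathbf s,\lambda_3^\vee;SU(4))$). *Notation.* For $\mathbf s=(s_1,\dots,s_6)$ with $\Re s_j\ge 1$ let $$\zeta_3(\mathbf s,\lambda_1^\vee)=\sum_{l,m,n\ge 1}\frac{i^{3l+2m+n}}{l^{s_1}m^{s_2}n^{s_3}(l+m)^{s_4}(m+n)^{s_5}(l+m+n)^{s_6}},\qquad \zeta_3(\mathbf s,\lambda_3^\vee)=\sum_{l,m,n\ge 1}\frac{i^{l+2m+3n}}{l^{s_1}m^{s_2}n^{s_3}(l+m)^{s_4}(m+n)^{s_5}(l+m+n)^{s_6}}.$$ For $x=\pm i$ and $\Re s>1$ let $\Lambda(s;x)=\sum_{m\in\mathbb Z\setminus\{0\}}x^m m^{-s}$, where $m^{-s}=\exp(-s(\log|m|+\pi i))$ for $m<0$. For integers $p,q\ge1$ and $\Re s>1$ let $$\mathfrak T(p,s,q;x,y)=\sum_{l\in\mathbb Z,\ m\ge 1,\ l\ne0,\ l+m\ne0}\frac{x^l y^m}{l^p m^s(l+m)^q}.$$ The series above, the last one for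 $(x,y)\in\{(-1,\pm i),(\pm i,-1),(\pm i,\mp i)\}$, converge absolutely and extend to entire functions (on $\mathbb C^6$, $\mathbb C$, $\mathbb C$ respectively), which are denoted by the same symbols. Let $L(s,\chi_4)$ be the Dirichlet $L$-function of the primitive character of conductor $4$, let $\phi(s)=(2^{1-s}-1)\zeta(s)$ (with $\phi(1)=-\log 2$), and for $x=\pm i$ let $\phi_x(s)=2^{-s}\phi(s)+x\,L(s,\chi_4)$. *Functional relations.* For all integers $p,q,a,b,c\ge 1$, all $s\in\mathbb C$ and $(\lambda,x)\in\{(\lambda_1^\vee,-i),(\lambda_3^\vee,i)\}$, $$\begin{aligned} &\zeta_3((p,q,s,a,b,c),\lambda)+(-1)^p\zeta_3((p,a,s,q,c,b),\lambda)+(-1)^{p+a}\zeta_3((q,a,c,p,s,b),\lambda)\\ &+(-1)^{p+a+c}\zeta_3((q,s,c,b,a,p),\lambda)+(-1)^{q}\zeta_3((a,q,b,p,s,c),\lambda)+(-1)^{q+b}\zeta_3((a,s,b,c,q,p),\lambda)\\ &+(-1)^{q+a}\zeta_3((a,p,b,q,c,s),\lambda)+(-1)^{q+a+b}\zeta_3((a,c,b,s,p,q),\lambda)+(-1)^{q+a+b+c}\zeta_3((s,c,p,a,b,q),\lambda)\\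 &+(-1)^{p+q+a}\zeta_3((q,p,c,a,b,s),\lambda)+(-1)^{p+q+a+c}\zeta_3((q,b,c,s,p,a),\lambda)+(-1)^{p+q+a+b+c}\zeta_3((s,b,p,q,c,a),\lambda)\\ ={}&(-1)^p\sum_{j=0}^{p}(-1)^j\Lambda(j;x)\sum_{\omega=0}^{p-j}\binom{\omega+a-1}{\omega}\binom{p+c-j-\omega-1}{c-1}\,\mathfrak T(q+a+\omega,s,p+b+c-j-\omega;-1,-x)\\ &+(-1)^{p+a}\sum_{j=0}^{c}\Lambda(j;x)\sum_{\omega=0}^{c-j}\binom{\omega+a-1}{\omega}\binom{p+c-j-\omega-1}{p-1}\,\mathfrak T(q,s+a+\omega,p+b+c-j-\omega;x,-1)\\ &+(-1)^{p}\sum_{j=0}^{a}\Lambda(j;x)\sum_{\omega=0}^{p-1}\binom{\omega+a-j}{\omega}\binom{p+c-2-\omega}{c-1}\,\mathfrak T(q+a-j+\omega+1,s,p+b+c-1-\omega;x,-x)\\ &+(-1)^{p+a}\sum_{j=0}^{a}(-1)^j\Lambda(j;x)\sum_{\omega=0}^{c-1}\binom{\omega+a-j}{\omega}\binom{p+c-2-\omega}{p-1}\,\mathfrak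 T(q,s+a-j+\omega+1,p+b+c-1-\omega;x,-x). \end{aligned}$$ *Expression by $\zeta(s)$ and $L(s,\chi_4)$.* Moreover, for $x=\pm i$ and all integers $k\ge 0$, $\Lambda(2k;x)=2^{1-2k}(2^{1-2k}-1)\zeta(2k)$ and $\Lambda(2k+1;x)=2x\,L(2k+1,\chi_4)$, and for all integers $p,q\ge1$ and all $s\in\mathbb C$ $$\begin{aligned} \mathfrak T(p,s,q;-1,x)={}&2(-1)^p\sum_{k=0}^{[p/2]}\phi(2k)\binom{p+q-1-2k}{q-1}\phi_x(s+p+q-2k)\\&+2(-1)^p\sum_{k=0}^{[q/2]}\phi(2k)\binom{p+q-1-2k}{p-1}\phi_{-x}(s+p+q-2k),\\ \mathfrak T(p,s,q;x,-1)={}&(-1)^p\sum_{l=0}^{p}(-1)^l\Lambda(l;x)\binom{p+q-1-l}{q-1}\phi(s+p+q-l)\\&+(-1)^p\sum_{l=0}^{q}\Lambda(l;x)\binom{p+q-1-l}{p-1}\phi_{x}(s+p+q-l),\\ \mathfrak T(p,s,q;x,-x)={}&(-1)^p\sum_{l=0}^{p}(-1)^l\Lambda(l;x)\binom{p+q-1-l}{q-1}\phi_{-x}(s+p+q-l)\\&+(-1)^p\sum_{l=0}^{q}\Lambda(l;x)\binom{p+q-1-l}{p-1}\phi(s+p+q-l).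 \end{aligned}$$ Substituting these formulas writes the right sides of both functional relations explicitly in terms of $\zeta(s)$ and $L(s,\chi_4)$. -/

import Mathlib

open Complex

noncomputable section

/-- `F` is the entire continuation of the function given on `U` by the (absolutely convergent)
series with terms `f i`. -/
def IsEntireContinuation {ι E : Type*} [NormedAddCommGroup E] [NormedSpace ℂ E]
    (f : ι → E → ℂ) (U : Set E) (F : E → ℂ) : Prop :=
  Differentiable ℂ F ∧ ∀ s ∈ U, HasSum (fun i => f i s) (F s)

/-- An entire continuation is unique as soon as `U` has an interior point. -/
theorem IsEntireContinuation.unique {ι E : Type*} [NormedAddCommGroup E] [NormedSpace ℂ E]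
    {f : ι → E → ℂ} {U : Set E} {F G : E → ℂ} (hU : (interior U).Nonempty)
    (hF : IsEntireContinuation f U F) (hG : IsEntireContinuation f U G) : F = G := by
  obtain ⟨x, hx⟩ := hU
  funext y
  have hline : Differentiable ℂ (fun t : ℂ => x + t • (y - x)) := by fun_prop
  have hA : AnalyticOnNhd ℂ (fun t : ℂ => F (x + t • (y - x))) Set.univ :=
    (hF.1.comp hline).differentiableOn.analyticOnNhd isOpen_univ
  have hB : AnalyticOnNhd ℂ (fun t : ℂ => G (x + t • (y - x))) Set.univ :=
    (hG.1.comp hline).differentiableOn.analyticOnNhd isOpen_univ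
  have hnear : (fun t : ℂ => F (x + t • (y - x))) =ᶠ[nhds 0]
      (fun t : ℂ => G (x + t • (y - x))) := by
    have hmem : (fun t : ℂ => x + t • (y - x)) ⁻¹' interior U ∈ nhds (0 : ℂ) :=
      (isOpen_interior.preimage hline.continuous).mem_nhds (by simpa using hx)
    filter_upwards [hmem] with t ht
    exact (hF.2 _ (interior_subset ht)).unique (hG.2 _ (interior_subset ht))
  have h := congrFun (hA.eq_of_eventuallyEq hB hnear) 1
  simpa using h

/-- The entire continuation of the series with terms `f i` on `U` (meaningful when one exists). -/
def entireContinuation {ι E : Type*} [NormedAddCommGroup E] [NormedSpace ℂ E]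
    (f : ι → E → ℂ) (U : Set E) : E → ℂ :=
  Classical.epsilon (IsEntireContinuation f U)

/-- The half-plane `Re s > 1`. -/
def halfPlane : Set ℂ := {s | 1 < s.re}

/-- The region `Re s_j ≥ 1` for all six variables. -/
def sixRegion : Set (Fin 6 → ℂ) := {s | ∀ j, 1 ≤ (s j).re}

/-- The general term of the zeta-function of type `A₃` with the twist `i ^ (u l + v m + w n)`. -/
def zetaTerm (u v w : ℕ) (k : ℕ+ × ℕ+ × ℕ+) (s : Fin 6 → ℂ) : ℂ :=
  let l : ℕ := k.1
  let m : ℕ := k.2.1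
  let n : ℕ := k.2.2
  I ^ (u * l + v * m + w * n) /
    ((l : ℂ) ^ s 0 * (m : ℂ) ^ s 1 * (n : ℂ) ^ s 2 * ((l + m : ℕ) : ℂ) ^ s 3 *
      ((m + n : ℕ) : ℂ) ^ s 4 * ((l + m + n : ℕ) : ℂ) ^ s 5)

/-- `ζ₃(s, λ₁^∨; SU(4))`, the twist being `exp (2πi ⟨λ₁^∨, lλ₁ + mλ₂ + nλ₃⟩) = i ^ (3l + 2m + n)`. -/
def zetaLambda1 : (Fin 6 → ℂ) → ℂ := entireContinuation (zetaTerm 3 2 1) sixRegion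

/-- `ζ₃(s, λ₃^∨; SU(4))`, the twist being `exp (2πi ⟨λ₃^∨, lλ₁ + mλ₂ + nλ₃⟩) = i ^ (l + 2m + 3n)`. -/
def zetaLambda3 : (Fin 6 → ℂ) → ℂ := entireContinuation (zetaTerm 1 2 3) sixRegion

/-- The general term of `Λ(s; x) = ∑_{m ≠ 0} x ^ m m ^ (-s)`; for `m < 0` the complex power is
`exp (-s (log |m| + πi))`. -/
def lambdaTerm (x : ℂ) (m : {m : ℤ // m ≠ 0}) (s : ℂ) : ℂ :=
  x ^ (m : ℤ) * ((m : ℤ) : ℂ) ^ (-s)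

/-- `Λ(s; x)`, used for `x = ± i`. -/
def bigLambda (x : ℂ) : ℂ → ℂ := entireContinuation (lambdaTerm x) halfPlane

/-- The general term of `𝔗(p, s, q; x, y)`, summed over `l ≠ 0`, `m ≥ 1`, `l + m ≠ 0`. -/
def torTerm (x y : ℂ) (p q : ℕ) (k : {k : ℤ × ℕ // k.1 ≠ 0 ∧ 1 ≤ k.2 ∧ k.1 + k.2 ≠ 0})
    (s : ℂ) : ℂ :=
  let l : ℤ := k.1.1
  let m : ℕ := k.1.2
  x ^ l * y ^ m / ((l : ℂ) ^ p * (m : ℂ) ^ s * ((l + m : ℤ) : ℂ) ^ q)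

/-- `𝔗(p, s, q; x, y)`, used for `(x, y) = (-1, ± i), (± i, -1), (± i, ∓ i)`. -/
def tor (x y : ℂ) (p : ℕ) (s : ℂ) (q : ℕ) : ℂ :=
  entireContinuation (torTerm x y p q) halfPlane s

/-- The twelve-term signed sum of a function `Z` of six variables. -/
def signedSum (Z : (Fin 6 → ℂ) → ℂ) (p q a b c : ℕ) (s : ℂ) : ℂ :=
  Z ![p, q, s, a, b, c]
  + (-1) ^ p * Z ![p, a, s, q, c, b]
  + (-1) ^ (p + a) * Z ![q, a, c, p, s, b]
  + (-1) ^ (p + a + c) * Z ![q, s, c, b, a, p]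
  + (-1) ^ q * Z ![a, q, b, p, s, c]
  + (-1) ^ (q + b) * Z ![a, s, b, c, q, p]
  + (-1) ^ (q + a) * Z ![a, p, b, q, c, s]
  + (-1) ^ (q + a + b) * Z ![a, c, b, s, p, q]
  + (-1) ^ (q + a + b + c) * Z ![s, c, p, a, b, q]
  + (-1) ^ (p + q + a) * Z ![q, p, c, a, b, s]
  + (-1) ^ (p + q + a + c) * Z ![q, b, c, s, p, a]
  + (-1) ^ (p + q + a + b + c) * Z ![s, b, p, q, c, a]

/-- The right side of the functional relations, in terms of a sequence `lam` and of three
functions `T₁, T₂, T₃` of `(p, s, q)`. All subtractions in `ℕ` are exact when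
`p, q, a, b, c ≥ 1`. -/
def rightSide (lam : ℕ → ℂ) (T₁ T₂ T₃ : ℕ → ℂ → ℕ → ℂ) (p q a b c : ℕ) (s : ℂ) : ℂ :=
  (-1) ^ p * ∑ j ∈ Finset.range (p + 1), lam j * (-1) ^ j *
      ∑ ω ∈ Finset.range (p - j + 1),
        ((ω + a - 1).choose ω : ℂ) * ((p + c - j - ω - 1).choose (c - 1) : ℂ) *
          T₁ (q + a + ω) s (p + b + c - j - ω)
  + (-1) ^ (p + a) * ∑ j ∈ Finset.range (c + 1), lam j *
      ∑ ω ∈ Finset.range (c - j + 1),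
        ((ω + a - 1).choose ω : ℂ) * ((p + c - j - ω - 1).choose (p - 1) : ℂ) *
          T₂ q (s + a + ω) (p + b + c - j - ω)
  + (-1) ^ p * ∑ j ∈ Finset.range (a + 1), lam j *
      ∑ ω ∈ Finset.range p,
        ((ω + a - j).choose ω : ℂ) * ((p + c - 2 - ω).choose (c - 1) : ℂ) *
          T₃ (q + a - j + ω + 1) s (p + b + c - 1 - ω)
  + (-1) ^ (p + a) * ∑ j ∈ Finset.range (a + 1), lam j * (-1) ^ j *
      ∑ ω ∈ Finset.range c,
        ((ω + a - j).choose ω : ℂ) * ((p + c - 2 - ω).choose (p - 1) : ℂ) *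
          T₃ q (s + a - j + ω + 1) (p + b + c - 1 - ω)

/-- `L(s, χ₄)` for the primitive Dirichlet character of conductor `4`. -/
def LChi4 (s : ℂ) : ℂ :=
  DirichletCharacter.LFunction (ZMod.χ₄.ringHomComp (Int.castRingHom ℂ)) s

/-- `φ(s) = (2 ^ (1 - s) - 1) ζ(s)`, with its value `- log 2` at the removable singularity
`s = 1`. -/
def phi (s : ℂ) : ℂ :=
  if s = 1 then -(Real.log 2 : ℂ) else (2 ^ (1 - s) - 1) * riemannZeta s

/-- `φ(s; ± 1/4) = 2 ^ (-s) φ(s) ± i L(s, χ₄)`, where `x = ± i`. -/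
def phiQuarter (x s : ℂ) : ℂ := 2 ^ (-s) * phi s + x * LChi4 s

/-- The value of `Λ(j; x)`, `x = ± i`, in terms of `ζ` and `L(·, χ₄)`. -/
def lambdaValue (x : ℂ) (j : ℕ) : ℂ :=
  if Even j then 2 ^ (1 - (j : ℂ)) * (2 ^ (1 - (j : ℂ)) - 1) * riemannZeta j
  else 2 * x * LChi4 j

/-- The expression of `𝔗(p, s, q; -1, y)`, `y = ± i`, in terms of `ζ` and `L(·, χ₄)`. -/
def torValue₁ (y : ℂ) (p : ℕ) (s : ℂ) (q : ℕ) : ℂ :=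
  2 * (-1) ^ p * ∑ k ∈ Finset.range (p / 2 + 1),
      phi (2 * k) * ((p + q - 1 - 2 * k).choose (q - 1) : ℂ) * phiQuarter y (s + p + q - 2 * k)
  + 2 * (-1) ^ p * ∑ k ∈ Finset.range (q / 2 + 1),
      phi (2 * k) * ((p + q - 1 - 2 * k).choose (p - 1) : ℂ) * phiQuarter (-y) (s + p + q - 2 * k)

/-- The expression of `𝔗(p, s, q; x, -1)`, `x = ± i`, in terms of `ζ` and `L(·, χ₄)`. -/
def torValue₂ (x : ℂ) (p : ℕ) (s : ℂ) (q : ℕ) : ℂ :=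
  (-1) ^ p * ∑ l ∈ Finset.range (p + 1),
      lambdaValue x l * (-1) ^ l * ((p + q - 1 - l).choose (q - 1) : ℂ) * phi (s + p + q - l)
  + (-1) ^ p * ∑ l ∈ Finset.range (q + 1),
      lambdaValue x l * ((p + q - 1 - l).choose (p - 1) : ℂ) * phiQuarter x (s + p + q - l)

/-- The expression of `𝔗(p, s, q; x, -x)`, `x = ± i`, in terms of `ζ` and `L(·, χ₄)`. -/
def torValue₃ (x : ℂ) (p : ℕ) (s : ℂ) (q : ℕ) : ℂ :=
  (-1) ^ p * ∑ l ∈ Finset.range (p + 1),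
      lambdaValue x l * (-1) ^ l * ((p + q - 1 - l).choose (q - 1) : ℂ) *
        phiQuarter (-x) (s + p + q - l)
  + (-1) ^ p * ∑ l ∈ Finset.range (q + 1),
      lambdaValue x l * ((p + q - 1 - l).choose (p - 1) : ℂ) * phi (s + p + q - l)

end

/-!
The proof rests on three facts.

*Continuation.* The denominator of `ζ₃` is a product of complex powers of the positive roots of
type `A₃`. Each finite difference of such a product in one variable gains a power of that
variable, locally uniformly in the exponents (`exists_norm_iterDiff_symb_le`). The twist is
`x ^ l y ^ m z ^ n` with `x, y, z ≠ 1`, so `N`-fold summation by parts in every variable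
multiplies the sum by `((1 - x) (1 - y) (1 - z)) ^ N ≠ 0` and makes the series converge normally
on any given ball of `ℂ⁶` once `N` is large (`exists_isEntireContinuation_zetaTerm`).

*Partial fractions.* In a product of negative integer powers of `l` and `l + m`, the partial
fraction decomposition in `l` separates the poles `0` and `-m`. Summed over `l ∈ ℤ` against
`x ^ l`, each pole contributes a number `Λ(j; x)`. The points at which a linear form vanishes are
left out of the summation; the resulting correction is exactly absorbed by the terms with `j = 0`,
since `Λ(0; x) = -1` is minus the term missing at the pole (`poleTerm`,
`inv_pow_mul_inv_pow_eq_sum_poleTerm`). For a pole of order `1` the sum over `l` converges only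
conditionally; the sums are therefore taken over symmetric intervals, and their values come from
`tendsto_sum_of_differentiable`. This evaluates `𝔗(p, s, q; x, y)` by one-variable functions
(`hasSum_torSummand`).

*Chambers.* Let `n` be the form to which the exponent `s` belongs. The summand `x ^ (l + 2m + 3n)
l ^ (-p) m ^ (-q) n ^ (-s) (l + m) ^ (-a) (m + n) ^ (-b) (l + m + n) ^ (-c)`, taken over all
integers `l, m` and all `n ≥ 1` at which no form vanishes, splits into twelve Weyl chambers. A
change of variables carries each chamber to the positive octant and the summand to that of `ζ₃` at
a permuted argument, with the sign produced by the forms which are negative there; the phase is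
preserved since `x ^ 4 = 1` (`sum_chamberTerm`). So the left side of the functional relation is
the sum over all chambers (`hasSum_rootSummand`). Summing over `l` first, by partial fractions
with the three poles `0`, `-m` and `-m - n`, gives the right side for `Re s > 1`
(`eq_rightSide_of_hasSum`), and the identity theorem gives it for all `s`. The relation for `λ₃`
is the case `x = i`; the one for `λ₁` is the case `x = -i`, because
`i ^ (3l + 2m + n) = (-i) ^ (l + 2m + 3n)`.
-/

noncomputable section
open Filter Topology Metric Finset

/-! ### Holomorphic functions on complex normed spaces -/

/-- Cauchy's estimate for the derivative on a ball of a complex normed space, obtained on complex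
lines. -/
theorem norm_fderiv_le_of_norm_le_on_ball {E : Type*} [NormedAddCommGroup E] [NormedSpace ℂ E]
    {f : E → ℂ} {x : E} {r C : ℝ} (hr : 0 < r) (hf : DifferentiableOn ℂ f (ball x r))
    (hC : ∀ y ∈ ball x r, ‖f y‖ ≤ C) : ‖fderiv ℂ f x‖ ≤ C * (2 / r) := by
  have hC0 : 0 ≤ C := (norm_nonneg _).trans (hC x (mem_ball_self hr))
  refine ContinuousLinearMap.opNorm_le_bound _ (by positivity) fun v => ?_
  rcases eq_or_ne v 0 with rfl | hv
  · simp
  have hv' : 0 < ‖v‖ := norm_pos_iff.2 hv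
  have hline : Differentiable ℂ (fun t : ℂ => x + t • v) := by fun_prop
  have hmem : ∀ t : ℂ, ‖t‖ ≤ r / (2 * ‖v‖) → x + t • v ∈ ball x r := by
    intro t ht
    rw [mem_ball, dist_eq_norm, add_sub_cancel_left, norm_smul]
    calc ‖t‖ * ‖v‖ ≤ r / (2 * ‖v‖) * ‖v‖ := by gcongr
      _ = r / 2 := by field_simp
      _ < r := by linarith
  have hd : DifferentiableAt ℂ f x := hf.differentiableAt (ball_mem_nhds x hr)
  have hderiv : HasDerivAt (fun t : ℂ => f (x + t • v)) (fderiv ℂ f x v) 0 := by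
    have h1 : HasDerivAt (fun t : ℂ => x + t • v) v 0 := by
      simpa using ((hasDerivAt_id (0 : ℂ)).smul_const v).const_add x
    have h2 : HasFDerivAt f (fderiv ℂ f x) (x + (0 : ℂ) • v) := by simpa using hd.hasFDerivAt
    exact h2.comp_hasDerivAt 0 h1
  have hcl : DifferentiableOn ℂ (fun t : ℂ => f (x + t • v)) (closedBall 0 (r / (2 * ‖v‖))) :=
    hf.comp hline.differentiableOn fun t ht => hmem t (by simpa using ht)
  have hbound := Complex.norm_deriv_le_of_forall_mem_sphere_norm_le (c := 0)
    (R := r / (2 * ‖v‖)) (C := C) (f := fun t : ℂ => f (x + t • v)) (by positivity)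
    (DifferentiableOn.diffContOnCl (by rwa [closure_ball _ (by positivity)]))
    (fun t ht => hC _ (hmem t (by simpa using (mem_sphere_zero_iff_norm.1 ht).le)))
  rw [hderiv.deriv] at hbound
  refine hbound.trans (le_of_eq ?_)
  field_simp

/-- Weierstrass' theorem for a normally convergent series of holomorphic functions on an open
subset of a complex normed space. -/
theorem differentiableOn_tsum_of_norm_le {α E : Type*} [NormedAddCommGroup E] [NormedSpace ℂ E]
    {f : α → E → ℂ} {u : α → ℝ} (hu : Summable u) {U : Set E} (hU : IsOpen U)
    (hf : ∀ i, DifferentiableOn ℂ (f i) U) (hb : ∀ i, ∀ s ∈ U, ‖f i s‖ ≤ u i) :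
    DifferentiableOn ℂ (fun s => ∑' i, f i s) U := by
  intro x hx
  obtain ⟨r, hr, hrU⟩ := Metric.isOpen_iff.1 hU x hx
  have hsub : ∀ y ∈ ball x (r / 2), ball y (r / 2) ⊆ U := fun y hy =>
    (ball_subset_ball' (by have := mem_ball.1 hy; linarith)).trans hrU
  have hpre : IsPreconnected (ball x (r / 2)) :=
    ((convex_ball (E := E) x (r / 2)).isPreconnected)
  refine (hasFDerivAt_tsum_of_isPreconnected (𝕜 := ℂ) (u := fun i => u i * (2 / (r / 2)))
    (s := ball x (r / 2)) (x₀ := x) (f' := fun i y => fderiv ℂ (f i) y)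
    (hu.mul_right _) isOpen_ball hpre ?_ ?_ (mem_ball_self (by positivity)) ?_
    (mem_ball_self (by positivity))).differentiableAt.differentiableWithinAt
  · intro i y hy
    exact ((hf i).differentiableAt (mem_of_superset (ball_mem_nhds y (by positivity))
      (hsub y hy))).hasFDerivAt
  · intro i y hy
    exact norm_fderiv_le_of_norm_le_on_ball (by positivity) ((hf i).mono (hsub y hy))
      fun z hz => hb i z (hsub y hy hz)
  · exact Summable.of_norm_bounded hu fun i => hb i x hx

/-- The identity theorem on a ball of a complex normed space. -/
theorem eqOn_ball_of_eqOn_nhds {E : Type*} [NormedAddCommGroup E] [NormedSpace ℂ E]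
    {F G : E → ℂ} {c x : E} {R : ℝ} (hF : DifferentiableOn ℂ F (ball c R))
    (hG : DifferentiableOn ℂ G (ball c R)) (hx : x ∈ ball c R) (h : F =ᶠ[𝓝 x] G) :
    Set.EqOn F G (ball c R) := by
  intro y hy
  have hline : Differentiable ℂ (fun t : ℂ => x + t • (y - x)) := by fun_prop
  set V : Set ℂ := (fun t : ℂ => x + t • (y - x)) ⁻¹' ball c R with hV
  have hVo : IsOpen V := isOpen_ball.preimage hline.continuous
  have hVc : Convex ℝ V := by
    intro s hs t ht a b ha hb hab
    have := convex_ball (E := E) c R hs ht ha hb hab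
    rw [hV, Set.mem_preimage]
    convert this using 1
    have hb' : b = 1 - a := by linarith
    subst hb'
    simp only [smul_add, add_smul, smul_assoc]
    rw [add_add_add_comm, ← add_smul]
    simp
  have h0 : (0 : ℂ) ∈ V := by simpa [hV] using hx
  have h1 : (1 : ℂ) ∈ V := by simpa [hV] using hy
  have hA : AnalyticOnNhd ℂ (fun t : ℂ => F (x + t • (y - x))) V :=
    (hF.comp hline.differentiableOn fun t ht => ht).analyticOnNhd hVo
  have hB : AnalyticOnNhd ℂ (fun t : ℂ => G (x + t • (y - x))) V :=
    (hG.comp hline.differentiableOn fun t ht => ht).analyticOnNhd hVo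
  have hnear : (fun t : ℂ => F (x + t • (y - x))) =ᶠ[𝓝 0] fun t : ℂ => G (x + t • (y - x)) := by
    have : Tendsto (fun t : ℂ => x + t • (y - x)) (𝓝 0) (𝓝 x) := by
      simpa using hline.continuous.tendsto (0 : ℂ)
    exact this.eventually h
  have := hA.eqOn_of_preconnected_of_eventuallyEq hB hVc.isPreconnected h0 hnear h1
  simpa using this

/-- Continuations to all balls around the origin glue to an entire continuation. -/
theorem exists_isEntireContinuation {ι E : Type*} [NormedAddCommGroup E] [NormedSpace ℂ E]
    {f : ι → E → ℂ} {U : Set E} (hU : (interior U).Nonempty)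
    (h : ∀ R : ℝ, ∃ F : E → ℂ, DifferentiableOn ℂ F (ball 0 R) ∧
      ∀ s ∈ U, s ∈ ball 0 R → HasSum (fun i => f i s) (F s)) :
    ∃ F, IsEntireContinuation f U F := by
  obtain ⟨x, hx⟩ := hU
  choose F hFd hFs using h
  have key : ∀ R R' : ℝ, ‖x‖ < R → R ≤ R' → Set.EqOn (F R) (F R') (ball 0 R) := by
    intro R R' hR hRR'
    have hxR : x ∈ ball (0 : E) R := by simpa using hR
    refine eqOn_ball_of_eqOn_nhds (hFd R) ((hFd R').mono (ball_subset_ball hRR')) hxR ?_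
    filter_upwards [isOpen_interior.mem_nhds hx, isOpen_ball.mem_nhds hxR] with y hy hyR
    exact (hFs R y (interior_subset hy) hyR).unique
      (hFs R' y (interior_subset hy) (ball_subset_ball hRR' hyR))
  refine ⟨fun s => F (‖x‖ + ‖s‖ + 1) s, fun s => ?_, fun s hs => hFs _ s hs ?_⟩
  · have hs : s ∈ ball (0 : E) (‖x‖ + ‖s‖ + 1) := by
      rw [mem_ball_zero_iff]; linarith [norm_nonneg x]
    refine ((hFd (‖x‖ + ‖s‖ + 1 + 1)).differentiableAt (isOpen_ball.mem_nhds
      (ball_subset_ball (by linarith) hs))).congr_of_eventuallyEq ?_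
    filter_upwards [isOpen_ball.mem_nhds (mem_ball_self (x := s) one_pos)] with y hy
    have hy' : ‖y‖ < ‖s‖ + 1 := by
      have := norm_sub_norm_le y s
      rw [mem_ball, dist_eq_norm] at hy
      linarith
    refine key _ _ (by linarith [norm_nonneg y]) (by linarith) ?_
    rw [mem_ball_zero_iff]; linarith [norm_nonneg x]
  · rw [mem_ball_zero_iff]; linarith [norm_nonneg x]

theorem isEntireContinuation_entireContinuation {ι E : Type*} [NormedAddCommGroup E]
    [NormedSpace ℂ E] {f : ι → E → ℂ} {U : Set E} (h : ∃ F, IsEntireContinuation f U F) :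
    IsEntireContinuation f U (entireContinuation f U) :=
  Classical.epsilon_spec h

/-! ### Differences of products of complex powers of linear forms -/

section Symbol

variable {ι κ : Type*} [Fintype κ]

/-- The product `∏ k, (∑ i ∈ S k, v i) ^ (-s k)` of complex powers of the linear forms attached to
a family `S` of sets of coordinates. -/
def symb (S : κ → Finset ι) (s : κ → ℂ) (v : ι → ℝ) : ℂ :=
  ∏ k, ((∑ i ∈ S k, v i : ℝ) : ℂ) ^ (-s k)

/-- The iterated forward difference along the coordinate directions in the list `L`. -/
def iterDiff [DecidableEq ι] (L : List ι) (f : (ι → ℝ) → ℂ) : (ι → ℝ) → ℂ :=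
  L.foldr (fun d g => fwdDiff (Pi.single d (1 : ℝ)) g) f

theorem iterDiff_cons [DecidableEq ι] (d : ι) (L : List ι) (f : (ι → ℝ) → ℂ) (v : ι → ℝ) :
    iterDiff (d :: L) f v = iterDiff L f (v + Pi.single d 1) - iterDiff L f v := rfl

theorem one_le_add_single [DecidableEq ι] {v : ι → ℝ} (hv : ∀ i, 1 ≤ v i) (d : ι) {t : ℝ}
    (ht : 0 ≤ t) (i : ι) :
    1 ≤ (v + Pi.single d t : ι → ℝ) i := by
  have : 0 ≤ (Pi.single d t : ι → ℝ) i := by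
    rcases eq_or_ne i d with rfl | h
    · simpa using ht
    · simp [h]
  simp only [Pi.add_apply]
  linarith [hv i]

theorem le_sum_of_mem {v : ι → ℝ} (hv : ∀ i, 1 ≤ v i) {T : Finset ι} {d : ι} (hd : d ∈ T) :
    v d ≤ ∑ i ∈ T, v i :=
  single_le_sum (f := v) (fun i _ => zero_le_one.trans (hv i)) hd

theorem one_le_sum {v : ι → ℝ} (hv : ∀ i, 1 ≤ v i) {T : Finset ι} (hT : T.Nonempty) :
    1 ≤ ∑ i ∈ T, v i := by
  obtain ⟨d, hd⟩ := hT
  exact (hv d).trans (le_sum_of_mem hv hd)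

theorem sum_add_single [DecidableEq ι] (v : ι → ℝ) (d : ι) (t : ℝ) (T : Finset ι) :
    ∑ i ∈ T, (v + Pi.single d t : ι → ℝ) i = ∑ i ∈ T, v i + if d ∈ T then t else 0 := by
  simp [sum_add_distrib]

theorem symb_add_single [DecidableEq κ] {S : κ → Finset ι} (s : κ → ℂ) {v : ι → ℝ} (k : κ)
    (hk : 1 ≤ ∑ i ∈ S k, v i) :
    symb S (s + Pi.single k 1) v = symb S s v * ((∑ i ∈ S k, v i : ℝ) : ℂ)⁻¹ := by
  have h0 : ((∑ i ∈ S k, v i : ℝ) : ℂ) ≠ 0 := by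
    exact_mod_cast (zero_lt_one.trans_le hk).ne'
  unfold symb
  rw [← mul_prod_erase univ _ (mem_univ k), ← mul_prod_erase univ _ (mem_univ k), mul_right_comm]
  congr 1
  · rw [Pi.add_apply, Pi.single_eq_same, neg_add, cpow_add _ _ h0, cpow_neg_one]
  · refine prod_congr rfl fun j hj => ?_
    rw [Pi.add_apply, Pi.single_eq_of_ne (ne_of_mem_erase hj), add_zero]

theorem hasDerivAt_symb [DecidableEq ι] [DecidableEq κ] {S : κ → Finset ι}
    (hS : ∀ k, (S k).Nonempty) (s : κ → ℂ) (d : ι) {v : ι → ℝ} (hv : ∀ i, 1 ≤ v i) {t : ℝ}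
    (ht : 0 ≤ t) :
    HasDerivAt (fun t : ℝ => symb S s (v + Pi.single d t))
      (∑ k, (if d ∈ S k then -s k else 0) * symb S (s + Pi.single k 1) (v + Pi.single d t)) t := by
  have hw : ∀ k, 1 ≤ ∑ i ∈ S k, (v + Pi.single d t : ι → ℝ) i := fun k =>
    one_le_sum (one_le_add_single hv d ht) (hS k)
  have hfac : ∀ k ∈ (univ : Finset κ), HasDerivAt
      (fun t : ℝ => ((∑ i ∈ S k, (v + Pi.single d t : ι → ℝ) i : ℝ) : ℂ) ^ (-s k))
      (-s k * ((∑ i ∈ S k, (v + Pi.single d t : ι → ℝ) i : ℝ) : ℂ) ^ (-s k - 1) *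
        (if d ∈ S k then 1 else 0)) t := by
    intro k _
    have h1 : HasDerivAt (fun t : ℝ => ((∑ i ∈ S k, (v + Pi.single d t : ι → ℝ) i : ℝ) : ℂ))
        (if d ∈ S k then 1 else 0) t := by
      simp only [sum_add_single]
      split_ifs
      · simpa using ((hasDerivAt_id t).const_add (∑ i ∈ S k, v i)).ofReal_comp
      · simpa using hasDerivAt_const t ((∑ i ∈ S k, v i : ℝ) : ℂ)
    have h2 : ((∑ i ∈ S k, (v + Pi.single d t : ι → ℝ) i : ℝ) : ℂ) ∈ slitPlane :=
      ofReal_mem_slitPlane.2 (zero_lt_one.trans_le (hw k))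
    exact (Complex.hasStrictDerivAt_cpow_const (c := -s k) h2).hasDerivAt.comp t h1
  have := HasDerivAt.fun_finsetProd hfac
  refine this.congr_deriv (sum_congr rfl fun k _ => ?_)
  rw [symb_add_single _ _ (hw k)]
  unfold symb
  rw [← mul_prod_erase univ _ (mem_univ k), cpow_sub _ _ (by
    exact_mod_cast (zero_lt_one.trans_le (hw k)).ne'), cpow_one, smul_eq_mul]
  split_ifs <;> ring

/-- Differences in the coordinate directions commute with the partial derivatives. -/
theorem hasDerivAt_iterDiff [DecidableEq ι] {f f' : (ι → ℝ) → ℂ} {d : ι}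
    (hf : ∀ v : ι → ℝ, (∀ i, 1 ≤ v i) → ∀ t : ℝ, 0 ≤ t →
      HasDerivAt (fun t : ℝ => f (v + Pi.single d t)) (f' (v + Pi.single d t)) t) (L : List ι) :
    ∀ v : ι → ℝ, (∀ i, 1 ≤ v i) → ∀ t : ℝ, 0 ≤ t →
      HasDerivAt (fun t : ℝ => iterDiff L f (v + Pi.single d t))
        (iterDiff L f' (v + Pi.single d t)) t := by
  induction L with
  | nil => exact hf
  | cons e L ih =>
    intro v hv t ht
    simp only [iterDiff_cons]
    refine HasDerivAt.sub ?_ (ih v hv t ht)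
    have := ih (v + Pi.single e 1) (one_le_add_single hv e zero_le_one) t ht
    simpa only [add_right_comm v] using this

theorem iterDiff_sum_mul [DecidableEq ι] (L : List ι) (c : κ → ℂ) (g : κ → (ι → ℝ) → ℂ) :
    iterDiff L (fun v => ∑ k, c k * g k v) = fun v => ∑ k, c k * iterDiff L (g k) v := by
  induction L with
  | nil => rfl
  | cons e L ih =>
    funext v
    simp only [iterDiff_cons, ih, mul_sub, sum_sub_distrib]

/-- A symbol varies by at most a constant factor when every linear form at most doubles. -/
theorem norm_symb_le_of_le {S : κ → Finset ι} (hS : ∀ k, (S k).Nonempty) {s : κ → ℂ} {R : ℝ}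
    (hs : ‖s‖ ≤ R) {v w : ι → ℝ} (hv : ∀ i, 1 ≤ v i) (hvw : ∀ i, v i ≤ w i)
    (hw : ∀ k, ∑ i ∈ S k, w i ≤ 2 * ∑ i ∈ S k, v i) :
    ‖symb S s w‖ ≤ (2 ^ R) ^ Fintype.card κ * ‖symb S s v‖ := by
  have hR : 0 ≤ R := (norm_nonneg s).trans hs
  unfold symb
  rw [norm_prod, norm_prod, ← card_univ, ← prod_const, ← prod_mul_distrib]
  refine prod_le_prod (fun _ _ => norm_nonneg _) fun k _ => ?_
  have h1 : 0 < ∑ i ∈ S k, v i := zero_lt_one.trans_le (one_le_sum hv (hS k))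
  have h2 : ∑ i ∈ S k, v i ≤ ∑ i ∈ S k, w i := sum_le_sum fun i _ => hvw i
  rw [norm_cpow_eq_rpow_re_of_pos (h1.trans_le h2), norm_cpow_eq_rpow_re_of_pos h1]
  have hre : |(-s k).re| ≤ R := (abs_re_le_norm _).trans (by
    rw [norm_neg]; exact (norm_le_pi_norm s k).trans hs)
  rcases le_total 0 (-s k).re with h | h
  · calc (∑ i ∈ S k, w i) ^ (-s k).re ≤ (2 * ∑ i ∈ S k, v i) ^ (-s k).re :=
          Real.rpow_le_rpow (h1.trans_le h2).le (hw k) h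
      _ = 2 ^ (-s k).re * (∑ i ∈ S k, v i) ^ (-s k).re := Real.mul_rpow (by norm_num) h1.le
      _ ≤ 2 ^ R * (∑ i ∈ S k, v i) ^ (-s k).re := by
          gcongr
          · norm_num
          · exact (le_abs_self _).trans hre
  · calc (∑ i ∈ S k, w i) ^ (-s k).re ≤ 1 * (∑ i ∈ S k, v i) ^ (-s k).re := by
          rw [one_mul]; exact Real.rpow_le_rpow_of_nonpos h1 h2 h
      _ ≤ 2 ^ R * (∑ i ∈ S k, v i) ^ (-s k).re := by
          gcongr
          exact Real.one_le_rpow (by norm_num) hR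

/-- Every difference in the direction `d` gains a factor `(v d)⁻¹`, locally uniformly in the
exponents. This holds since the partial derivatives of a symbol are combinations of symbols whose
exponents are raised by one at a form which involves the coordinate `d`. -/
theorem exists_norm_iterDiff_symb_le [DecidableEq ι] [DecidableEq κ] {S : κ → Finset ι}
    (hS : ∀ k, (S k).Nonempty) (L : List ι) :
    ∀ R : ℝ, ∃ C : ℝ, 0 ≤ C ∧ ∀ s : κ → ℂ, ‖s‖ ≤ R → ∀ v : ι → ℝ, (∀ i, 1 ≤ v i) →
      ‖iterDiff L (symb S s) v‖ ≤ C * ‖symb S s v‖ * (L.map fun d => (v d)⁻¹).prod := by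
  induction L with
  | nil =>
    intro R
    exact ⟨1, zero_le_one, fun s _ v _ => by simp [iterDiff]⟩
  | cons d L ih =>
    intro R
    obtain ⟨C, hC0, hC⟩ := ih (R + 1)
    set K : ℝ := (2 ^ |R|) ^ Fintype.card κ with hK
    refine ⟨Fintype.card κ * (|R| * C * K), by positivity, fun s hs v hv => ?_⟩
    have hR : ‖s‖ ≤ |R| := hs.trans (le_abs_self R)
    have hder : ∀ t : ℝ, 0 ≤ t → HasDerivAt
        (fun t : ℝ => iterDiff L (symb S s) (v + Pi.single d t))
        (∑ k, (if d ∈ S k then -s k else 0) *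
          iterDiff L (symb S (s + Pi.single k 1)) (v + Pi.single d t)) t := by
      intro t ht
      set f' : (ι → ℝ) → ℂ := fun w =>
        ∑ k, (if d ∈ S k then -s k else 0) * symb S (s + Pi.single k 1) w with hf'
      have h0 : ∀ u : ι → ℝ, (∀ i, 1 ≤ u i) → ∀ r : ℝ, 0 ≤ r →
          HasDerivAt (fun r : ℝ => symb S s (u + Pi.single d r)) (f' (u + Pi.single d r)) r :=
        fun u hu r hr => hasDerivAt_symb hS s d hu hr
      have h := hasDerivAt_iterDiff h0 L v hv t ht
      have h2 := congrFun (iterDiff_sum_mul L (fun k => if d ∈ S k then -s k else 0)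
        (fun k => symb S (s + Pi.single k 1))) (v + Pi.single d t)
      exact h2 ▸ h
    have hprod0 : ∀ w : ι → ℝ, (∀ i, 1 ≤ w i) → 0 ≤ (L.map fun e => (w e)⁻¹).prod := fun w hw =>
      List.prod_nonneg (by
        intro a ha
        obtain ⟨e, -, rfl⟩ := List.mem_map.1 ha
        exact inv_nonneg.2 (zero_le_one.trans (hw e)))
    have hb : ∀ t ∈ Set.Ico (0 : ℝ) 1,
        ‖∑ k, (if d ∈ S k then -s k else 0) *
          iterDiff L (symb S (s + Pi.single k 1)) (v + Pi.single d t)‖ ≤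
        Fintype.card κ * (|R| * C * K) * ‖symb S s v‖ * ((d :: L).map fun d => (v d)⁻¹).prod := by
      intro t ht
      have hw := one_le_add_single hv d ht.1
      have hvw : ∀ i, v i ≤ (v + Pi.single d t : ι → ℝ) i := by
        intro i
        rcases eq_or_ne i d with rfl | h
        · simpa using ht.1
        · simp [h]
      have hprod : (L.map fun e => ((v + Pi.single d t : ι → ℝ) e)⁻¹).prod ≤
          (L.map fun e => (v e)⁻¹).prod := by
        refine List.prod_map_le_prod_map₀ _ _ (fun e _ => ?_) fun e _ => ?_
        · exact inv_nonneg.2 (zero_le_one.trans (hw e))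
        · exact inv_anti₀ (zero_lt_one.trans_le (hv e)) (hvw e)
      have hsymb : ‖symb S s (v + Pi.single d t)‖ ≤ K * ‖symb S s v‖ := by
        refine norm_symb_le_of_le hS hR hv hvw fun k => ?_
        rw [sum_add_single]
        have := one_le_sum hv (hS k)
        split_ifs <;> linarith [ht.2]
      have hterm : ∀ k, ‖(if d ∈ S k then -s k else 0) *
          iterDiff L (symb S (s + Pi.single k 1)) (v + Pi.single d t)‖ ≤
          |R| * C * K * ‖symb S s v‖ * ((d :: L).map fun d => (v d)⁻¹).prod := by
        intro k
        have h0 : 0 ≤ ((d :: L).map fun d => (v d)⁻¹).prod := by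
          rw [List.map_cons, List.prod_cons]
          exact mul_nonneg (inv_nonneg.2 (zero_le_one.trans (hv d))) (hprod0 v hv)
        split_ifs with hd
        · have h1 : ‖s + Pi.single k 1‖ ≤ R + 1 := by
            refine (norm_add_le _ _).trans (add_le_add hs ?_)
            rw [Pi.norm_single]
            simp
          have hform : 1 ≤ ∑ i ∈ S k, (v + Pi.single d t : ι → ℝ) i := one_le_sum hw (hS k)
          have hvd : v d ≤ ∑ i ∈ S k, (v + Pi.single d t : ι → ℝ) i :=
            (hvw d).trans (le_sum_of_mem hw hd)
          have hv0 : 0 < v d := zero_lt_one.trans_le (hv d)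
          have h2 : ‖symb S (s + Pi.single k 1) (v + Pi.single d t)‖ ≤
              K * ‖symb S s v‖ * (v d)⁻¹ := by
            rw [symb_add_single _ _ hform, norm_mul, norm_inv, norm_real, Real.norm_eq_abs,
              abs_of_nonneg (by linarith)]
            gcongr
          rw [norm_mul, norm_neg, List.map_cons, List.prod_cons]
          calc ‖s k‖ * ‖iterDiff L (symb S (s + Pi.single k 1)) (v + Pi.single d t)‖
              ≤ |R| * (C * (K * ‖symb S s v‖ * (v d)⁻¹) * (L.map fun e => (v e)⁻¹).prod) := by
                refine mul_le_mul ((norm_le_pi_norm s k).trans hR) ?_ (norm_nonneg _)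
                  (abs_nonneg _)
                refine (hC _ h1 _ hw).trans ?_
                refine mul_le_mul ?_ hprod (hprod0 _ hw) (by positivity)
                gcongr
            _ = _ := by ring
        · rw [zero_mul, norm_zero]
          positivity
      refine (norm_sum_le _ _).trans ((sum_le_sum fun k _ => hterm k).trans (le_of_eq ?_))
      rw [sum_const, card_univ, nsmul_eq_mul]
      ring
    have := norm_image_sub_le_of_norm_deriv_le_segment_01'
      (fun t ht => (hder t ht.1).hasDerivWithinAt) hb
    rw [iterDiff_cons]
    simpa using this

theorem norm_symb_le {S : κ → Finset ι} {s : κ → ℂ} {A : ℕ} (hs : ‖s‖ ≤ A) {v : ι → ℝ}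
    {M : ℝ} (hM : ∀ k, ∑ i ∈ S k, v i ≤ M) (hv : ∀ k, 1 ≤ ∑ i ∈ S k, v i) :
    ‖symb S s v‖ ≤ M ^ (Fintype.card κ * A) := by
  unfold symb
  rw [norm_prod, mul_comm, pow_mul, ← card_univ, ← prod_const]
  refine prod_le_prod (fun _ _ => norm_nonneg _) fun k _ => ?_
  rw [norm_cpow_eq_rpow_re_of_pos (zero_lt_one.trans_le (hv k)), ← Real.rpow_natCast]
  have hre : (-s k).re ≤ A := (le_abs_self _).trans ((abs_re_le_norm _).trans (by
    rw [norm_neg]; exact (norm_le_pi_norm s k).trans hs))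
  exact (Real.rpow_le_rpow_of_exponent_le (hv k) hre).trans
    (Real.rpow_le_rpow (zero_le_one.trans (hv k)) (hM k) (Nat.cast_nonneg _))

theorem differentiable_symb {S : κ → Finset ι} {v : ι → ℝ} (hv : ∀ k, 1 ≤ ∑ i ∈ S k, v i) :
    Differentiable ℂ fun s : κ → ℂ => symb S s v := by
  have h : ∀ k, Differentiable ℂ fun s : κ → ℂ => ((∑ i ∈ S k, v i : ℝ) : ℂ) ^ (-s k) :=
    fun k => Differentiable.const_cpow (by fun_prop) (Or.inl (by
      exact_mod_cast (zero_lt_one.trans_le (hv k)).ne'))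
  classical
  intro s
  exact (HasFDerivAt.finsetProd fun k _ => (h k s).hasFDerivAt).differentiableAt

end Symbol

/-! ### Summation by parts -/

/-- The backward difference on `ℕ → ℂ`, sequences being extended by zero to the left of `0`. With
this convention summation by parts has no boundary terms. -/
def backDiff : AddMonoid.End (ℕ → ℂ) where
  toFun g l := g l - if l = 0 then 0 else g (l - 1)
  map_zero' := by funext l; simp
  map_add' g h := by
    funext l
    simp only [Pi.add_apply]
    split_ifs <;> ring

theorem backDiff_apply (g : ℕ → ℂ) (l : ℕ) :
    backDiff g l = g l - if l = 0 then 0 else g (l - 1) := rfl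

theorem backDiff_zero (g : ℕ → ℂ) : backDiff g 0 = g 0 := by
  simp [backDiff_apply]

theorem backDiff_succ (g : ℕ → ℂ) (l : ℕ) : backDiff g (l + 1) = g (l + 1) - g l := by
  simp [backDiff_apply]

/-- The value at `l` of the `N`-th backward difference. -/
def backDiffAt (N l : ℕ) : (ℕ → ℂ) →+ ℂ :=
  (Pi.evalAddMonoidHom (fun _ : ℕ => ℂ) l).comp (backDiff ^ N)

theorem backDiffAt_zero (l : ℕ) (g : ℕ → ℂ) : backDiffAt 0 l g = g l := rfl

theorem backDiffAt_succ (N l : ℕ) (g : ℕ → ℂ) :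
    backDiffAt (N + 1) l g = backDiffAt N l (backDiff g) := by
  simp only [backDiffAt, pow_succ]
  rfl

theorem backDiffAt_add_left (N : ℕ) : ∀ (g : ℕ → ℂ) (l : ℕ),
    backDiffAt N (l + N) g = (fwdDiff 1)^[N] g l := by
  induction N with
  | zero => intro g l; rfl
  | succ N ih =>
    intro g l
    have h : (fun k => backDiff g (k + 1)) = fwdDiff 1 g := by
      funext k
      rw [backDiff_succ]
      rfl
    rw [backDiffAt_succ, ← add_assoc, add_right_comm, ih, Function.iterate_succ_apply, ← h]
    exact (fwdDiff_iter_comp_add 1 (backDiff g) 1 N l).symm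

theorem norm_backDiffAt_le_of_forall_le (N : ℕ) : ∀ (g : ℕ → ℂ) (l : ℕ) (c : ℝ),
    (∀ k ≤ l, ‖g k‖ ≤ c) → ‖backDiffAt N l g‖ ≤ 2 ^ N * c := by
  induction N with
  | zero => intro g l c h; simpa [backDiffAt_zero] using h l le_rfl
  | succ N ih =>
    intro g l c h
    rw [backDiffAt_succ, pow_succ, mul_assoc]
    refine ih _ _ _ fun k hk => ?_
    rcases k with _ | k
    · rw [backDiff_zero]
      linarith [h 0 hk, (norm_nonneg _).trans (h 0 hk)]
    · rw [backDiff_succ]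
      refine (norm_sub_le _ _).trans ?_
      linarith [h (k + 1) hk, h k (by omega)]

/-- A bound for forward differences carries over to backward differences. Near the left boundary,
where the extension by zero interferes, `l` is bounded in terms of `N` and the bound for `g` itself
suffices. -/
theorem norm_backDiffAt_le {N A : ℕ} {c : ℝ} {g : ℕ → ℂ} (hc : 0 ≤ c)
    (h0 : ∀ l : ℕ, ‖g l‖ ≤ c * (l + 1) ^ A)
    (hN : ∀ l : ℕ, ‖(fwdDiff 1)^[N] g l‖ ≤ c * (l + 1) ^ A * ((l + 1 : ℝ)⁻¹) ^ N) (l : ℕ) :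
    ‖backDiffAt N l g‖ ≤ (2 * (N + 1)) ^ N * c * (l + 1) ^ A * ((l + 1 : ℝ)⁻¹) ^ N := by
  have hN1 : (1 : ℝ) ≤ 2 ^ N := one_le_pow₀ (by norm_num)
  rcases le_or_gt N l with h | h
  · obtain ⟨k, rfl⟩ := Nat.exists_eq_add_of_le' h
    rw [backDiffAt_add_left]
    refine (hN k).trans ?_
    have h1 : ((k + 1 : ℝ)⁻¹) ^ N ≤ (N + 1) ^ N * (((k + N : ℕ) + 1 : ℝ)⁻¹) ^ N := by
      rw [← mul_pow]
      refine pow_le_pow_left₀ (by positivity) ?_ N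
      rw [← div_eq_mul_inv, inv_eq_one_div, div_le_div_iff₀ (by positivity) (by positivity)]
      push_cast
      nlinarith [mul_nonneg (Nat.cast_nonneg (α := ℝ) N) (Nat.cast_nonneg (α := ℝ) k)]
    calc c * (k + 1) ^ A * ((k + 1 : ℝ)⁻¹) ^ N
        ≤ c * ((k + N : ℕ) + 1) ^ A * ((N + 1) ^ N * (((k + N : ℕ) + 1 : ℝ)⁻¹) ^ N) := by
          gcongr
          linarith [Nat.cast_nonneg (α := ℝ) N]
      _ ≤ 2 ^ N * (c * ((k + N : ℕ) + 1) ^ A * ((N + 1) ^ N * (((k + N : ℕ) + 1 : ℝ)⁻¹) ^ N)) :=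
          le_mul_of_one_le_left (by positivity) hN1
      _ = _ := by rw [mul_pow]; ring
  · have h1 : (1 : ℝ) ≤ (N + 1) ^ N * ((l + 1 : ℝ)⁻¹) ^ N := by
      rw [← mul_pow]
      refine one_le_pow₀ ?_
      rw [← div_eq_mul_inv, one_le_div (by positivity)]
      have : (l : ℝ) ≤ N := by exact_mod_cast h.le
      linarith
    calc ‖backDiffAt N l g‖ ≤ 2 ^ N * (c * (l + 1) ^ A) := by
          refine norm_backDiffAt_le_of_forall_le N g l _ fun k hk => (h0 k).trans ?_
          have : (k : ℝ) ≤ l := by exact_mod_cast hk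
          gcongr
      _ ≤ 2 ^ N * (c * (l + 1) ^ A) * ((N + 1) ^ N * ((l + 1 : ℝ)⁻¹) ^ N) :=
          le_mul_of_one_le_right (by positivity) h1
      _ = _ := by rw [mul_pow]; ring

theorem fwdDiff_iterate_map (μ : (ℕ → ℂ) →+ ℂ) (N : ℕ) (g : ℕ → ℕ → ℂ) (m : ℕ) :
    (fwdDiff 1)^[N] (fun m' => μ (fun l' => g l' m')) m =
      μ (fun l' => (fwdDiff 1)^[N] (fun m' => g l' m') m) := by
  have h : (fun l' => (fwdDiff 1)^[N] (fun m' => g l' m') m) =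
      ∑ k ∈ range (N + 1), ((-1 : ℤ) ^ (N - k) * (N.choose k : ℤ)) •
        (fun l' => g l' (m + k • 1)) := by
    funext l'
    rw [fwdDiff_iter_eq_sum_shift]
    simp
  rw [h, map_sum, fwdDiff_iter_eq_sum_shift]
  refine sum_congr rfl fun k _ => ?_
  rw [map_zsmul]

theorem hasSum_backDiff {α : Type*} {x : ℂ} (w : α → ℂ) {g : ℕ → α → ℂ} {T : ℂ}
    (h : HasSum (fun p : ℕ × α => x ^ (p.1 + 1) * w p.2 * g p.1 p.2) T) :
    HasSum (fun p : ℕ × α => x ^ (p.1 + 1) * w p.2 * backDiff (fun l => g l p.2) p.1)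
      ((1 - x) * T) := by
  have hinj : Function.Injective fun p : ℕ × α => (p.1 + 1, p.2) := by
    rintro ⟨a, b⟩ ⟨c, d⟩ hp
    simpa using hp
  have h1 : HasSum (fun p : ℕ × α =>
      x ^ (p.1 + 1) * w p.2 * if p.1 = 0 then 0 else g (p.1 - 1) p.2) (x * T) := by
    rw [← hinj.hasSum_iff]
    · refine (h.mul_left x).congr_fun fun p => ?_
      simp only [Function.comp, Nat.add_eq_zero_iff, one_ne_zero, and_false, if_false,
        Nat.add_sub_cancel]
      ring
    · rintro ⟨a, b⟩ hp
      rcases a with _ | a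
      · simp
      · exact absurd ⟨(a, b), rfl⟩ hp
  have h2 := h.sub h1
  rw [← one_sub_mul] at h2
  refine h2.congr_fun fun p => ?_
  rw [backDiff_apply]
  ring

/-- Summation by parts in the first variable, `N` times. -/
theorem hasSum_backDiffAt {α : Type*} {x : ℂ} (w : α → ℂ) (N : ℕ) : ∀ {g : ℕ → α → ℂ} {T : ℂ},
    HasSum (fun p : ℕ × α => x ^ (p.1 + 1) * w p.2 * g p.1 p.2) T →
    HasSum (fun p : ℕ × α => x ^ (p.1 + 1) * w p.2 * backDiffAt N p.1 (fun l => g l p.2))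
      ((1 - x) ^ N * T) := by
  induction N with
  | zero => intro g T h; simpa [backDiffAt_zero] using h
  | succ N ih =>
    intro g T h
    simp only [backDiffAt_succ]
    rw [pow_succ, mul_assoc]
    exact ih (g := fun l a => backDiff (fun l => g l a) l) (hasSum_backDiff w h)

theorem differentiable_backDiffAt {E : Type*} [NormedAddCommGroup E] [NormedSpace ℂ E] (N : ℕ) :
    ∀ {g : E → ℕ → ℂ}, (∀ l, Differentiable ℂ fun s => g s l) → ∀ l,
      Differentiable ℂ fun s => backDiffAt N l (g s) := by
  induction N with
  | zero => intro g h l; simpa [backDiffAt_zero] using h l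
  | succ N ih =>
    intro g h l
    simp only [backDiffAt_succ]
    refine ih (g := fun s => backDiff (g s)) (fun k => ?_) l
    rcases k with _ | k
    · simpa only [backDiff_zero] using h 0
    · simp only [backDiff_succ]
      exact (h (k + 1)).fun_sub (h k)

/-! ### Backward differences in three variables -/

/-- The `N`-th backward differences in all three variables. -/
def tripleDiff (N : ℕ) (f : ℕ → ℕ → ℕ → ℂ) (l m n : ℕ) : ℂ :=
  backDiffAt N n fun n' => backDiffAt N m fun m' => backDiffAt N l fun l' => f l' m' n'

theorem hasSum_tripleDiff {x y z T : ℂ} {f : ℕ → ℕ → ℕ → ℂ} (N : ℕ)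
    (h : HasSum (fun k : ℕ × ℕ × ℕ =>
      x ^ (k.1 + 1) * (y ^ (k.2.1 + 1) * z ^ (k.2.2 + 1)) * f k.1 k.2.1 k.2.2) T) :
    HasSum (fun k : ℕ × ℕ × ℕ => x ^ (k.1 + 1) * (y ^ (k.2.1 + 1) * z ^ (k.2.2 + 1)) *
      tripleDiff N f k.1 k.2.1 k.2.2) (((1 - x) * (1 - y) * (1 - z)) ^ N * T) := by
  have h1 := hasSum_backDiffAt (x := x)
    (fun a : ℕ × ℕ => y ^ (a.1 + 1) * z ^ (a.2 + 1)) N (g := fun l a => f l a.1 a.2) h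
  let e : ℕ × ℕ × ℕ ≃ ℕ × ℕ × ℕ :=
    ⟨fun k => (k.2.1, k.1, k.2.2), fun k => (k.2.1, k.1, k.2.2), fun _ => rfl, fun _ => rfl⟩
  let e' : ℕ × ℕ × ℕ ≃ ℕ × ℕ × ℕ :=
    ⟨fun k => (k.2.2, k.2.1, k.1), fun k => (k.2.2, k.2.1, k.1), fun _ => rfl, fun _ => rfl⟩
  let e'' : ℕ × ℕ × ℕ ≃ ℕ × ℕ × ℕ :=
    ⟨fun k => (k.2.2, k.1, k.2.1), fun k => (k.2.1, k.2.2, k.1), fun _ => rfl, fun _ => rfl⟩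
  have h2 := hasSum_backDiffAt (x := y)
    (fun a : ℕ × ℕ => x ^ (a.1 + 1) * z ^ (a.2 + 1)) N
    (g := fun m a => backDiffAt N a.1 fun l' => f l' m a.2) (T := (1 - x) ^ N * T) (by
      rw [← e.hasSum_iff]
      convert h1 using 2 with k
      simp only [e, Function.comp, Equiv.coe_fn_mk]
      ring)
  have h3 := hasSum_backDiffAt (x := z)
    (fun a : ℕ × ℕ => x ^ (a.2 + 1) * y ^ (a.1 + 1)) N
    (g := fun n a => backDiffAt N a.1 fun m' => backDiffAt N a.2 fun l' => f l' m' n)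
    (T := (1 - y) ^ N * ((1 - x) ^ N * T)) (by
      rw [← e''.hasSum_iff]
      convert h2 using 2 with k
      simp only [e'', Function.comp, Equiv.coe_fn_mk]
      ring)
  rw [← e'.hasSum_iff] at h3
  convert h3 using 1
  · funext k
    simp only [e', Function.comp, Equiv.coe_fn_mk, tripleDiff]
    ring
  · rw [mul_pow, mul_pow]
    ring

/-- Mixed differences of orders `0` and `N` in each variable are enough to bound the triple
difference: order `0` serves near the boundary and order `N` away from it. -/
theorem norm_tripleDiff_le {N A : ℕ} {c : ℝ} {f : ℕ → ℕ → ℕ → ℂ} (hc : 0 ≤ c)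
    (h : ∀ i ∈ ({0, N} : Set ℕ), ∀ j ∈ ({0, N} : Set ℕ), ∀ k ∈ ({0, N} : Set ℕ), ∀ l m n : ℕ,
      ‖(fwdDiff 1)^[i] (fun l' => (fwdDiff 1)^[j] (fun m' =>
        (fwdDiff 1)^[k] (fun n' => f l' m' n') n) m) l‖ ≤
      c * (l + 1) ^ A * (m + 1) ^ A * (n + 1) ^ A *
        (((l + 1 : ℝ)⁻¹) ^ i * ((m + 1 : ℝ)⁻¹) ^ j * ((n + 1 : ℝ)⁻¹) ^ k)) (l m n : ℕ) :
    ‖tripleDiff N f l m n‖ ≤ ((2 * (N + 1)) ^ N) ^ 3 * c *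
      ((l + 1) ^ A * ((l + 1 : ℝ)⁻¹) ^ N) * ((m + 1) ^ A * ((m + 1 : ℝ)⁻¹) ^ N) *
        ((n + 1) ^ A * ((n + 1 : ℝ)⁻¹) ^ N) := by
  have h0 : (0 : ℕ) ∈ ({0, N} : Set ℕ) := by simp
  have hN : N ∈ ({0, N} : Set ℕ) := by simp
  set K : ℝ := (2 * (N + 1)) ^ N with hK
  have hK0 : 0 ≤ K := by positivity
  have step1 : ∀ j ∈ ({0, N} : Set ℕ), ∀ k ∈ ({0, N} : Set ℕ), ∀ m n : ℕ,
      ‖backDiffAt N l (fun l' => (fwdDiff 1)^[j] (fun m' =>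
        (fwdDiff 1)^[k] (fun n' => f l' m' n') n) m)‖ ≤
      K * c * ((l + 1) ^ A * ((l + 1 : ℝ)⁻¹) ^ N) * (m + 1) ^ A * (n + 1) ^ A *
        (((m + 1 : ℝ)⁻¹) ^ j * ((n + 1 : ℝ)⁻¹) ^ k) := by
    intro j hj k hk m n
    refine (norm_backDiffAt_le (A := A) (c := c * (m + 1) ^ A * (n + 1) ^ A *
      (((m + 1 : ℝ)⁻¹) ^ j * ((n + 1 : ℝ)⁻¹) ^ k)) (by positivity) (fun l => ?_) (fun l => ?_)
      l).trans (le_of_eq (by ring))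
    · exact (h 0 h0 j hj k hk l m n).trans (le_of_eq (by ring))
    · exact (h N hN j hj k hk l m n).trans (le_of_eq (by ring))
  have step2 : ∀ k ∈ ({0, N} : Set ℕ), ∀ n : ℕ,
      ‖backDiffAt N m (fun m' => backDiffAt N l (fun l' =>
        (fwdDiff 1)^[k] (fun n' => f l' m' n') n))‖ ≤
      K ^ 2 * c * ((l + 1) ^ A * ((l + 1 : ℝ)⁻¹) ^ N) * ((m + 1) ^ A * ((m + 1 : ℝ)⁻¹) ^ N) *
        (n + 1) ^ A * ((n + 1 : ℝ)⁻¹) ^ k := by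
    intro k hk n
    refine (norm_backDiffAt_le (A := A) (c := K * c * ((l + 1) ^ A * ((l + 1 : ℝ)⁻¹) ^ N) *
      (n + 1) ^ A * ((n + 1 : ℝ)⁻¹) ^ k) (by positivity) (fun m => ?_) (fun m => ?_)
      m).trans (le_of_eq (by ring))
    · exact (step1 0 h0 k hk m n).trans (le_of_eq (by ring))
    · rw [fwdDiff_iterate_map]
      exact (step1 N hN k hk m n).trans (le_of_eq (by ring))
  refine (norm_backDiffAt_le (A := A) (c := K ^ 2 * c * ((l + 1) ^ A * ((l + 1 : ℝ)⁻¹) ^ N) *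
      ((m + 1) ^ A * ((m + 1 : ℝ)⁻¹) ^ N)) (by positivity) (fun n => ?_) (fun n => ?_)
      n).trans (le_of_eq (by ring))
  · exact (step2 0 h0 n).trans (le_of_eq (by ring))
  · rw [fwdDiff_iterate_map]
    simp only [fwdDiff_iterate_map (backDiffAt N l)]
    exact (step2 N hN n).trans (le_of_eq (by ring))

theorem differentiable_tripleDiff {E : Type*} [NormedAddCommGroup E] [NormedSpace ℂ E] (N : ℕ)
    {f : E → ℕ → ℕ → ℕ → ℂ} (h : ∀ l m n, Differentiable ℂ fun s => f s l m n) (l m n : ℕ) :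
    Differentiable ℂ fun s => tripleDiff N (f s) l m n :=
  differentiable_backDiffAt N (fun n' => differentiable_backDiffAt N (fun m' =>
    differentiable_backDiffAt N (fun l' => h l' m' n') l) m) n

/-! ### The zeta-functions as entire functions -/

/-- The positive roots of type `A₃`, as sets of coordinates. -/
def rootSupport : Fin 6 → Finset (Fin 3) := ![{0}, {1}, {2}, {0, 1}, {1, 2}, {0, 1, 2}]

/-- The point of `ℝ³` with coordinates `l + 1`, `m + 1`, `n + 1`. -/
def gridPoint (l m n : ℕ) : Fin 3 → ℝ := ![l + 1, m + 1, n + 1]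

theorem rootSupport_nonempty (k : Fin 6) : (rootSupport k).Nonempty := by
  fin_cases k <;> simp [rootSupport]

theorem one_le_gridPoint (l m n : ℕ) (i : Fin 3) : 1 ≤ gridPoint l m n i := by
  fin_cases i <;> simp [gridPoint]

theorem symb_gridPoint (s : Fin 6 → ℂ) (l m n : ℕ) :
    symb rootSupport s (gridPoint l m n) =
      (((l + 1 : ℕ) : ℂ) ^ s 0 * ((m + 1 : ℕ) : ℂ) ^ s 1 * ((n + 1 : ℕ) : ℂ) ^ s 2 *
        ((l + 1 + (m + 1) : ℕ) : ℂ) ^ s 3 * ((m + 1 + (n + 1) : ℕ) : ℂ) ^ s 4 *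
        ((l + 1 + (m + 1) + (n + 1) : ℕ) : ℂ) ^ s 5)⁻¹ := by
  simp only [symb, Fin.prod_univ_six, cpow_neg, mul_inv, rootSupport, gridPoint]
  simp [add_assoc]

theorem iterate_fwdDiff_comp {ι : Type*} [DecidableEq ι] {d : ι} {g : (ι → ℝ) → ℂ}
    {v : ℕ → ι → ℝ} (hv : ∀ k, v (k + 1) = v k + Pi.single d 1) (i : ℕ) : ∀ k,
    (fwdDiff 1)^[i] (fun k' => g (v k')) k = iterDiff (List.replicate i d) g (v k) := by
  induction i with
  | zero => intro k; rfl
  | succ i ih =>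
    intro k
    rw [Function.iterate_succ_apply', fwdDiff, ih, ih, hv, List.replicate_succ, iterDiff_cons]

theorem iterDiff_append {ι : Type*} [DecidableEq ι] (L L' : List ι) (g : (ι → ℝ) → ℂ) :
    iterDiff L (iterDiff L' g) = iterDiff (L ++ L') g := by
  simp [iterDiff]

theorem iterate_fwdDiff_gridPoint (g : (Fin 3 → ℝ) → ℂ) (i j k l m n : ℕ) :
    (fwdDiff 1)^[i] (fun l' => (fwdDiff 1)^[j] (fun m' =>
        (fwdDiff 1)^[k] (fun n' => g (gridPoint l' m' n')) n) m) l =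
      iterDiff (List.replicate i 0 ++ (List.replicate j 1 ++ List.replicate k 2)) g
        (gridPoint l m n) := by
  have h0 : ∀ m n l, gridPoint (l + 1) m n = gridPoint l m n + Pi.single 0 1 := by
    intro m n l; ext i; fin_cases i <;> simp [gridPoint]
  have h1 : ∀ l n m, gridPoint l (m + 1) n = gridPoint l m n + Pi.single 1 1 := by
    intro l n m; ext i; fin_cases i <;> simp [gridPoint]
  have h2 : ∀ l m n, gridPoint l m (n + 1) = gridPoint l m n + Pi.single 2 1 := by
    intro l m n; ext i; fin_cases i <;> simp [gridPoint]
  simp only [iterate_fwdDiff_comp (h2 _ _)]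
  simp only [iterate_fwdDiff_comp (v := fun m => gridPoint _ m n) (h1 _ n), iterDiff_append]
  rw [iterate_fwdDiff_comp (v := fun l => gridPoint l m n) (h0 m n), iterDiff_append]

/-- On each ball of exponents, differences of a suitable order `N` are dominated by a convergent
series. -/
theorem exists_norm_tripleDiff_symb_le (R : ℝ) : ∃ (N : ℕ) (C : ℝ), ∀ s : Fin 6 → ℂ, ‖s‖ ≤ R →
    ∀ l m n : ℕ, ‖tripleDiff N (fun l m n => symb rootSupport s (gridPoint l m n)) l m n‖ ≤
      C * (((l + 1 : ℝ)⁻¹) ^ 2 * (((m + 1 : ℝ)⁻¹) ^ 2 * ((n + 1 : ℝ)⁻¹) ^ 2)) := by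
  obtain ⟨a, ha⟩ := exists_nat_ge R
  -- on the ball the symbol grows at most like `((l + 1) (m + 1) (n + 1)) ^ A`; a gain of `A + 2`
  -- powers in each variable leaves convergent series
  set A := Fintype.card (Fin 6) * a with hA
  set N := A + 2 with hN
  choose C hC0 hC using fun L => exists_norm_iterDiff_symb_le rootSupport_nonempty L R
  let L : ℕ → ℕ → ℕ → List (Fin 3) := fun i j k =>
    List.replicate i 0 ++ (List.replicate j 1 ++ List.replicate k 2)
  set D : ℝ := ∑ i ∈ {0, N}, ∑ j ∈ {0, N}, ∑ k ∈ {0, N}, C (L i j k) with hD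
  have hCD : ∀ i ∈ ({0, N} : Finset ℕ), ∀ j ∈ ({0, N} : Finset ℕ), ∀ k ∈ ({0, N} : Finset ℕ),
      C (L i j k) ≤ D := by
    intro i hi j hj k hk
    refine le_trans ?_ (single_le_sum (f := fun i => ∑ j ∈ {0, N}, ∑ k ∈ {0, N}, C (L i j k))
      (fun i _ => sum_nonneg fun j _ => sum_nonneg fun k _ => hC0 _) hi)
    refine le_trans ?_ (single_le_sum (f := fun j => ∑ k ∈ {0, N}, C (L i j k))
      (fun j _ => sum_nonneg fun k _ => hC0 _) hj)
    exact single_le_sum (f := fun k => C (L i j k)) (fun k _ => hC0 _) hk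
  have hD0 : 0 ≤ D := (hC0 _).trans (hCD 0 (by simp) 0 (by simp) 0 (by simp))
  refine ⟨N, ((2 * (N + 1)) ^ N) ^ 3 * (D * 3 ^ A), fun s hs l m n => ?_⟩
  have hbound := norm_tripleDiff_le (N := N) (A := A) (c := D * 3 ^ A)
    (f := fun l m n => symb rootSupport s (gridPoint l m n)) (by positivity) (by
      intro i hi j hj k hk l m n
      rw [iterate_fwdDiff_gridPoint]
      refine (hC (L i j k) s hs _ (one_le_gridPoint l m n)).trans ?_
      have h1 : ‖symb rootSupport s (gridPoint l m n)‖ ≤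
          (3 * ((l + 1) * (m + 1) * (n + 1))) ^ A := by
        refine norm_symb_le (hs.trans ha) (fun r => ?_) fun r =>
          one_le_sum (one_le_gridPoint l m n) (rootSupport_nonempty r)
        have : ∑ i ∈ rootSupport r, gridPoint l m n i ≤ ∑ i, gridPoint l m n i :=
          sum_le_sum_of_subset_of_nonneg (subset_univ _) fun i _ _ =>
            zero_le_one.trans (one_le_gridPoint l m n i)
        refine this.trans ?_
        simp only [Fin.sum_univ_three, gridPoint, Matrix.cons_val]
        have hl := Nat.cast_nonneg (α := ℝ) l
        have hm := Nat.cast_nonneg (α := ℝ) m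
        have hn := Nat.cast_nonneg (α := ℝ) n
        nlinarith [mul_nonneg hl hm, mul_nonneg hm hn, mul_nonneg hl hn,
          mul_nonneg (mul_nonneg hl hm) hn]
      have h2 : ((L i j k).map fun d => (gridPoint l m n d)⁻¹).prod =
          ((l + 1 : ℝ)⁻¹) ^ i * ((m + 1 : ℝ)⁻¹) ^ j * ((n + 1 : ℝ)⁻¹) ^ k := by
        simp [L, gridPoint, mul_assoc]
      have h3 := hCD i (by simpa using hi) j (by simpa using hj) k (by simpa using hk)
      rw [h2]
      calc _ ≤ D * (3 * ((l + 1) * (m + 1) * (n + 1))) ^ A *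
            (((l + 1 : ℝ)⁻¹) ^ i * ((m + 1 : ℝ)⁻¹) ^ j * ((n + 1 : ℝ)⁻¹) ^ k) := by gcongr
        _ = _ := by rw [mul_pow, mul_pow, mul_pow]; ring) l m n
  refine hbound.trans (le_of_eq ?_)
  have hcancel : ∀ l : ℕ, ((l + 1 : ℝ)) ^ A * ((l + 1 : ℝ)⁻¹) ^ N = ((l + 1 : ℝ)⁻¹) ^ 2 := by
    intro l
    have : (l + 1 : ℝ) ≠ 0 := by positivity
    rw [hN, pow_add, ← mul_assoc, ← mul_pow, mul_inv_cancel₀ this, one_pow, one_mul]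
  rw [hcancel, hcancel, hcancel]
  ring

theorem summable_inv_sq : Summable fun l : ℕ => ((l + 1 : ℝ)⁻¹) ^ 2 := by
  have := (summable_nat_add_iff 1).2 (Real.summable_nat_pow_inv.2 (by norm_num : 1 < 2))
  refine this.congr fun l => ?_
  push_cast
  rw [inv_pow]

theorem summable_triple_inv_sq : Summable fun k : ℕ × ℕ × ℕ =>
    ((k.1 + 1 : ℝ)⁻¹) ^ 2 * (((k.2.1 + 1 : ℝ)⁻¹) ^ 2 * ((k.2.2 + 1 : ℝ)⁻¹) ^ 2) := by
  have h := summable_inv_sq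
  have h2 := h.mul_of_nonneg h (fun _ => by positivity) (fun _ => by positivity)
  exact h.mul_of_nonneg h2 (fun _ => by positivity) (fun _ => by positivity)

theorem norm_symb_gridPoint_le {s : Fin 6 → ℂ} (hs : s ∈ sixRegion) (l m n : ℕ) :
    ‖symb rootSupport s (gridPoint l m n)‖ ≤
      ((l + 1 : ℝ)⁻¹) ^ 2 * (((m + 1 : ℝ)⁻¹) ^ 2 * ((n + 1 : ℝ)⁻¹) ^ 2) := by
  have key : ∀ (u : ℕ) (w : ℝ) (z : ℂ), 0 < w → w ≤ u → 1 ≤ w → 1 ≤ z.re →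
      ‖(((u : ℂ)) ^ z)⁻¹‖ ≤ w⁻¹ := by
    intro u w z hw0 hwu hw1 hz
    have hu : (1 : ℝ) ≤ u := hw1.trans hwu
    rw [norm_inv]
    refine inv_anti₀ hw0 ?_
    have hu0 : 0 < u := by exact_mod_cast zero_lt_one.trans_le hu
    rw [norm_natCast_cpow_of_pos hu0]
    calc w ≤ (u : ℝ) ^ (1 : ℝ) := by rwa [Real.rpow_one]
      _ ≤ (u : ℝ) ^ z.re := Real.rpow_le_rpow_of_exponent_le hu hz
  have hl := Nat.cast_nonneg (α := ℝ) l
  have hm := Nat.cast_nonneg (α := ℝ) m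
  have hn := Nat.cast_nonneg (α := ℝ) n
  rw [symb_gridPoint]
  simp only [mul_inv, norm_mul]
  have e0 := key (l + 1) (l + 1) (s 0) (by positivity) (by push_cast; linarith) (by linarith) (hs 0)
  have e1 := key (m + 1) (m + 1) (s 1) (by positivity) (by push_cast; linarith) (by linarith) (hs 1)
  have e2 := key (n + 1) (n + 1) (s 2) (by positivity) (by push_cast; linarith) (by linarith) (hs 2)
  have e3 := key (l + 1 + (m + 1)) (l + 1) (s 3) (by positivity) (by push_cast; linarith)
    (by linarith) (hs 3)
  have e4 := key (m + 1 + (n + 1)) (m + 1) (s 4) (by positivity) (by push_cast; linarith)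
    (by linarith) (hs 4)
  have e5 := key (l + 1 + (m + 1) + (n + 1)) (n + 1) (s 5) (by positivity) (by push_cast; linarith)
    (by linarith) (hs 5)
  -- the forms `l + m`, `m + n`, `l + m + n` are bounded below by `l`, `m`, `n` respectively
  calc _ ≤ (l + 1 : ℝ)⁻¹ * (m + 1 : ℝ)⁻¹ * (n + 1 : ℝ)⁻¹ * (l + 1 : ℝ)⁻¹ * (m + 1 : ℝ)⁻¹ *
        (n + 1 : ℝ)⁻¹ := by gcongr
    _ = _ := by ring

theorem interior_sixRegion_nonempty : (interior sixRegion).Nonempty := by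
  refine ⟨fun _ => 2, mem_interior.2 ⟨{s | ∀ j, 1 < (s j).re}, fun s hs j => (hs j).le, ?_, ?_⟩⟩
  · simp only [Set.ofPred_forall]
    exact isOpen_iInter_of_finite fun j =>
      isOpen_lt continuous_const (continuous_re.comp (continuous_apply j))
  · intro j; simp

/-- A zeta-function of type `A₃` twisted by a character which is nontrivial on each of the three
fundamental variables extends to an entire function. -/
theorem exists_isEntireContinuation_zetaTerm {u v w : ℕ} (hu : I ^ u ≠ 1) (hv : I ^ v ≠ 1)
    (hw : I ^ w ≠ 1) : ∃ F, IsEntireContinuation (zetaTerm u v w) sixRegion F := by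
  refine exists_isEntireContinuation interior_sixRegion_nonempty fun R => ?_
  obtain ⟨N, C, hC⟩ := exists_norm_tripleDiff_symb_le R
  set x := I ^ u with hx
  set y := I ^ v with hy
  set z := I ^ w with hz
  have hxn : ∀ l m n : ℕ, ‖x ^ (l + 1) * (y ^ (m + 1) * z ^ (n + 1))‖ = 1 := by
    intro l m n
    simp [x, y, z]
  set P : ℂ := ((1 - x) * (1 - y) * (1 - z)) ^ N with hP
  have hP0 : P ≠ 0 := pow_ne_zero _ (mul_ne_zero (mul_ne_zero (sub_ne_zero.2 hu.symm)
    (sub_ne_zero.2 hv.symm)) (sub_ne_zero.2 hw.symm))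
  let g : (Fin 6 → ℂ) → ℕ → ℕ → ℕ → ℂ := fun s l m n => symb rootSupport s (gridPoint l m n)
  refine ⟨fun s => P⁻¹ * ∑' k : ℕ × ℕ × ℕ, x ^ (k.1 + 1) * (y ^ (k.2.1 + 1) * z ^ (k.2.2 + 1)) *
    tripleDiff N (g s) k.1 k.2.1 k.2.2, ?_, ?_⟩
  · refine DifferentiableOn.const_mul (differentiableOn_tsum_of_norm_le
      (summable_triple_inv_sq.mul_left C) isOpen_ball (fun k => ?_) fun k s hs => ?_) _
    · refine (Differentiable.const_mul (differentiable_tripleDiff N (fun l m n => ?_) _ _ _)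
        _).differentiableOn
      exact differentiable_symb fun r => one_le_sum (one_le_gridPoint l m n)
        (rootSupport_nonempty r)
    · rw [norm_mul, hxn, one_mul]
      exact hC s (by simpa using (mem_ball_zero_iff.1 hs).le) _ _ _
  · intro s hs _
    have hsum : Summable fun k : ℕ × ℕ × ℕ =>
        x ^ (k.1 + 1) * (y ^ (k.2.1 + 1) * z ^ (k.2.2 + 1)) * g s k.1 k.2.1 k.2.2 := by
      refine Summable.of_norm_bounded summable_triple_inv_sq fun k => ?_
      rw [norm_mul, hxn, one_mul]
      exact norm_symb_gridPoint_le hs _ _ _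
    have h1 := hsum.hasSum
    beta_reduce
    rw [(hasSum_tripleDiff N h1).tsum_eq, inv_mul_cancel_left₀ hP0]
    let e : ℕ+ × ℕ+ × ℕ+ ≃ ℕ × ℕ × ℕ :=
      Equiv.pnatEquivNat.prodCongr (Equiv.pnatEquivNat.prodCongr Equiv.pnatEquivNat)
    rw [← e.symm.hasSum_iff]
    convert h1 using 2 with k
    obtain ⟨l, m, n⟩ := k
    simp only [Function.comp, zetaTerm, g, symb_gridPoint, x, y, z, ← pow_mul, ← pow_add,
      div_eq_mul_inv, e, Equiv.prodCongr_symm, Equiv.prodCongr_apply, Prod.map,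
      Equiv.pnatEquivNat_symm_apply, Nat.succPNat_coe, Nat.succ_eq_add_one, add_assoc]

/-! ### The one-variable functions `∑ x ^ m m ^ (-s)` -/

theorem hasSum_riemannZeta {s : ℂ} (hs : 1 < s.re) :
    HasSum (fun n : ℕ => (n : ℂ) ^ (-s)) (riemannZeta s) := by
  have h := (Complex.summable_one_div_nat_cpow.2 hs).hasSum
  rw [← zeta_eq_tsum_one_div_nat_cpow hs] at h
  exact h.congr_fun fun n => by rw [cpow_neg, one_div]

/-- The even part of a Dirichlet series is `2 ^ (-s)` times the series with halved indices. -/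
theorem hasSum_even_of_hasSum {f : ℕ → ℂ} {T s : ℂ}
    (h : HasSum (fun k : ℕ => f k * (k : ℂ) ^ (-s)) T) :
    HasSum (fun n : ℕ => if Even n then f (n / 2) * (n : ℂ) ^ (-s) else 0) (2 ^ (-s) * T) := by
  have hinj : Function.Injective fun k : ℕ => 2 * k := fun a b h => by simpa using h
  rw [← hinj.hasSum_iff]
  · refine (h.mul_left (2 ^ (-s))).congr_fun fun k => ?_
    have : ((2 * k : ℕ) : ℂ) ^ (-s) = 2 ^ (-s) * (k : ℂ) ^ (-s) := by
      rw [Nat.cast_mul, natCast_mul_natCast_cpow]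
      simp
    simp only [Function.comp, even_two, Even.mul_right, if_true, this]
    rw [Nat.mul_div_cancel_left k two_pos]
    ring
  · intro n hn
    rw [if_neg]
    rintro ⟨k, rfl⟩
    exact hn ⟨k, by simp [two_mul]⟩

theorem hasSum_phi {s : ℂ} (hs : 1 < s.re) :
    HasSum (fun n : ℕ => (-1) ^ n * (n : ℂ) ^ (-s)) (phi s) := by
  have hs1 : s ≠ 1 := by rintro rfl; simp at hs
  have h := hasSum_riemannZeta hs
  have h2 := (hasSum_even_of_hasSum (f := fun _ => 1) (by simpa using h)).mul_left 2
  have h3 := h2.sub h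
  have hval : 2 * (2 ^ (-s) * riemannZeta s) - riemannZeta s = phi s := by
    rw [phi, if_neg hs1, sub_eq_add_neg 1 s, cpow_add _ _ two_ne_zero, cpow_one]
    ring
  rw [hval] at h3
  refine h3.congr_fun fun n => ?_
  rcases Nat.even_or_odd n with hn | hn
  · rw [hn.neg_one_pow, if_pos hn]; ring
  · rw [hn.neg_one_pow, if_neg (Nat.not_even_iff_odd.2 hn)]; ring

theorem differentiable_phi : Differentiable ℂ phi := by
  have hoff : ∀ s : ℂ, s ≠ 1 → DifferentiableAt ℂ phi s := by
    intro s hs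
    have : phi =ᶠ[𝓝 s] fun s => (2 ^ (1 - s) - 1) * riemannZeta s := by
      filter_upwards [isOpen_ne.mem_nhds hs] with z hz
      rw [phi, if_neg hz]
    refine DifferentiableAt.congr_of_eventuallyEq ?_ this
    refine DifferentiableAt.mul ?_ (differentiableAt_riemannZeta hs)
    exact (DifferentiableAt.const_cpow (by fun_prop) (Or.inl two_ne_zero)).sub_const 1
  -- at `s = 1` the simple zero of `2 ^ (1 - s) - 1` cancels the pole of `ζ`
  have hcont : ContinuousAt phi 1 := by
    rw [← continuousWithinAt_compl_self]
    have hd : HasDerivAt (fun s : ℂ => (2 : ℂ) ^ (1 - s)) (-(Real.log 2 : ℂ)) 1 := by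
      have h1 : HasDerivAt (fun s : ℂ => 1 - s) (-1) 1 := by
        simpa using (hasDerivAt_id (1 : ℂ)).const_sub 1
      have := h1.const_cpow (c := 2) (Or.inl two_ne_zero)
      refine this.congr_deriv ?_
      rw [sub_self, cpow_zero, ofReal_log (by norm_num)]
      simp
    have h1 := (hasDerivAt_iff_tendsto_slope.1 hd).mul riemannZeta_residue_one
    rw [mul_one] at h1
    have hphi1 : phi 1 = -(Real.log 2 : ℂ) := by simp [phi]
    rw [ContinuousWithinAt, hphi1]
    refine h1.congr' ?_
    filter_upwards [self_mem_nhdsWithin] with z hz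
    have hz1 : z - 1 ≠ 0 := sub_ne_zero.2 hz
    rw [phi, if_neg (show z ≠ 1 from hz), slope_def_field, sub_self, cpow_zero]
    field_simp
  have := (Complex.differentiableOn_compl_singleton_and_continuousAt_iff
    (f := phi) (s := Set.univ) (c := 1) univ_mem).1
    ⟨fun s hs => (hoff s hs.2).differentiableWithinAt, hcont⟩
  exact differentiableOn_univ.1 this

theorem chi4_ne_one : ZMod.χ₄.ringHomComp (Int.castRingHom ℂ) ≠ 1 := by
  intro h
  have h3 := congrArg (fun χ : MulChar (ZMod 4) ℂ => χ 3) h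
  have hu : IsUnit (3 : ZMod 4) := by decide
  have h4 : ZMod.χ₄ 3 = -1 := by decide
  simp only [MulChar.ringHomComp_apply, h4, MulChar.one_apply hu] at h3
  norm_num at h3

theorem hasSum_LChi4 {s : ℂ} (hs : 1 < s.re) :
    HasSum (fun n : ℕ => ((ZMod.χ₄ n : ℤ) : ℂ) * (n : ℂ) ^ (-s)) (LChi4 s) := by
  have h := (DirichletCharacter.LSeriesSummable_of_one_lt_re
    (ZMod.χ₄.ringHomComp (Int.castRingHom ℂ)) hs).hasSum
  have h1 : LChi4 s = ∑' n, LSeries.term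
      (fun n : ℕ => ZMod.χ₄.ringHomComp (Int.castRingHom ℂ) n) s n :=
    DirichletCharacter.LFunction_eq_LSeries _ hs
  rw [h1]
  refine h.congr_fun fun n => ?_
  rcases eq_or_ne n 0 with rfl | hn
  · simp
  · rw [LSeries.term_of_ne_zero hn, cpow_neg, div_eq_mul_inv]
    simp

/-- For `x = ± i` the even powers of `x` are signs and the odd ones are `x` times values of `χ₄`. -/
theorem pow_eq_of_sq_eq_neg_one {x : ℂ} (hx : x ^ 2 = -1) (n : ℕ) :
    x ^ n = (if Even n then (-1) ^ (n / 2) else 0) + x * ((ZMod.χ₄ n : ℤ) : ℂ) := by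
  have h4 : x ^ 4 = 1 := by rw [show (4 : ℕ) = 2 * 2 from rfl, pow_mul, hx]; norm_num
  rcases Nat.even_or_odd' n with ⟨k, rfl | rfl⟩
  · have : ZMod.χ₄ ((2 * k : ℕ) : ZMod 4) = 0 := by
      rw [ZMod.χ₄_nat_eq_if_mod_four]; simp
    rw [this, Int.cast_zero, mul_zero, add_zero, pow_mul, hx]
    simp
  · have hodd : ¬ Even (2 * k + 1) := by simp
    rw [if_neg hodd, zero_add, pow_succ, pow_mul, hx, mul_comm]
    congr 1
    rcases Nat.even_or_odd' k with ⟨j, rfl | rfl⟩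
    · rw [ZMod.χ₄_nat_one_mod_four (by omega)]; simp [pow_mul]
    · rw [ZMod.χ₄_nat_three_mod_four (by omega)]; simp [pow_succ, pow_mul]

theorem hasSum_phiQuarter {x s : ℂ} (hx : x ^ 2 = -1) (hs : 1 < s.re) :
    HasSum (fun n : ℕ => x ^ n * (n : ℂ) ^ (-s)) (phiQuarter x s) := by
  have h := (hasSum_even_of_hasSum (hasSum_phi hs)).add ((hasSum_LChi4 hs).mul_left x)
  refine h.congr_fun fun n => ?_
  rw [pow_eq_of_sq_eq_neg_one hx]
  split_ifs <;> ring

theorem differentiable_phiQuarter (x : ℂ) : Differentiable ℂ (phiQuarter x) := by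
  unfold phiQuarter
  have h1 : Differentiable ℂ fun s : ℂ => (2 : ℂ) ^ (-s) :=
    Differentiable.const_cpow (by fun_prop) (Or.inl two_ne_zero)
  have h2 : Differentiable ℂ LChi4 := DirichletCharacter.differentiable_LFunction chi4_ne_one
  exact (h1.mul differentiable_phi).add (h2.const_mul x)

/-- A fourth root of unity different from `1`. -/
def IsTwist (x : ℂ) : Prop := x = -1 ∨ x = I ∨ x = -I

theorem IsTwist.pow_four {x : ℂ} (hx : IsTwist x) : x ^ 4 = 1 := by
  have hI : I ^ 4 = 1 := I_pow_four
  rcases hx with rfl | rfl | rfl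
  · norm_num
  · exact hI
  · rw [Even.neg_pow (by decide)]; exact hI

theorem IsTwist.ne_zero {x : ℂ} (hx : IsTwist x) : x ≠ 0 := by
  rintro rfl
  simpa using hx.pow_four

theorem IsTwist.ne_one {x : ℂ} (hx : IsTwist x) : x ≠ 1 := by
  rcases hx with rfl | rfl | rfl <;> norm_num [Complex.ext_iff]

theorem IsTwist.norm {x : ℂ} (hx : IsTwist x) : ‖x‖ = 1 := by
  rcases hx with rfl | rfl | rfl <;> simp

theorem IsTwist.inv {x : ℂ} (hx : IsTwist x) : IsTwist x⁻¹ := by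
  rcases hx with rfl | rfl | rfl
  · left; norm_num
  · right; right; simp
  · right; left; rw [inv_neg, inv_I, neg_neg]

/-- The entire continuation of `∑_{m ≥ 1} x ^ m m ^ (-s)`, for `x = -1, ± i`. -/
def twistedZeta (x s : ℂ) : ℂ := if x = -1 then phi s else phiQuarter x s

theorem sq_eq_neg_one_of_eq {x : ℂ} (hx : x = I ∨ x = -I) : x ^ 2 = -1 := by
  rcases hx with rfl | rfl <;> simp

theorem ne_neg_one_of_eq {x : ℂ} (hx : x = I ∨ x = -I) : x ≠ -1 := by
  rcases hx with rfl | rfl <;> norm_num [Complex.ext_iff]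

theorem twistedZeta_neg_one (s : ℂ) : twistedZeta (-1) s = phi s := if_pos rfl

theorem twistedZeta_of_eq {x : ℂ} (hx : x = I ∨ x = -I) (s : ℂ) :
    twistedZeta x s = phiQuarter x s := if_neg (ne_neg_one_of_eq hx)

theorem differentiable_twistedZeta (x : ℂ) : Differentiable ℂ (twistedZeta x) := by
  unfold twistedZeta
  split_ifs
  · exact differentiable_phi
  · exact differentiable_phiQuarter x

theorem hasSum_twistedZeta {x s : ℂ} (hx : IsTwist x) (hs : 1 < s.re) :
    HasSum (fun m : ℕ => x ^ (m + 1) * ((m + 1 : ℕ) : ℂ) ^ (-s)) (twistedZeta x s) := by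
  have h : HasSum (fun n : ℕ => x ^ n * (n : ℂ) ^ (-s)) (twistedZeta x s) := by
    rcases hx with rfl | hx
    · simpa only [twistedZeta_neg_one] using hasSum_phi hs
    · rw [twistedZeta_of_eq hx]
      exact hasSum_phiQuarter (sq_eq_neg_one_of_eq hx) hs
  have h0 : -s ≠ 0 := by
    intro h0
    rw [neg_eq_zero] at h0
    rw [h0, zero_re] at hs
    linarith
  have := (hasSum_nat_add_iff' 1).2 h
  simpa [zero_cpow h0] using this

/-! ### Conditional convergence of the series in the right half-plane -/

/-- The case of a single linear form in one variable of `exists_norm_iterDiff_symb_le`. -/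
theorem exists_norm_cpow_sub_cpow_le (R : ℝ) : ∃ C : ℝ, 0 ≤ C ∧ ∀ s : ℂ, ‖s‖ ≤ R → ∀ m : ℕ,
    ‖((m + 1 + 1 : ℕ) : ℂ) ^ (-s) - ((m + 1 : ℕ) : ℂ) ^ (-s)‖ ≤
      C * ((m + 1 : ℕ) : ℝ) ^ (-(1 + s.re)) := by
  obtain ⟨C, hC0, hC⟩ := exists_norm_iterDiff_symb_le (ι := Unit) (κ := Unit)
    (S := fun _ => {()}) (fun _ => singleton_nonempty _) [()] R
  refine ⟨C, hC0, fun s hs m => ?_⟩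
  have hm : (0 : ℝ) < ((m + 1 : ℕ) : ℝ) := by positivity
  have h := hC (fun _ => s) (by simpa using hs) (fun _ => ((m + 1 : ℕ) : ℝ)) (fun _ => by simp)
  have e : ∀ v : Unit → ℝ, symb (fun _ : Unit => {()}) (fun _ => s) v = (v () : ℂ) ^ (-s) := by
    intro v; simp [symb]
  rw [iterDiff_cons] at h
  simp only [iterDiff, List.foldr_nil, e, List.map_cons, List.map_nil, List.prod_cons,
    List.prod_nil, mul_one, Pi.add_apply, Pi.single_eq_same] at h
  have hn : ‖(((m + 1 : ℕ) : ℝ) : ℂ) ^ (-s)‖ = ((m + 1 : ℕ) : ℝ) ^ (-s.re) := by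
    rw [norm_cpow_eq_rpow_re_of_pos hm, neg_re]
  rw [hn] at h
  have h2 : C * ((m + 1 : ℕ) : ℝ) ^ (-(1 + s.re)) =
      C * ((m + 1 : ℕ) : ℝ) ^ (-s.re) * (((m + 1 : ℕ) : ℝ))⁻¹ := by
    rw [show -(1 + s.re) = -s.re - 1 by ring, Real.rpow_sub_one hm.ne']
    ring
  rw [h2]
  simpa using h

theorem sum_mul_backDiff (x : ℂ) (f : ℕ → ℂ) (N : ℕ) :
    ∑ m ∈ range N, x ^ (m + 1) * backDiff f m =
      (1 - x) * ∑ m ∈ range N, x ^ (m + 1) * f m +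
        x ^ (N + 1) * (if N = 0 then 0 else f (N - 1)) := by
  induction N with
  | zero => simp
  | succ N ih =>
    rw [sum_range_succ, sum_range_succ, ih, backDiff_apply]
    simp only [Nat.add_eq_zero_iff, one_ne_zero, and_false, if_false, Nat.add_sub_cancel]
    ring

/-- A Dirichlet series with coefficients `x ^ m`, where `x ≠ 1` has modulus `1`, converges to its
analytic continuation for `Re s > 0`, by summation by parts. -/
theorem tendsto_sum_of_differentiable {x : ℂ} (hx1 : ‖x‖ = 1) (hx : x ≠ 1) {F : ℂ → ℂ}
    (hF : Differentiable ℂ F)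
    (hFs : ∀ s : ℂ, 1 < s.re →
      HasSum (fun m : ℕ => x ^ (m + 1) * ((m + 1 : ℕ) : ℂ) ^ (-s)) (F s)) {s : ℂ}
    (hs : 0 < s.re) :
    Tendsto (fun N => ∑ m ∈ range N, x ^ (m + 1) * ((m + 1 : ℕ) : ℂ) ^ (-s)) atTop
      (𝓝 (F s)) := by
  have hx' : 1 - x ≠ 0 := sub_ne_zero.2 hx.symm
  let f : ℂ → ℕ → ℂ := fun s m => ((m + 1 : ℕ) : ℂ) ^ (-s)
  let d : ℂ → ℕ → ℂ := fun s m => x ^ (m + 1) * backDiff (f s) m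
  have hf : ∀ m, Differentiable ℂ fun s => f s m := fun m =>
    Differentiable.const_cpow (by fun_prop) (Or.inl (by exact_mod_cast Nat.succ_ne_zero m))
  have hd : ∀ m, Differentiable ℂ fun s => d s m := by
    intro m
    refine Differentiable.const_mul ?_ _
    rcases m with _ | m
    · simpa only [backDiff_zero] using hf 0
    · simp only [backDiff_succ]
      exact (hf (m + 1)).fun_sub (hf m)
  -- normal convergence of the differenced series on bounded parts of `Re s > δ`
  have hnorm : ∀ R δ : ℝ, 0 < δ → ∃ u : ℕ → ℝ, Summable u ∧
      ∀ m, ∀ z ∈ {z : ℂ | δ < z.re} ∩ ball 0 R, ‖d z m‖ ≤ u m := by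
    intro R δ hδ
    obtain ⟨C, hC0, hC⟩ := exists_norm_cpow_sub_cpow_le R
    refine ⟨fun m => if m = 0 then 1 else C * (m : ℝ) ^ (-(1 + δ)), ?_, ?_⟩
    · rw [← summable_nat_add_iff 1]
      have h := (summable_nat_add_iff 1).2
        ((Real.summable_nat_rpow (p := -(1 + δ))).2 (by linarith))
      simpa using h.mul_left C
    · rintro m z ⟨hz, hzR⟩
      simp only [d, norm_mul, norm_pow, hx1, one_pow, one_mul]
      rcases m with _ | m
      · simp [backDiff_zero, f]
      · rw [backDiff_succ, if_neg (Nat.succ_ne_zero m)]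
        refine (hC z (by simpa using (mem_ball_zero_iff.1 hzR).le) m).trans ?_
        refine mul_le_mul_of_nonneg_left ?_ hC0
        refine Real.rpow_le_rpow_of_exponent_le (by simp) ?_
        have : δ < z.re := hz
        linarith
  have hopen : IsOpen {z : ℂ | 0 < z.re} := isOpen_lt continuous_const continuous_re
  have hmem : ∀ z : ℂ, 0 < z.re → z ∈ {w : ℂ | z.re / 2 < w.re} ∩ ball 0 (‖z‖ + 1) := by
    intro z hz
    refine ⟨?_, by simp⟩
    change z.re / 2 < z.re
    linarith
  have hsum : ∀ z : ℂ, 0 < z.re → Summable (d z) := by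
    intro z hz
    obtain ⟨u, hu, hb⟩ := hnorm (‖z‖ + 1) (z.re / 2) (by linarith)
    exact Summable.of_norm_bounded hu fun m => hb m z (hmem z hz)
  have hD : DifferentiableOn ℂ (fun z => ∑' m, d z m) {z : ℂ | 0 < z.re} := by
    intro z hz
    obtain ⟨u, hu, hb⟩ := hnorm (‖z‖ + 1) (z.re / 2) (half_pos hz)
    have hO : IsOpen ({w : ℂ | z.re / 2 < w.re} ∩ ball 0 (‖z‖ + 1)) :=
      (isOpen_lt continuous_const continuous_re).inter isOpen_ball
    exact ((differentiableOn_tsum_of_norm_le hu hO (fun m => (hd m).differentiableOn)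
      hb).differentiableAt (hO.mem_nhds (hmem z hz))).differentiableWithinAt
  have hlim : ∀ z : ℂ, 0 < z.re → Tendsto (fun N => ∑ m ∈ range N, x ^ (m + 1) * f z m) atTop
      (𝓝 ((1 - x)⁻¹ * ∑' m, d z m)) := by
    intro z hz
    have h1 := (hsum z hz).hasSum.tendsto_sum_nat
    have h2 : Tendsto (fun N => x ^ (N + 1) * (if N = 0 then 0 else f z (N - 1))) atTop (𝓝 0) := by
      rw [← tendsto_add_atTop_iff_nat 1]
      refine squeeze_zero_norm (a := fun N : ℕ => ((N : ℝ) + 1) ^ (-z.re)) (fun N => ?_) ?_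
      · simp only [norm_mul, norm_pow, hx1, one_pow, one_mul, Nat.add_eq_zero_iff, one_ne_zero,
          and_false, if_false, Nat.add_sub_cancel, f]
        rw [norm_natCast_cpow_of_pos (Nat.succ_pos N)]
        simp
      · exact (tendsto_rpow_neg_atTop hz).comp
          (tendsto_atTop_add_const_right _ _ tendsto_natCast_atTop_atTop)
    have h3 := ((h1.sub h2).const_mul (1 - x)⁻¹)
    rw [sub_zero] at h3
    refine h3.congr fun N => ?_
    simp only [d]
    rw [sum_mul_backDiff, add_sub_cancel_right, inv_mul_cancel_left₀ hx']
  have hpre : IsPreconnected {z : ℂ | 0 < z.re} := (convex_halfSpace_re_gt 0).isPreconnected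
  have heq : Set.EqOn F (fun z => (1 - x)⁻¹ * ∑' m, d z m) {z : ℂ | 0 < z.re} := by
    refine (hF.differentiableOn.analyticOnNhd hopen).eqOn_of_preconnected_of_eventuallyEq
      ((hD.const_mul _).analyticOnNhd hopen) hpre (z₀ := 2) (by simp) ?_
    have h2 : {z : ℂ | 1 < z.re} ∈ 𝓝 (2 : ℂ) :=
      (isOpen_lt continuous_const continuous_re).mem_nhds (by simp)
    filter_upwards [h2] with z hz
    have hz' : 1 < z.re := hz
    exact tendsto_nhds_unique (hFs z hz).tendsto_sum_nat (hlim z (by linarith))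
  rw [heq hs]
  exact hlim s hs

/-! ### The numbers `Λ(j; x)` and symmetric summation over `ℤ` -/

/-- The value of `∑_{m ≠ 0} x ^ m m ^ (-j)` for a twist `x`, continued to `j = 0`. -/
def lambdaNumber (x : ℂ) (j : ℕ) : ℂ := twistedZeta x j + (-1) ^ j * twistedZeta x⁻¹ j

theorem inv_eq_neg_of_eq {x : ℂ} (hx : x = I ∨ x = -I) : x⁻¹ = -x := by
  rcases hx with rfl | rfl
  · exact inv_I
  · rw [inv_neg, inv_I]

theorem neg_eq_of_eq {x : ℂ} (hx : x = I ∨ x = -I) : -x = I ∨ -x = -I := by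
  rcases hx with rfl | rfl
  · exact Or.inr rfl
  · exact Or.inl (neg_neg I)

theorem lambdaNumber_neg_one (j : ℕ) : lambdaNumber (-1) j = if Even j then 2 * phi j else 0 := by
  have h : (-1 : ℂ)⁻¹ = -1 := by norm_num
  rw [lambdaNumber, h, twistedZeta_neg_one]
  rcases Nat.even_or_odd j with hj | hj
  · rw [hj.neg_one_pow, if_pos hj]; ring
  · rw [hj.neg_one_pow, if_neg (Nat.not_even_iff_odd.2 hj)]; ring

theorem lambdaNumber_of_eq {x : ℂ} (hx : x = I ∨ x = -I) (j : ℕ) :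
    lambdaNumber x j = lambdaValue x j := by
  rw [lambdaNumber, inv_eq_neg_of_eq hx, twistedZeta_of_eq hx, twistedZeta_of_eq (neg_eq_of_eq hx),
    lambdaValue, phiQuarter, phiQuarter]
  rcases Nat.even_or_odd j with hj | hj
  · have hj1 : (j : ℂ) ≠ 1 := by
      intro h
      have : j = 1 := by exact_mod_cast h
      subst this
      exact absurd hj (by decide)
    rw [if_pos hj, hj.neg_one_pow, phi, if_neg hj1, sub_eq_add_neg 1 (j : ℂ),
      cpow_add _ _ two_ne_zero, cpow_one]
    ring
  · rw [if_neg (Nat.not_even_iff_odd.2 hj), hj.neg_one_pow]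
    ring

theorem lambdaNumber_zero {x : ℂ} (hx : IsTwist x) : lambdaNumber x 0 = -1 := by
  rcases hx with rfl | hx
  · rw [lambdaNumber_neg_one]
    simp [phi, riemannZeta_zero]
    norm_num
  · rw [lambdaNumber_of_eq hx, lambdaValue]
    simp [riemannZeta_zero]
    norm_num

/-- The function `z ↦ z ^ (-j)` on the integers, with value `0` at `z = 0` for `j ≥ 1`. For `j = 0`
it is the negative of the indicator function of `0`, which makes its twisted sum over `ℤ` equal to
`Λ(0; x) = -1`. -/
def poleTerm (j : ℕ) (z : ℤ) : ℂ := if j = 0 then if z = 0 then -1 else 0 else ((z : ℂ)⁻¹) ^ j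

theorem poleTerm_zero_left (z : ℤ) : poleTerm 0 z = if z = 0 then -1 else 0 := if_pos rfl

theorem poleTerm_of_ne_zero {j : ℕ} (hj : j ≠ 0) (z : ℤ) : poleTerm j z = ((z : ℂ)⁻¹) ^ j :=
  if_neg hj

theorem tendsto_poleTerm_cofinite {x : ℂ} (hx : ‖x‖ = 1) (j : ℕ) :
    Tendsto (fun z : ℤ => x ^ z * poleTerm j z) cofinite (𝓝 0) := by
  have hlim : Tendsto (fun z : ℤ => |(z : ℝ)|⁻¹) cofinite (𝓝 0) := by
    rw [Int.cofinite_eq, tendsto_sup]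
    exact ⟨tendsto_inv_atTop_zero.comp (tendsto_abs_atBot_atTop.comp
      (tendsto_intCast_atBot_iff.2 tendsto_id)), tendsto_inv_atTop_zero.comp
      (tendsto_abs_atTop_atTop.comp tendsto_intCast_atTop_atTop)⟩
  refine squeeze_zero_norm' ?_ hlim
  filter_upwards [(Set.finite_singleton (0 : ℤ)).compl_mem_cofinite] with z hz
  have hz0 : z ≠ 0 := hz
  rw [norm_mul, norm_zpow, hx, one_zpow, one_mul]
  rcases eq_or_ne j 0 with rfl | hj
  · rw [poleTerm_zero_left, if_neg hz0, norm_zero]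
    positivity
  · rw [poleTerm_of_ne_zero hj, norm_pow, norm_inv, norm_intCast]
    have h1 : (1 : ℝ) ≤ |(z : ℝ)| := by exact_mod_cast Int.one_le_abs hz0
    exact pow_le_of_le_one (by positivity) (inv_le_one_of_one_le₀ h1) hj

theorem Icc_neg_succ (N : ℕ) : Icc (-((N + 1 : ℕ) : ℤ)) ((N + 1 : ℕ) : ℤ) =
    insert ((N : ℤ) + 1) (insert (-((N : ℤ) + 1)) (Icc (-(N : ℤ)) N)) := by
  ext z
  simp only [mem_Icc, mem_insert]
  push_cast
  omega

theorem sum_Icc_neg_succ (h : ℤ → ℂ) (N : ℕ) :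
    ∑ l ∈ Icc (-((N + 1 : ℕ) : ℤ)) ((N + 1 : ℕ) : ℤ), h l =
      h (N + 1) + (h (-((N : ℤ) + 1)) + ∑ l ∈ Icc (-(N : ℤ)) N, h l) := by
  rw [Icc_neg_succ, sum_insert, sum_insert]
  · simp only [mem_Icc]; omega
  · simp only [mem_Icc, mem_insert]; omega

theorem sum_Icc_neg (h : ℤ → ℂ) (N : ℕ) :
    ∑ l ∈ Icc (-(N : ℤ)) N, h l = h 0 + ∑ k ∈ range N, (h (k + 1) + h (-((k : ℤ) + 1))) := by
  induction N with
  | zero => simp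
  | succ N ih =>
    rw [sum_Icc_neg_succ, ih, sum_range_succ]
    ring

theorem sum_Icc_neg_shift (h : ℤ → ℂ) (N : ℕ) (t : ℤ) :
    ∑ l ∈ Icc (-(N : ℤ)) N, h (l + (t + 1)) =
      ∑ l ∈ Icc (-(N : ℤ)) N, h (l + t) + (h (N + (t + 1)) - h (-(N : ℤ) + t)) := by
  induction N with
  | zero => simp
  | succ N ih =>
    rw [sum_Icc_neg_succ (fun l => h (l + (t + 1))), sum_Icc_neg_succ (fun l => h (l + t)), ih]
    have e1 : -((N : ℤ) + 1) + (t + 1) = -(N : ℤ) + t := by ring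
    have e2 : (N : ℤ) + 1 + t = N + (t + 1) := by ring
    have e3 : -((N + 1 : ℕ) : ℤ) + t = -((N : ℤ) + 1) + t := by push_cast; ring
    have e4 : ((N + 1 : ℕ) : ℤ) + (t + 1) = (N : ℤ) + 1 + (t + 1) := by push_cast; ring
    rw [e1, e2, e3, e4]
    ring

/-- Symmetric limits of sums over `ℤ` are invariant under translation when the terms tend to `0`. -/
theorem tendsto_sum_Icc_shift {h : ℤ → ℂ} (h0 : Tendsto h cofinite (𝓝 0)) {T : ℂ}
    (hT : Tendsto (fun N : ℕ => ∑ l ∈ Icc (-(N : ℤ)) N, h l) atTop (𝓝 T)) (t : ℤ) :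
    Tendsto (fun N : ℕ => ∑ l ∈ Icc (-(N : ℤ)) N, h (l + t)) atTop (𝓝 T) := by
  have hd : ∀ t : ℤ, Tendsto (fun N : ℕ => h (N + (t + 1)) - h (-(N : ℤ) + t)) atTop (𝓝 0) := by
    intro t
    have i1 : Function.Injective fun N : ℕ => (N : ℤ) + (t + 1) := fun a b hab => by simpa using hab
    have i2 : Function.Injective fun N : ℕ => -(N : ℤ) + t := fun a b hab => by simpa using hab
    have := (h0.comp i1.tendsto_cofinite).sub (h0.comp i2.tendsto_cofinite)
    rw [Nat.cofinite_eq_atTop, sub_zero] at this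
    exact this
  induction t using Int.induction_on with
  | zero => simpa using hT
  | succ i ih =>
    have := ih.add (hd i)
    rw [add_zero] at this
    refine this.congr fun N => (sum_Icc_neg_shift h N i).symm
  | pred i ih =>
    have := ih.sub (hd (-(i : ℤ) - 1))
    rw [sub_zero] at this
    refine this.congr fun N => ?_
    have h1 := sum_Icc_neg_shift h N (-(i : ℤ) - 1)
    rw [sub_add_cancel] at h1
    rw [h1, sub_add_cancel, add_sub_cancel_right]

/-- The contribution of a pole at `l = 0` to the sum over `l`. For `j ≥ 1` the two halves of the
symmetric sum converge separately; for `j = 0` only the term at `0` is present. -/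
theorem tendsto_sum_poleTerm {x : ℂ} (hx : IsTwist x) (j : ℕ) :
    Tendsto (fun N : ℕ => ∑ l ∈ Icc (-(N : ℤ)) N, x ^ l * poleTerm j l) atTop
      (𝓝 (lambdaNumber x j)) := by
  simp only [sum_Icc_neg]
  rcases eq_or_ne j 0 with rfl | hj
  · rw [lambdaNumber_zero hx]
    refine tendsto_const_nhds.congr fun N => ?_
    rw [sum_eq_zero]
    · simp [poleTerm]
    · intro k _
      have h1 : (k : ℤ) + 1 ≠ 0 := by omega
      have h2 : -((k : ℤ) + 1) ≠ 0 := by omega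
      rw [poleTerm_zero_left, poleTerm_zero_left, if_neg h1, if_neg h2]
      ring
  · have hre : 0 < (j : ℂ).re := by
      rw [natCast_re]; exact_mod_cast Nat.pos_of_ne_zero hj
    have hlim : ∀ {y : ℂ}, IsTwist y → Tendsto
        (fun N => ∑ m ∈ range N, y ^ (m + 1) * ((m + 1 : ℕ) : ℂ) ^ (-(j : ℂ))) atTop
        (𝓝 (twistedZeta y j)) := fun {y} hy =>
      tendsto_sum_of_differentiable hy.norm hy.ne_one (differentiable_twistedZeta y)
        (fun s hs => hasSum_twistedZeta hy hs) hre
    refine ((hlim hx).add ((hlim hx.inv).const_mul ((-1) ^ j))).congr fun N => ?_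
    rw [poleTerm_of_ne_zero hj, Int.cast_zero, inv_zero, zero_pow hj, mul_zero, zero_add, mul_sum,
      ← sum_add_distrib]
    refine sum_congr rfl fun k _ => ?_
    have e1 : x ^ ((k : ℤ) + 1) = x ^ (k + 1) := by exact_mod_cast zpow_natCast x (k + 1)
    have e2 : x ^ (-((k : ℤ) + 1)) = x⁻¹ ^ (k + 1) := by rw [zpow_neg, e1, inv_pow]
    rw [poleTerm_of_ne_zero hj, poleTerm_of_ne_zero hj, e1, e2, cpow_neg, cpow_natCast]
    push_cast
    rw [← inv_pow, inv_neg, neg_pow]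
    ring

/-- The contribution of a pole at `l = -t`, with the phase which the translation produces. -/
theorem tendsto_sum_poleTerm_add {x : ℂ} (hx : IsTwist x) (j : ℕ) (t : ℤ) :
    Tendsto (fun N : ℕ => ∑ l ∈ Icc (-(N : ℤ)) N, x ^ l * poleTerm j (l + t)) atTop
      (𝓝 (x ^ (-t) * lambdaNumber x j)) := by
  have h := (tendsto_sum_Icc_shift (tendsto_poleTerm_cofinite hx.norm j)
    (tendsto_sum_poleTerm hx j) t).const_mul (x ^ (-t))
  refine h.congr fun N => ?_
  rw [mul_sum]
  refine sum_congr rfl fun l _ => ?_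
  rw [← mul_assoc, ← zpow_add₀ hx.ne_zero]
  congr 2
  ring

theorem tendsto_sum_Icc_of_hasSum {h : ℤ → ℂ} {T : ℂ} (hT : HasSum h T) :
    Tendsto (fun N : ℕ => ∑ l ∈ Icc (-(N : ℤ)) N, h l) atTop (𝓝 T) := by
  refine hT.comp (tendsto_atTop_finset_of_monotone ?_ ?_)
  · intro M N hMN
    exact Icc_subset_Icc (by omega) (by omega)
  · intro z
    exact ⟨z.natAbs, by rw [mem_Icc]; omega⟩

/-! ### The function `Λ(s; x)` -/

theorem isEntireContinuation_lambdaTerm {x : ℂ} (hx : IsTwist x) :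
    IsEntireContinuation (lambdaTerm x) halfPlane
      (fun s => twistedZeta x s + exp (-(Real.pi * I * s)) * twistedZeta x⁻¹ s) := by
  refine ⟨(differentiable_twistedZeta x).add (Differentiable.mul (by fun_prop)
    (differentiable_twistedZeta x⁻¹)), fun s hs => ?_⟩
  have hs' : 1 < s.re := hs
  have hs0 : -s ≠ 0 := by
    intro h0
    rw [neg_eq_zero] at h0
    rw [h0, zero_re] at hs'
    linarith
  have h1 := hasSum_twistedZeta hx hs'
  have h2 := (hasSum_twistedZeta hx.inv hs').mul_left (exp (-(Real.pi * I * s)))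
  have key := HasSum.of_add_one_of_neg_add_one (f := fun m : ℤ => x ^ m * (m : ℂ) ^ (-s))
    (m := twistedZeta x s) (m' := exp (-(Real.pi * I * s)) * twistedZeta x⁻¹ s)
    (h1.congr_fun fun n => by
      have e1 : x ^ ((n : ℤ) + 1) = x ^ (n + 1) := by exact_mod_cast zpow_natCast x (n + 1)
      rw [e1]
      push_cast
      rfl)
    (h2.congr_fun fun n => by
      have e1 : x ^ ((n : ℤ) + 1) = x ^ (n + 1) := by exact_mod_cast zpow_natCast x (n + 1)
      have e2 : x ^ (-((n : ℤ) + 1)) = x⁻¹ ^ (n + 1) := by rw [zpow_neg, e1, inv_pow]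
      have e3 := ofReal_cpow_of_nonpos (x := -((n : ℝ) + 1))
        (by linarith [Nat.cast_nonneg (α := ℝ) n]) (-s)
      push_cast at e3 ⊢
      rw [e2, e3, neg_neg, mul_neg]
      ring)
  simp only [Int.cast_zero, zero_cpow hs0, mul_zero, add_zero] at key
  refine (hasSum_subtype_iff_of_support_subset (s := {m : ℤ | m ≠ 0}) ?_).2 key
  intro m hm h0
  have h0' : m = 0 := h0
  subst h0'
  simp [zero_cpow hs0] at hm

theorem halfPlane_interior_nonempty : (interior halfPlane).Nonempty :=
  ⟨2, mem_interior.2 ⟨halfPlane, subset_rfl, isOpen_lt continuous_const continuous_re,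
    by simp [halfPlane]⟩⟩

theorem entireContinuation_eq {ι : Type*} {f : ι → ℂ → ℂ} {F : ℂ → ℂ}
    (hF : IsEntireContinuation f halfPlane F) : entireContinuation f halfPlane = F :=
  (isEntireContinuation_entireContinuation ⟨F, hF⟩).unique halfPlane_interior_nonempty hF

theorem bigLambda_natCast {x : ℂ} (hx : IsTwist x) (j : ℕ) : bigLambda x j = lambdaNumber x j := by
  rw [bigLambda, entireContinuation_eq (isEntireContinuation_lambdaTerm hx)]
  have : exp (-(Real.pi * I * j)) = (-1) ^ j := by
    rw [exp_neg, mul_comm, exp_nat_mul, exp_pi_mul_I, ← inv_pow]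
    norm_num
  simp only [this, lambdaNumber]

/-! ### Partial fractions -/

/-- The principal part at `X = 0` in the partial fraction decomposition of
`X ^ (-(P + 1)) (X + M) ^ (-(Q + 1))`, as a polynomial in `ξ = X⁻¹` and `μ = M⁻¹`. -/
def principalPart (P Q : ℕ) (ξ μ : ℂ) : ℂ :=
  ∑ k ∈ antidiagonal P, (-1) ^ k.1 * ((Q + k.1).choose Q : ℂ) * μ ^ (Q + k.1 + 1) * ξ ^ (k.2 + 1)

theorem principalPart_zero_left (Q : ℕ) (ξ μ : ℂ) : principalPart 0 Q ξ μ = μ ^ (Q + 1) * ξ := by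
  simp [principalPart]

theorem principalPart_succ_left (P Q : ℕ) (ξ μ : ℂ) :
    principalPart (P + 1) Q ξ μ = μ ^ (Q + 1) * ξ ^ (P + 2) -
      ∑ k ∈ antidiagonal P, (-1) ^ k.1 * ((Q + k.1 + 1).choose Q : ℂ) * μ ^ (Q + k.1 + 2) *
        ξ ^ (k.2 + 1) := by
  rw [principalPart, Nat.antidiagonal_succ, sum_cons, sum_map, sub_eq_add_neg, ← sum_neg_distrib]
  congr 1
  · simp
  · refine sum_congr rfl fun k _ => ?_
    change (-1 : ℂ) ^ (k.1 + 1) * ((Q + (k.1 + 1)).choose Q : ℂ) * μ ^ (Q + (k.1 + 1) + 1) *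
      ξ ^ (k.2 + 1) = _
    rw [← add_assoc Q]
    ring

theorem principalPart_succ_zero (P : ℕ) (ξ μ : ℂ) :
    principalPart (P + 1) 0 ξ μ = μ * ξ ^ (P + 2) - μ * principalPart P 0 ξ μ := by
  rw [principalPart_succ_left, principalPart, mul_sum]
  congr 1
  · ring
  · refine sum_congr rfl fun k _ => ?_
    simp only [Nat.choose_zero_right]
    ring

theorem principalPart_succ_succ (P Q : ℕ) (ξ μ : ℂ) :
    principalPart (P + 1) (Q + 1) ξ μ =
      μ * (principalPart (P + 1) Q ξ μ - principalPart P (Q + 1) ξ μ) := by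
  rw [principalPart_succ_left, principalPart_succ_left, principalPart, sub_sub, ← sum_add_distrib,
    mul_sub, mul_sum]
  congr 1
  · ring
  · refine sum_congr rfl fun k _ => ?_
    have h : (Q + 1 + k.1 + 1).choose (Q + 1) =
        (Q + k.1 + 1).choose Q + (Q + 1 + k.1).choose (Q + 1) := by
      rw [Nat.choose_succ_succ, show Q + 1 + k.1 = Q + k.1 + 1 by ring]
    rw [h]
    push_cast
    ring

/-- Partial fractions in terms of `ξ = X⁻¹`, `η = (X + M)⁻¹` and `μ = M⁻¹`, as a polynomial
consequence of the relation `ξ η = μ (ξ - η)`. -/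
theorem pow_mul_pow_eq_principalPart {ξ η μ : ℂ} (h : ξ * η = μ * (ξ - η)) :
    ∀ P Q : ℕ, ξ ^ (P + 1) * η ^ (Q + 1) = principalPart P Q ξ μ + principalPart Q P η (-μ) := by
  have base : ∀ {ξ η μ : ℂ}, ξ * η = μ * (ξ - η) → ∀ Q : ℕ,
      ξ ^ (0 + 1) * η ^ (Q + 1) = principalPart 0 Q ξ μ + principalPart Q 0 η (-μ) := by
    intro ξ η μ h Q
    induction Q with
    | zero =>
      rw [principalPart_zero_left, principalPart_zero_left]
      linear_combination h
    | succ Q ih =>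
      rw [principalPart_succ_zero]
      rw [principalPart_zero_left] at ih ⊢
      linear_combination μ * ih + η ^ (Q + 1) * h
  intro P
  induction P with
  | zero => exact base h
  | succ P ihP =>
    intro Q
    induction Q with
    | zero =>
      have h' : η * ξ = -μ * (η - ξ) := by linear_combination h
      have := base h' (P + 1)
      rw [neg_neg] at this
      linear_combination this
    | succ Q ihQ =>
      have h1 := ihP (Q + 1)
      rw [principalPart_succ_succ P Q, principalPart_succ_succ Q P]
      linear_combination μ * ihQ - μ * h1 + ξ ^ (P + 1) * η ^ (Q + 1) * h

theorem principalPart_eq_sum_range (P Q : ℕ) (ξ μ : ℂ) :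
    principalPart P Q ξ μ = (-1) ^ P * ∑ i ∈ range (P + 1),
      (-1) ^ i * ((P + Q - i).choose Q : ℂ) * μ ^ (P + Q + 1 - i) * ξ ^ (i + 1) := by
  rw [principalPart, ← Nat.sum_antidiagonal_swap, Nat.sum_antidiagonal_eq_sum_range_succ_mk,
    mul_sum]
  refine sum_congr rfl fun i hi => ?_
  have hi' : i ≤ P := Nat.lt_succ_iff.1 (mem_range.1 hi)
  obtain ⟨k, rfl⟩ := Nat.exists_eq_add_of_le hi'
  have e1 : i + k + Q - i = Q + k := by omega
  have e2 : i + k + Q + 1 - i = Q + k + 1 := by omega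
  simp only [Prod.swap, Nat.add_sub_cancel_left, e1, e2]
  have : ((-1 : ℂ)) ^ (i + k) * (-1) ^ i = (-1) ^ k := by
    rw [pow_add, mul_right_comm, ← mul_pow]; norm_num
  linear_combination (-((Q + k).choose Q * μ ^ (Q + k + 1) * ξ ^ (i + 1))) * this

theorem sum_range_choose_sub (P Q : ℕ) :
    ∑ i ∈ range (Q + 1), ((P + Q - i).choose P : ℂ) = ((P + Q + 1).choose Q : ℂ) := by
  rw [← sum_range_reflect]
  have h := Nat.sum_range_add_choose Q P
  have h2 : (Q + P + 1).choose (P + 1) = (P + Q + 1).choose Q := by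
    rw [show Q + P + 1 = Q + (P + 1) by ring, ← Nat.choose_symm_add]
    congr 1
    ring
  rw [h2] at h
  rw [← h]
  push_cast
  refine sum_congr rfl fun k hk => ?_
  have : P + Q - (Q - k) = k + P := by have := mem_range.1 hk; omega
  rw [this]

/-- Partial fractions with two poles, valid at all integers: at the poles the left side vanishes and
the terms with `j = 0` cancel the value of the other principal part. -/
theorem inv_pow_mul_inv_pow_eq_sum_poleTerm {p q : ℕ} (hp : 1 ≤ p) (hq : 1 ≤ q) {X Y M : ℤ}
    (hM : M ≠ 0) (hXY : Y = X + M) :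
    ((X : ℂ)⁻¹) ^ p * ((Y : ℂ)⁻¹) ^ q = (-1) ^ p *
      (∑ j ∈ range (p + 1), (-1) ^ j * ((p + q - 1 - j).choose (q - 1) : ℂ) *
          ((M : ℂ)⁻¹) ^ (p + q - j) * poleTerm j X +
        ∑ j ∈ range (q + 1), ((p + q - 1 - j).choose (p - 1) : ℂ) *
          ((M : ℂ)⁻¹) ^ (p + q - j) * poleTerm j Y) := by
  obtain ⟨P, rfl⟩ := Nat.exists_eq_add_of_le' hp
  obtain ⟨Q, rfl⟩ := Nat.exists_eq_add_of_le' hq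
  rw [sum_range_succ' _ (P + 1), sum_range_succ' _ (Q + 1)]
  have a0 : P + 1 + (Q + 1) - 1 = P + Q + 1 := by omega
  have a1 : ∀ i, P + Q + 1 - (i + 1) = P + Q - i := by intro i; omega
  have a2 : ∀ i, P + 1 + (Q + 1) - (i + 1) = P + Q + 1 - i := by intro i; omega
  simp only [a0, a1, a2, Nat.add_sub_cancel, Nat.sub_zero, pow_zero, one_mul, poleTerm_zero_left]
  have hpt : ∀ i z, poleTerm (i + 1) z = ((z : ℂ)⁻¹) ^ (i + 1) := fun i z =>
    poleTerm_of_ne_zero (Nat.succ_ne_zero i) z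
  simp only [hpt]
  -- at `X = 0` the left side is `0`, and the term with `j = 0` cancels the other principal part
  by_cases hX : X = 0
  · subst hX
    have hY : Y = M := by rw [hXY, zero_add]
    subst hY
    rw [if_pos rfl, if_neg hM]
    have hs : ∑ i ∈ range (Q + 1), ((P + Q - i).choose P : ℂ) * ((Y : ℂ)⁻¹) ^ (P + Q + 1 - i) *
        ((Y : ℂ)⁻¹) ^ (i + 1) = ((P + Q + 1).choose Q : ℂ) * ((Y : ℂ)⁻¹) ^ (P + 1 + (Q + 1)) := by
      rw [← sum_range_choose_sub, sum_mul]
      refine sum_congr rfl fun i hi => ?_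
      have := mem_range.1 hi
      rw [mul_assoc, ← pow_add]
      congr 2
      omega
    rw [hs]
    simp
  · by_cases hY : Y = 0
    · have hXM : X = -M := by omega
      subst hXM
      subst hY
      rw [if_neg hX, if_pos rfl]
      have hs : ∑ i ∈ range (P + 1), (-1) ^ (i + 1) * ((P + Q - i).choose Q : ℂ) *
          ((M : ℂ)⁻¹) ^ (P + Q + 1 - i) * (((-M : ℤ) : ℂ)⁻¹) ^ (i + 1) =
          ((P + Q + 1).choose P : ℂ) * ((M : ℂ)⁻¹) ^ (P + 1 + (Q + 1)) := by
        rw [add_comm P Q, ← sum_range_choose_sub, sum_mul]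
        refine sum_congr rfl fun i hi => ?_
        have := mem_range.1 hi
        have e : P + 1 + (Q + 1) = (Q + P + 1 - i) + (i + 1) := by omega
        have e2 : (-1 : ℂ) ^ (i + 1) * (-1) ^ (i + 1) = 1 := by rw [← mul_pow]; norm_num
        rw [e, pow_add, Int.cast_neg, inv_neg, neg_pow]
        linear_combination ((Q + P - i).choose Q * ((M : ℂ)⁻¹) ^ (Q + P + 1 - i) *
          ((M : ℂ)⁻¹) ^ (i + 1)) * e2
      rw [hs]
      simp
    · rw [if_neg hX, if_neg hY]
      have hXc : (X : ℂ) ≠ 0 := by exact_mod_cast hX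
      have hYc : (Y : ℂ) ≠ 0 := by exact_mod_cast hY
      have hMc : (M : ℂ) ≠ 0 := by exact_mod_cast hM
      have hrel : (X : ℂ)⁻¹ * (Y : ℂ)⁻¹ = (M : ℂ)⁻¹ * ((X : ℂ)⁻¹ - (Y : ℂ)⁻¹) := by
        have : (Y : ℂ) = X + M := by exact_mod_cast hXY
        field_simp
        rw [this]
        ring
      rw [pow_mul_pow_eq_principalPart hrel, principalPart_eq_sum_range,
        principalPart_eq_sum_range, mul_zero, mul_zero, add_zero, add_zero, mul_add]
      congr 1
      · rw [mul_sum, mul_sum]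
        refine sum_congr rfl fun i _ => ?_
        ring
      · rw [mul_sum, mul_sum]
        refine sum_congr rfl fun i hi => ?_
        have hi' := mem_range.1 hi
        rw [add_comm Q P, neg_pow]
        have e : (-1 : ℂ) ^ Q * (-1) ^ i * (-1) ^ (P + Q + 1 - i) = (-1) ^ (P + 1) := by
          rw [← pow_add, ← pow_add]
          have : Q + i + (P + Q + 1 - i) = (P + 1) + 2 * Q := by omega
          rw [this, pow_add, pow_mul]
          norm_num
        linear_combination ((P + Q - i).choose P * ((M : ℂ)⁻¹) ^ (P + Q + 1 - i) *
          ((Y : ℂ)⁻¹) ^ (i + 1)) * e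

/-! ### The functions `𝔗` -/

/-- The general term of `𝔗(p, s, q; x, y)` on all of `ℤ × ℤ`. The convention `0⁻¹ = 0` removes the
points with `l = 0` and with `l + m = 0`. -/
def torSummand (x y : ℂ) (p : ℕ) (s : ℂ) (q : ℕ) (k : ℤ × ℤ) : ℂ :=
  if 1 ≤ k.2 then
    x ^ k.1 * y ^ k.2 * ((k.1 : ℂ)⁻¹) ^ p * (k.2 : ℂ) ^ (-s) * (((k.1 + k.2 : ℤ) : ℂ)⁻¹) ^ q
  else 0

theorem hasSum_torTerm_iff {x y : ℂ} {p q : ℕ} (hp : 1 ≤ p) (hq : 1 ≤ q) {s T : ℂ} :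
    HasSum (fun k => torTerm x y p q k s) T ↔ HasSum (torSummand x y p s q) T := by
  let g : {k : ℤ × ℕ // k.1 ≠ 0 ∧ 1 ≤ k.2 ∧ k.1 + k.2 ≠ 0} → ℤ × ℤ := fun k => (k.1.1, k.1.2)
  have hg : Function.Injective g := by
    rintro ⟨⟨a, b⟩, _⟩ ⟨⟨c, d⟩, _⟩ h
    simpa [g] using h
  rw [← hg.hasSum_iff (f := torSummand x y p s q)]
  · refine iff_of_eq (congrArg (fun f => HasSum f T) (funext fun k => ?_))
    obtain ⟨⟨l, m⟩, h1, h2, h3⟩ := k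
    have h2' : (1 : ℤ) ≤ (m : ℤ) := by exact_mod_cast h2
    simp only [Function.comp, g, torSummand, torTerm, if_pos h2', zpow_natCast, cpow_neg,
      Int.cast_natCast, div_eq_mul_inv, mul_inv, inv_pow]
    ring
  · rintro ⟨l, m⟩ hk
    by_contra hne
    unfold torSummand at hne
    split_ifs at hne with h1
    · apply hk
      have hl : l ≠ 0 := by
        rintro rfl
        simp [show p ≠ 0 by omega] at hne
      have hlm : l + m ≠ 0 := by
        intro h0
        simp [h0, show q ≠ 0 by omega] at hne
      have hm : ((m.toNat : ℕ) : ℤ) = m := Int.toNat_of_nonneg (by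
        have : (1 : ℤ) ≤ m := h1
        omega)
      refine ⟨⟨(l, m.toNat), hl, ?_, ?_⟩, ?_⟩
      · have : (1 : ℤ) ≤ m := h1
        change 1 ≤ m.toNat
        omega
      · change l + (m.toNat : ℤ) ≠ 0
        rwa [hm]
      · simp only [g, hm]
    · exact hne rfl

theorem norm_inv_intCast_pow_le {p : ℕ} (hp : 1 ≤ p) (l : ℤ) :
    ‖((l : ℂ)⁻¹) ^ p‖ ≤ |(l : ℝ)|⁻¹ := by
  rw [norm_pow, norm_inv, norm_intCast]
  refine pow_le_of_le_one (by positivity) ?_ (by omega)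
  rcases eq_or_ne l 0 with rfl | hl
  · simp
  · exact inv_le_one_of_one_le₀ (by exact_mod_cast Int.one_le_abs hl)

/-- The terms are dominated by `m ^ (-Re s) |l|⁻¹ |l + m|⁻¹`, hence by
`m ^ (-Re s) (l ^ (-2) + (l + m) ^ (-2))`. -/
theorem summable_torSummand {x y : ℂ} (hx : ‖x‖ = 1) (hy : ‖y‖ = 1) {p q : ℕ} (hp : 1 ≤ p)
    (hq : 1 ≤ q) {s : ℂ} (hs : 1 < s.re) : Summable (torSummand x y p s q) := by
  let g : ℤ → ℝ := fun l => (|(l : ℝ)|⁻¹) ^ 2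
  let h : ℤ → ℝ := fun m => if 1 ≤ m then (m : ℝ) ^ (-s.re) else 0
  have hg : Summable g := by
    have := Real.summable_one_div_int_pow.2 (by norm_num : 1 < 2)
    refine this.congr fun l => ?_
    simp only [g, inv_pow, sq_abs, one_div]
  have hh : Summable h := by
    have hinj : Function.Injective fun n : ℕ => (n : ℤ) + 1 := fun a b hab => by simpa using hab
    rw [← hinj.summable_iff]
    · have := (summable_nat_add_iff 1).2 ((Real.summable_nat_rpow (p := -s.re)).2 (by linarith))
      refine this.congr fun n => ?_
      simp [Function.comp, h]
    · intro m hm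
      refine if_neg fun h1 => hm ⟨(m - 1).toNat, ?_⟩
      change ((m - 1).toNat : ℤ) + 1 = m
      omega
  have hg0 : 0 ≤ g := fun l => by positivity
  have hh0 : 0 ≤ h := fun m => by
    simp only [h]
    split_ifs with h1
    · have : (0 : ℝ) ≤ m := by exact_mod_cast zero_le_one.trans h1
      positivity
    · exact le_rfl
  have h1 := hg.mul_of_nonneg hh hg0 hh0
  let e : ℤ × ℤ ≃ ℤ × ℤ :=
    ⟨fun k => (k.1 + k.2, k.2), fun k => (k.1 - k.2, k.2), fun k => by simp, fun k => by simp⟩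
  have h2 := e.summable_iff.2 h1
  refine Summable.of_norm_bounded (h1.add h2) fun k => ?_
  obtain ⟨l, m⟩ := k
  simp only [Function.comp, e, Equiv.coe_fn_mk, torSummand, h]
  split_ifs with hm
  · have hm0 : (0 : ℝ) < m := by exact_mod_cast zero_lt_one.trans_le hm
    have hn : ‖(m : ℂ) ^ (-s)‖ = (m : ℝ) ^ (-s.re) := by
      rw [← ofReal_intCast, norm_cpow_eq_rpow_re_of_pos hm0, neg_re]
    rw [norm_mul, norm_mul, norm_mul, norm_mul, norm_zpow, norm_zpow, hx, hy, one_zpow, one_zpow,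
      one_mul, one_mul, hn]
    have b1 := norm_inv_intCast_pow_le hp l
    have b2 := norm_inv_intCast_pow_le hq (l + m)
    have hr : 0 ≤ (m : ℝ) ^ (-s.re) := by positivity
    calc _ ≤ |(l : ℝ)|⁻¹ * (m : ℝ) ^ (-s.re) * |((l + m : ℤ) : ℝ)|⁻¹ := by gcongr
      _ ≤ _ := by
        simp only [g]
        set u := |(l : ℝ)|⁻¹
        set w := |((l + m : ℤ) : ℝ)|⁻¹
        nlinarith [mul_nonneg hr (sq_nonneg (u - w)), mul_nonneg hr (sq_nonneg u),
          mul_nonneg hr (sq_nonneg w)]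
  · simp

/-- The value of `𝔗(p, s, q; x, y)` in terms of one-variable functions. -/
def torNumber (x y : ℂ) (p : ℕ) (s : ℂ) (q : ℕ) : ℂ :=
  (-1) ^ p * ∑ j ∈ range (p + 1), lambdaNumber x j * (-1) ^ j *
      ((p + q - 1 - j).choose (q - 1) : ℂ) * twistedZeta y (s + p + q - j)
  + (-1) ^ p * ∑ j ∈ range (q + 1), lambdaNumber x j *
      ((p + q - 1 - j).choose (p - 1) : ℂ) * twistedZeta (y * x⁻¹) (s + p + q - j)

theorem differentiable_torNumber (x y : ℂ) (p q : ℕ) :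
    Differentiable ℂ fun s => torNumber x y p s q := by
  have h : ∀ (z : ℂ) (j : ℕ), Differentiable ℂ fun s : ℂ => twistedZeta z (s + p + q - j) :=
    fun z j => (differentiable_twistedZeta z).comp
      (((differentiable_id.add_const _).add_const _).sub_const _)
  unfold torNumber
  refine Differentiable.add ?_ ?_ <;>
  exact Differentiable.const_mul (Differentiable.fun_sum fun j _ => (h _ j).const_mul _) _

theorem hasSum_zpow_mul_cpow {y : ℂ} (hy : IsTwist y) {s : ℂ} (hs : 1 < s.re) :
    HasSum (fun m : ℤ => if 1 ≤ m then y ^ m * (m : ℂ) ^ (-s) else 0) (twistedZeta y s) := by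
  have hinj : Function.Injective fun n : ℕ => (n : ℤ) + 1 := fun a b hab => by simpa using hab
  rw [← hinj.hasSum_iff]
  · refine (hasSum_twistedZeta hy hs).congr_fun fun n => ?_
    have e1 : y ^ ((n : ℤ) + 1) = y ^ (n + 1) := by exact_mod_cast zpow_natCast y (n + 1)
    have h1 : (1 : ℤ) ≤ (n : ℤ) + 1 := by omega
    simp only [Function.comp, if_pos h1, e1]
    push_cast
    rfl
  · intro m hm
    refine if_neg fun h1 => hm ⟨(m - 1).toNat, ?_⟩
    change ((m - 1).toNat : ℤ) + 1 = m
    omega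

theorem intCast_cpow_mul_inv_pow {m : ℤ} (hm : 1 ≤ m) (s : ℂ) (k : ℕ) :
    (m : ℂ) ^ (-s) * ((m : ℂ)⁻¹) ^ k = (m : ℂ) ^ (-(s + k)) := by
  have h0 : (m : ℂ) ≠ 0 := by exact_mod_cast (by omega : m ≠ 0)
  rw [neg_add, cpow_add _ _ h0, cpow_neg _ (k : ℂ), cpow_natCast, inv_pow]

theorem torSummand_eq_sum_poleTerm {x y : ℂ} {p q : ℕ} (hp : 1 ≤ p) (hq : 1 ≤ q) (s : ℂ) (l : ℤ)
    {m : ℤ} (hm : 1 ≤ m) :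
    torSummand x y p s q (l, m) = y ^ m * (m : ℂ) ^ (-s) * ((-1) ^ p *
      (∑ j ∈ range (p + 1), (-1) ^ j * ((p + q - 1 - j).choose (q - 1) : ℂ) *
          ((m : ℂ)⁻¹) ^ (p + q - j) * (x ^ l * poleTerm j l) +
        ∑ j ∈ range (q + 1), ((p + q - 1 - j).choose (p - 1) : ℂ) *
          ((m : ℂ)⁻¹) ^ (p + q - j) * (x ^ l * poleTerm j (l + m)))) := by
  have h := inv_pow_mul_inv_pow_eq_sum_poleTerm hp hq (X := l) (Y := l + m) (M := m) (by omega) rfl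
  simp only [mul_left_comm _ (x ^ l)]
  rw [← mul_sum, ← mul_sum, ← mul_add]
  rw [torSummand, if_pos hm]
  linear_combination (x ^ l * y ^ m * (m : ℂ) ^ (-s)) * h

/-- Summation over `l` by partial fractions: the poles `0` and `-m` contribute the numbers
`Λ(j; x)`, with a phase `x ^ (-m)` at the second one. -/
theorem hasSum_torSummand {x y : ℂ} (hx : IsTwist x) (hy : IsTwist y) (hyx : IsTwist (y * x⁻¹))
    {p q : ℕ} (hp : 1 ≤ p) (hq : 1 ≤ q) {s : ℂ} (hs : 1 < s.re) :
    HasSum (torSummand x y p s q) (torNumber x y p s q) := by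
  have hsum := summable_torSummand hx.norm hy.norm hp hq hs
  let e : ℤ × ℤ ≃ ℤ × ℤ := Equiv.prodComm ℤ ℤ
  have hsum' : Summable (torSummand x y p s q ∘ e) := e.summable_iff.2 hsum
  rw [← e.hasSum_iff]
  let V : ℤ → ℂ := fun m => if 1 ≤ m then
    y ^ m * (m : ℂ) ^ (-s) * ((-1) ^ p *
      (∑ j ∈ range (p + 1), (-1) ^ j * ((p + q - 1 - j).choose (q - 1) : ℂ) *
          ((m : ℂ)⁻¹) ^ (p + q - j) * lambdaNumber x j +
        ∑ j ∈ range (q + 1), ((p + q - 1 - j).choose (p - 1) : ℂ) *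
          ((m : ℂ)⁻¹) ^ (p + q - j) * (x ^ (-m) * lambdaNumber x j))) else 0
  have hfib : ∀ m : ℤ, HasSum (fun l : ℤ => (torSummand x y p s q ∘ e) (m, l)) (V m) := by
    intro m
    by_cases hm : 1 ≤ m
    -- the inner sum converges absolutely, so that it is the limit of its symmetric partial sums,
    -- in which the two poles may be separated
    · have h1 := (hsum'.prod_factor m).hasSum
      suffices hval : V m = ∑' l : ℤ, (torSummand x y p s q ∘ e) (m, l) by
        rw [hval]
        exact h1
      refine tendsto_nhds_unique ?_ (tendsto_sum_Icc_of_hasSum h1)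
      have h2 : Tendsto (fun N : ℕ => y ^ m * (m : ℂ) ^ (-s) * ((-1) ^ p *
          (∑ j ∈ range (p + 1), (-1) ^ j * ((p + q - 1 - j).choose (q - 1) : ℂ) *
              ((m : ℂ)⁻¹) ^ (p + q - j) * (∑ l ∈ Icc (-(N : ℤ)) N, x ^ l * poleTerm j l) +
            ∑ j ∈ range (q + 1), ((p + q - 1 - j).choose (p - 1) : ℂ) *
              ((m : ℂ)⁻¹) ^ (p + q - j) *
                (∑ l ∈ Icc (-(N : ℤ)) N, x ^ l * poleTerm j (l + m))))) atTop (𝓝 (V m)) := by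
        simp only [V, if_pos hm]
        refine Tendsto.const_mul _ (Tendsto.const_mul _ (Tendsto.add ?_ ?_))
        · exact tendsto_finsetSum _ fun j _ => (tendsto_sum_poleTerm hx j).const_mul _
        · exact tendsto_finsetSum _ fun j _ => (tendsto_sum_poleTerm_add hx j m).const_mul _
      refine h2.congr fun N => ?_
      have : ∀ l : ℤ, (torSummand x y p s q ∘ e) (m, l) = torSummand x y p s q (l, m) :=
        fun l => rfl
      simp only [this, torSummand_eq_sum_poleTerm hp hq s _ hm]
      rw [← mul_sum, ← mul_sum, sum_add_distrib, sum_comm (s := Icc _ _), sum_comm (s := Icc _ _)]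
      simp only [mul_sum]
    · simp only [V, if_neg hm]
      refine hasSum_zero.congr_fun fun l => ?_
      exact if_neg hm
  have htot := hsum'.hasSum.prod_fiberwise hfib
  have hV : HasSum V (torNumber x y p s q) := by
    have hre : ∀ j, j + 1 ≤ p + q → 1 < (s + ((p + q - j : ℕ) : ℂ)).re := by
      intro j hj
      rw [add_re, natCast_re]
      have : (0 : ℝ) ≤ ((p + q - j : ℕ) : ℝ) := Nat.cast_nonneg _
      linarith
    have hA := hasSum_sum (s := range (p + 1)) fun j hj =>
      (hasSum_zpow_mul_cpow hy (hre j (by have := mem_range.1 hj; omega))).mul_left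
        (lambdaNumber x j * (-1) ^ j * ((p + q - 1 - j).choose (q - 1) : ℂ))
    have hB := hasSum_sum (s := range (q + 1)) fun j hj =>
      (hasSum_zpow_mul_cpow hyx (hre j (by have := mem_range.1 hj; omega))).mul_left
        (lambdaNumber x j * ((p + q - 1 - j).choose (p - 1) : ℂ))
    have hAB := (hA.mul_left ((-1) ^ p)).add (hB.mul_left ((-1) ^ p))
    have hc : ∀ j, j ≤ p + q → s + ((p + q - j : ℕ) : ℂ) = s + p + q - j := by
      intro j hj
      rw [Nat.cast_sub hj]
      push_cast
      ring
    have hval : torNumber x y p s q =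
        (-1) ^ p * ∑ j ∈ range (p + 1), lambdaNumber x j * (-1) ^ j *
          ((p + q - 1 - j).choose (q - 1) : ℂ) * twistedZeta y (s + ((p + q - j : ℕ) : ℂ))
        + (-1) ^ p * ∑ j ∈ range (q + 1), lambdaNumber x j *
          ((p + q - 1 - j).choose (p - 1) : ℂ) *
            twistedZeta (y * x⁻¹) (s + ((p + q - j : ℕ) : ℂ)) := by
      rw [torNumber]
      congr 2
      · exact sum_congr rfl fun j hj => by rw [hc j (by have := mem_range.1 hj; omega)]
      · exact sum_congr rfl fun j hj => by rw [hc j (by have := mem_range.1 hj; omega)]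
    rw [hval]
    refine hAB.congr_fun fun m => ?_
    by_cases hm : 1 ≤ m
    · simp only [V, if_pos hm, mul_zpow, inv_zpow', ← intCast_cpow_mul_inv_pow hm, mul_sum, mul_add]
      congr 1
      · exact sum_congr rfl fun j _ => by ring
      · exact sum_congr rfl fun j _ => by ring
    · simp [V, if_neg hm]
  rw [hV.unique htot]
  exact hsum'.hasSum

theorem isEntireContinuation_torTerm {x y : ℂ} (hx : IsTwist x) (hy : IsTwist y)
    (hyx : IsTwist (y * x⁻¹)) {p q : ℕ} (hp : 1 ≤ p) (hq : 1 ≤ q) :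
    IsEntireContinuation (torTerm x y p q) halfPlane (fun s => torNumber x y p s q) :=
  ⟨differentiable_torNumber x y p q, fun _ hs =>
    (hasSum_torTerm_iff hp hq).2 (hasSum_torSummand hx hy hyx hp hq hs)⟩

theorem tor_eq_torNumber {x y : ℂ} (hx : IsTwist x) (hy : IsTwist y) (hyx : IsTwist (y * x⁻¹))
    {p q : ℕ} (hp : 1 ≤ p) (hq : 1 ≤ q) (s : ℂ) : tor x y p s q = torNumber x y p s q :=
  congrFun (entireContinuation_eq (isEntireContinuation_torTerm hx hy hyx hp hq)) s

theorem isTwist_neg_one : IsTwist (-1) := Or.inl rfl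

theorem isTwist_of_eq {x : ℂ} (hx : x = I ∨ x = -I) : IsTwist x := Or.inr hx

theorem neg_one_mul_inv_of_eq {x : ℂ} (hx : x = I ∨ x = -I) : -1 * x⁻¹ = x := by
  rw [inv_eq_neg_of_eq hx]; ring

theorem neg_mul_inv_of_eq {x : ℂ} (hx : x = I ∨ x = -I) : -x * x⁻¹ = -1 := by
  rw [neg_mul, mul_inv_cancel₀ (isTwist_of_eq hx).ne_zero]

theorem mul_neg_one_inv (x : ℂ) : x * (-1)⁻¹ = -x := by norm_num

/-- Only even indices contribute to `𝔗(p, s, q; -1, y)`, as `Λ(j; -1) = 0` for odd `j`. -/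
theorem sum_range_even (f : ℕ → ℂ) (p : ℕ) :
    ∑ j ∈ range (p + 1), (if Even j then f j else 0) = ∑ k ∈ range (p / 2 + 1), f (2 * k) := by
  rw [← sum_filter]
  symm
  refine sum_bij (fun k _ => 2 * k) (fun k hk => ?_) (fun a _ b _ h => by omega) (fun j hj => ?_)
    (fun k _ => rfl)
  · rw [mem_filter, mem_range]
    have := mem_range.1 hk
    exact ⟨by omega, even_two_mul k⟩
  · obtain ⟨h1, k, rfl⟩ := mem_filter.1 hj
    have := mem_range.1 h1
    exact ⟨k, mem_range.2 (by omega), by omega⟩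

theorem torNumber_neg_one_left {y : ℂ} (hy : y = I ∨ y = -I) (p : ℕ) (s : ℂ) (q : ℕ) :
    torNumber (-1) y p s q = torValue₁ y p s q := by
  have h1 := sum_range_even (fun j => 2 * phi j * ((p + q - 1 - j).choose (q - 1) : ℂ) *
    phiQuarter y (s + p + q - j)) p
  have h2 := sum_range_even (fun j => 2 * phi j * ((p + q - 1 - j).choose (p - 1) : ℂ) *
    phiQuarter (-y) (s + p + q - j)) q
  rw [torNumber, torValue₁, mul_neg_one_inv, mul_assoc 2, mul_assoc 2, mul_left_comm 2,
    mul_left_comm 2, mul_sum (a := (2 : ℂ)), mul_sum (a := (2 : ℂ))]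
  congr 2
  · refine Eq.trans (sum_congr rfl fun j _ => ?_) (h1.trans (sum_congr rfl fun k _ => ?_))
    · rw [lambdaNumber_neg_one, twistedZeta_of_eq hy]
      split_ifs with hj
      · rw [hj.neg_one_pow, mul_one]
      · ring
    · push_cast
      ring
  · refine Eq.trans (sum_congr rfl fun j _ => ?_) (h2.trans (sum_congr rfl fun k _ => ?_))
    · rw [lambdaNumber_neg_one, twistedZeta_of_eq (neg_eq_of_eq hy)]
      split_ifs with hj
      · rfl
      · ring
    · push_cast
      ring

theorem torNumber_neg_one_right {x : ℂ} (hx : x = I ∨ x = -I) (p : ℕ) (s : ℂ) (q : ℕ) :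
    torNumber x (-1) p s q = torValue₂ x p s q := by
  simp only [torNumber, torValue₂, neg_one_mul_inv_of_eq hx, twistedZeta_neg_one,
    twistedZeta_of_eq hx, lambdaNumber_of_eq hx]

theorem torNumber_neg_right {x : ℂ} (hx : x = I ∨ x = -I) (p : ℕ) (s : ℂ) (q : ℕ) :
    torNumber x (-x) p s q = torValue₃ x p s q := by
  simp only [torNumber, torValue₃, neg_mul_inv_of_eq hx, twistedZeta_neg_one,
    twistedZeta_of_eq (neg_eq_of_eq hx), lambdaNumber_of_eq hx]

/-! ### Summation over the first variable with three poles -/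

/-- A double sum over `j < J`, `ω < W j` with weights `w`, the common shape of the four sums on the
right side of the functional relations. -/
def doubleSum (J : ℕ) (W : ℕ → ℕ) (w A : ℕ → ℕ → ℂ) : ℂ :=
  ∑ j ∈ range J, ∑ ω ∈ range (W j), w j ω * A j ω

theorem doubleSum_congr {J : ℕ} {W : ℕ → ℕ} {w A B : ℕ → ℕ → ℂ}
    (h : ∀ j < J, ∀ ω < W j, A j ω = B j ω) : doubleSum J W w A = doubleSum J W w B :=
  sum_congr rfl fun j hj => sum_congr rfl fun ω hω => by
    rw [h j (mem_range.1 hj) ω (mem_range.1 hω)]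

theorem mul_doubleSum (J : ℕ) (W : ℕ → ℕ) (w A : ℕ → ℕ → ℂ) (z : ℂ) :
    z * doubleSum J W w A = doubleSum J W w fun j ω => z * A j ω := by
  simp only [doubleSum, mul_sum, mul_left_comm z]

theorem sum_doubleSum {α : Type*} (T : Finset α) (J : ℕ) (W : ℕ → ℕ) (w : ℕ → ℕ → ℂ)
    (A : α → ℕ → ℕ → ℂ) :
    ∑ l ∈ T, doubleSum J W w (A l) = doubleSum J W w fun j ω => ∑ l ∈ T, A l j ω := by
  unfold doubleSum
  rw [sum_comm]
  refine sum_congr rfl fun j _ => ?_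
  rw [sum_comm]
  simp only [mul_sum]

theorem tendsto_doubleSum {α : Type*} {F : Filter α} {J : ℕ} {W : ℕ → ℕ} {w : ℕ → ℕ → ℂ}
    {A : α → ℕ → ℕ → ℂ} {B : ℕ → ℕ → ℂ} (h : ∀ j ω, Tendsto (fun a => A a j ω) F (𝓝 (B j ω))) :
    Tendsto (fun a => doubleSum J W w (A a)) F (𝓝 (doubleSum J W w B)) :=
  tendsto_finsetSum _ fun j _ => tendsto_finsetSum _ fun ω _ => (h j ω).const_mul _

theorem hasSum_doubleSum {α : Type*} {J : ℕ} {W : ℕ → ℕ} {w : ℕ → ℕ → ℂ}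
    {A : α → ℕ → ℕ → ℂ} {B : ℕ → ℕ → ℂ}
    (h : ∀ j < J, ∀ ω < W j, HasSum (fun a => A a j ω) (B j ω)) :
    HasSum (fun a => doubleSum J W w (A a)) (doubleSum J W w B) :=
  hasSum_sum fun j hj => hasSum_sum fun ω hω =>
    (h j (mem_range.1 hj) ω (mem_range.1 hω)).mul_left _

/-- The weights in the contribution of the pole `l = 0`. -/
def weightFst (p a c j ω : ℕ) : ℂ :=
  (-1) ^ p * (-1) ^ j * ((ω + a - 1).choose ω : ℂ) * ((p + c - j - ω - 1).choose (c - 1) : ℂ)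

/-- The weights in the contribution of the pole `l = -m - n`. -/
def weightLst (p a c j ω : ℕ) : ℂ :=
  (-1) ^ (p + a) * ((ω + a - 1).choose ω : ℂ) * ((p + c - j - ω - 1).choose (p - 1) : ℂ)

/-- The weights in the first half of the contribution of the pole `l = -m`. -/
def weightMidFst (p a c j ω : ℕ) : ℂ :=
  (-1) ^ p * ((ω + a - j).choose ω : ℂ) * ((p + c - 2 - ω).choose (c - 1) : ℂ)

/-- The weights in the second half of the contribution of the pole `l = -m`. -/
def weightMidLst (p a c j ω : ℕ) : ℂ :=
  (-1) ^ (p + a) * (-1) ^ j * ((ω + a - j).choose ω : ℂ) * ((p + c - 2 - ω).choose (p - 1) : ℂ)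

theorem rightSide_eq (lam : ℕ → ℂ) (T₁ T₂ T₃ : ℕ → ℂ → ℕ → ℂ) (p q a b c : ℕ) (s : ℂ) :
    rightSide lam T₁ T₂ T₃ p q a b c s =
      doubleSum (p + 1) (fun j => p - j + 1) (weightFst p a c)
        (fun j ω => lam j * T₁ (q + a + ω) s (p + b + c - j - ω)) +
      doubleSum (c + 1) (fun j => c - j + 1) (weightLst p a c)
        (fun j ω => lam j * T₂ q (s + a + ω) (p + b + c - j - ω)) +
      doubleSum (a + 1) (fun _ => p) (weightMidFst p a c)
        (fun j ω => lam j * T₃ (q + a - j + ω + 1) s (p + b + c - 1 - ω)) +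
      doubleSum (a + 1) (fun _ => c) (weightMidLst p a c)
        (fun j ω => lam j * T₃ q (s + a - j + ω + 1) (p + b + c - 1 - ω)) := by
  unfold rightSide doubleSum weightFst weightLst weightMidFst weightMidLst
  simp only [mul_sum]
  congr 1
  · congr 1
    · congr 1
      · exact sum_congr rfl fun j _ => sum_congr rfl fun ω _ => by ring
      · exact sum_congr rfl fun j _ => sum_congr rfl fun ω _ => by ring
    · exact sum_congr rfl fun j _ => sum_congr rfl fun ω _ => by ring
  · exact sum_congr rfl fun j _ => sum_congr rfl fun ω _ => by ring

/-- Separation of a pole at `X = 0` from one at `X = -m`. The term with `i = 0` is supported at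
`X = 0`, and needs no second pole. -/
theorem poleTerm_mul_inv_pow {a : ℕ} (ha : 1 ≤ a) {X U m : ℤ} (hm : m ≠ 0) (hU : U = X + m)
    (i : ℕ) :
    poleTerm i X * ((U : ℂ)⁻¹) ^ a =
      (-1) ^ i * ∑ j ∈ range (i + 1), (-1) ^ j * ((i + a - 1 - j).choose (a - 1) : ℂ) *
        ((m : ℂ)⁻¹) ^ (i + a - j) * poleTerm j X +
      if i = 0 then 0 else (-1) ^ i * ∑ j ∈ range (a + 1), ((i + a - 1 - j).choose (i - 1) : ℂ) *
        ((m : ℂ)⁻¹) ^ (i + a - j) * poleTerm j U := by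
  rcases eq_or_ne i 0 with rfl | hi
  · simp only [poleTerm_zero_left, if_true, zero_add, sum_range_one, pow_zero, one_mul,
      Nat.sub_zero, Nat.choose_self, Nat.cast_one, add_zero]
    split_ifs with hX
    · rw [hU, hX, zero_add]; ring
    · ring
  · rw [if_neg hi, ← mul_add, poleTerm_of_ne_zero hi]
    exact inv_pow_mul_inv_pow_eq_sum_poleTerm (Nat.one_le_iff_ne_zero.2 hi) ha hm hU

/-- The previous decomposition summed over `i`, collected by the order `j` of the resulting pole. -/
theorem sum_poleTerm_mul_inv_pow {a : ℕ} (ha : 1 ≤ a) {X U m : ℤ} (hm : m ≠ 0) (hU : U = X + m)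
    (P : ℕ) (w : ℕ → ℂ) :
    ∑ i ∈ range (P + 1), w i * (poleTerm i X * ((U : ℂ)⁻¹) ^ a) =
      ∑ j ∈ range (P + 1), ∑ ω ∈ range (P + 1 - j), w (j + ω) * ((-1) ^ ω *
        ((ω + a - 1).choose ω : ℂ) * ((m : ℂ)⁻¹) ^ (a + ω) * poleTerm j X) +
      ∑ j ∈ range (a + 1), ∑ ω ∈ range P, w (ω + 1) * ((-1) ^ (ω + 1) *
        ((ω + a - j).choose ω : ℂ) * ((m : ℂ)⁻¹) ^ (a - j + ω + 1) * poleTerm j U) := by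
  simp only [poleTerm_mul_inv_pow ha hm hU, mul_add, sum_add_distrib]
  congr 1
  · rw [← sum_range_diag_flip (P + 1) fun j ω => w (j + ω) * ((-1) ^ ω *
        ((ω + a - 1).choose ω : ℂ) * ((m : ℂ)⁻¹) ^ (a + ω) * poleTerm j X)]
    refine sum_congr rfl fun i _ => ?_
    rw [mul_sum, mul_sum]
    refine sum_congr rfl fun j hj => ?_
    obtain ⟨ω, rfl⟩ := Nat.exists_eq_add_of_le (Nat.lt_succ_iff.1 (mem_range.1 hj))
    have e1 : j + ω + a - 1 - j = ω + a - 1 := by omega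
    have e2 : j + ω + a - j = a + ω := by omega
    have e3 : ((ω + a - 1).choose (a - 1) : ℂ) = ((ω + a - 1).choose ω : ℂ) := by
      rw [Nat.choose_symm_of_eq_add]
      omega
    have e4 : (-1 : ℂ) ^ (j + ω) * (-1) ^ j = (-1) ^ ω := by
      rw [pow_add, mul_right_comm, ← mul_pow]; norm_num
    rw [Nat.add_sub_cancel_left, e1, e2, e3]
    linear_combination (w (j + ω) * ((ω + a - 1).choose ω) * ((m : ℂ)⁻¹) ^ (a + ω) *
      poleTerm j X) * e4
  · rw [sum_range_succ', if_pos rfl, mul_zero, add_zero, sum_comm]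
    refine sum_congr rfl fun ω _ => ?_
    rw [if_neg (Nat.succ_ne_zero ω), mul_sum, mul_sum]
    refine sum_congr rfl fun j hj => ?_
    have hj' := mem_range.1 hj
    have e1 : ω + 1 + a - 1 - j = ω + a - j := by omega
    have e2 : ω + 1 + a - j = a - j + ω + 1 := by omega
    rw [e1, e2, Nat.add_sub_cancel]
    ring

/-- Partial fractions with the three poles `0`, `-m`, `-m - n`: the poles `0` and `-m - n` are
separated first, and then each of them from `-m`. -/
theorem inv_pow_three_eq {p a c : ℕ} (hp : 1 ≤ p) (ha : 1 ≤ a) (hc : 1 ≤ c) {l m n : ℤ}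
    (hm : m ≠ 0) (hn : n ≠ 0) (hmn : m + n ≠ 0) :
    ((l : ℂ)⁻¹) ^ p * (((l + m : ℤ) : ℂ)⁻¹) ^ a * (((l + m + n : ℤ) : ℂ)⁻¹) ^ c =
      doubleSum (p + 1) (fun j => p - j + 1) (weightFst p a c)
        (fun j ω => ((m : ℂ)⁻¹) ^ (a + ω) * (((m + n : ℤ) : ℂ)⁻¹) ^ (p + c - j - ω) *
          poleTerm j l) +
      doubleSum (c + 1) (fun j => c - j + 1) (weightLst p a c)
        (fun j ω => ((n : ℂ)⁻¹) ^ (a + ω) * (((m + n : ℤ) : ℂ)⁻¹) ^ (p + c - j - ω) *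
          poleTerm j (l + m + n)) +
      doubleSum (a + 1) (fun _ => p) (weightMidFst p a c)
        (fun j ω => ((m : ℂ)⁻¹) ^ (a - j + ω + 1) * (((m + n : ℤ) : ℂ)⁻¹) ^ (p + c - 1 - ω) *
          poleTerm j (l + m)) +
      doubleSum (a + 1) (fun _ => c) (weightMidLst p a c)
        (fun j ω => ((n : ℂ)⁻¹) ^ (a - j + ω + 1) * (((m + n : ℤ) : ℂ)⁻¹) ^ (p + c - 1 - ω) *
          poleTerm j (l + m)) := by
  have h1 := inv_pow_mul_inv_pow_eq_sum_poleTerm hp hc (X := l) (Y := l + m + n) (M := m + n) hmn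
    (by ring)
  have h2 := sum_poleTerm_mul_inv_pow ha hm (X := l) (U := l + m) rfl p
    fun i => (-1) ^ p * ((-1) ^ i * ((p + c - 1 - i).choose (c - 1) : ℂ) *
      (((m + n : ℤ) : ℂ)⁻¹) ^ (p + c - i))
  have h3 := sum_poleTerm_mul_inv_pow ha (neg_ne_zero.2 hn) (X := l + m + n) (U := l + m)
    (by ring) c fun i => (-1) ^ p * (((p + c - 1 - i).choose (p - 1) : ℂ) *
      (((m + n : ℤ) : ℂ)⁻¹) ^ (p + c - i))
  have h4 : ((l : ℂ)⁻¹) ^ p * (((l + m : ℤ) : ℂ)⁻¹) ^ a * (((l + m + n : ℤ) : ℂ)⁻¹) ^ c =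
      ∑ i ∈ range (p + 1), (-1) ^ p * ((-1) ^ i * ((p + c - 1 - i).choose (c - 1) : ℂ) *
        (((m + n : ℤ) : ℂ)⁻¹) ^ (p + c - i)) * (poleTerm i l * (((l + m : ℤ) : ℂ)⁻¹) ^ a) +
      ∑ i ∈ range (c + 1), (-1) ^ p * (((p + c - 1 - i).choose (p - 1) : ℂ) *
        (((m + n : ℤ) : ℂ)⁻¹) ^ (p + c - i)) *
          (poleTerm i (l + m + n) * (((l + m : ℤ) : ℂ)⁻¹) ^ a) := by
    rw [mul_right_comm, h1, mul_add, add_mul, mul_sum, mul_sum, sum_mul, sum_mul]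
    congr 1
    · exact sum_congr rfl fun i _ => by ring
    · exact sum_congr rfl fun i _ => by ring
  rw [h4, h2, h3]
  unfold doubleSum weightFst weightLst weightMidFst weightMidLst
  have hsq : ∀ i : ℕ, (-1 : ℂ) ^ i * (-1) ^ i = 1 := fun i => by rw [← mul_pow]; norm_num
  rw [add_add_add_comm, ← add_assoc]
  congr 1
  · congr 1
    · congr 1
      · refine sum_congr rfl fun j hj => ?_
        have hj' := mem_range.1 hj
        rw [show p + 1 - j = p - j + 1 by omega]
        refine sum_congr rfl fun ω _ => ?_
        rw [show p + c - 1 - (j + ω) = p + c - j - ω - 1 by omega,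
          show p + c - (j + ω) = p + c - j - ω by omega, pow_add]
        linear_combination ((-1) ^ p * (-1) ^ j * ((ω + a - 1).choose ω) *
          ((p + c - j - ω - 1).choose (c - 1)) * (((m : ℂ)⁻¹) ^ (a + ω) *
          (((m + n : ℤ) : ℂ)⁻¹) ^ (p + c - j - ω) * poleTerm j l)) * hsq ω
      · refine sum_congr rfl fun j hj => ?_
        have hj' := mem_range.1 hj
        rw [show c + 1 - j = c - j + 1 by omega]
        refine sum_congr rfl fun ω _ => ?_
        rw [show p + c - 1 - (j + ω) = p + c - j - ω - 1 by omega,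
          show p + c - (j + ω) = p + c - j - ω by omega, Int.cast_neg, inv_neg, neg_pow _ (a + ω),
          pow_add (-1 : ℂ) a, pow_add (-1 : ℂ) p]
        linear_combination ((-1) ^ p * (-1) ^ a * ((ω + a - 1).choose ω) *
          ((p + c - j - ω - 1).choose (p - 1)) * (((n : ℂ)⁻¹) ^ (a + ω) *
          (((m + n : ℤ) : ℂ)⁻¹) ^ (p + c - j - ω) * poleTerm j (l + m + n))) * hsq ω
    · refine sum_congr rfl fun j hj => sum_congr rfl fun ω hω => ?_
      have := mem_range.1 hω
      rw [show p + c - 1 - (ω + 1) = p + c - 2 - ω by omega,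
        show p + c - (ω + 1) = p + c - 1 - ω by omega]
      linear_combination ((-1) ^ p * ((ω + a - j).choose ω) *
        ((p + c - 2 - ω).choose (c - 1)) * (((m : ℂ)⁻¹) ^ (a - j + ω + 1) *
        (((m + n : ℤ) : ℂ)⁻¹) ^ (p + c - 1 - ω) * poleTerm j (l + m))) * hsq (ω + 1)
  · refine sum_congr rfl fun j hj => sum_congr rfl fun ω hω => ?_
    have := mem_range.1 hω
    have hj' := mem_range.1 hj
    have e : (-1 : ℂ) ^ (ω + 1) * (-1) ^ (a - j + ω + 1) = (-1) ^ a * (-1) ^ j := by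
      rw [← pow_add, ← pow_add,
        show a + j = (a - j) + 2 * j by omega,
        show ω + 1 + (a - j + ω + 1) = (a - j) + 2 * (ω + 1) by omega, pow_add, pow_mul,
        pow_add _ _ (2 * j), pow_mul _ 2 j]
      norm_num
    rw [show p + c - 1 - (ω + 1) = p + c - 2 - ω by omega,
      show p + c - (ω + 1) = p + c - 1 - ω by omega, Int.cast_neg, inv_neg,
      neg_pow _ (a - j + ω + 1), pow_add (-1 : ℂ) p a]
    linear_combination ((-1) ^ p * ((ω + a - j).choose ω) *
      ((p + c - 2 - ω).choose (p - 1)) * (((n : ℂ)⁻¹) ^ (a - j + ω + 1) *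
      (((m + n : ℤ) : ℂ)⁻¹) ^ (p + c - 1 - ω) * poleTerm j (l + m))) * e

/-! ### Evaluation of the sum over all chambers -/

/-- The general term of the twelve-term sum, taken over all `(m, n, l)` with `n ≥ 1`. The convention
`0⁻¹ = 0` removes the points at which one of the linear forms vanishes. -/
def rootSummand (x : ℂ) (p q a b c : ℕ) (s : ℂ) (k : (ℤ × ℤ) × ℤ) : ℂ :=
  if 1 ≤ k.1.2 then
    x ^ (k.2 + 2 * k.1.1 + 3 * k.1.2) * ((k.2 : ℂ)⁻¹) ^ p * ((k.1.1 : ℂ)⁻¹) ^ q *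
      (k.1.2 : ℂ) ^ (-s) * (((k.2 + k.1.1 : ℤ) : ℂ)⁻¹) ^ a * (((k.1.1 + k.1.2 : ℤ) : ℂ)⁻¹) ^ b *
      (((k.2 + k.1.1 + k.1.2 : ℤ) : ℂ)⁻¹) ^ c
  else 0

theorem torSummand_eq_zero {x y : ℂ} {p q : ℕ} (hp : 1 ≤ p) (hq : 1 ≤ q) (s : ℂ) {k : ℤ × ℤ}
    (hk : k.1 = 0 ∨ k.1 + k.2 = 0) : torSummand x y p s q k = 0 := by
  unfold torSummand
  split_ifs
  · rcases hk with h | h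
    · simp [h, show p ≠ 0 by omega]
    · rw [h]
      simp [show q ≠ 0 by omega]
  · rfl

theorem doubleSum_eq_zero {J : ℕ} {W : ℕ → ℕ} {w A : ℕ → ℕ → ℂ}
    (h : ∀ j < J, ∀ ω < W j, A j ω = 0) : doubleSum J W w A = 0 :=
  sum_eq_zero fun j hj => sum_eq_zero fun ω hω => by
    rw [h j (mem_range.1 hj) ω (mem_range.1 hω), mul_zero]

theorem zpow_twist_eq {x : ℂ} (hx : x = I ∨ x = -I) (l m n : ℤ) :
    x ^ (l + 2 * m + 3 * n) = x ^ l * ((-1) ^ m * (-x) ^ n) ∧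
    x ^ (l + 2 * m + 3 * n) = x ^ (l + (m + n)) * (x ^ m * (-1) ^ n) ∧
    x ^ (l + 2 * m + 3 * n) = x ^ (l + m) * (x ^ m * (-x) ^ n) := by
  have h0 := (isTwist_of_eq hx).ne_zero
  have h2 : (-1 : ℂ) = x ^ (2 : ℤ) := (sq_eq_neg_one_of_eq hx).symm
  have h3 : -x = x ^ (3 : ℤ) := by
    have : x ^ (3 : ℤ) = x ^ 2 * x := by
      rw [← pow_succ]; norm_cast
    rw [this, sq_eq_neg_one_of_eq hx]; ring
  refine ⟨?_, ?_, ?_⟩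
  · rw [h3, h2, ← zpow_mul, ← zpow_mul, ← zpow_add₀ h0, ← zpow_add₀ h0, add_assoc]
  · rw [h2, ← zpow_mul, ← zpow_add₀ h0, ← zpow_add₀ h0]
    congr 1; ring
  · rw [h3, ← zpow_mul, ← zpow_add₀ h0, ← zpow_add₀ h0]
    congr 1; ring

/-- Partial fractions in `l` turn the general term into terms of the functions `𝔗` in `(m, n)`,
multiplied by terms of the numbers `Λ(j; x)`. -/
theorem rootSummand_eq {x : ℂ} (hx : x = I ∨ x = -I) {p q a b c : ℕ} (hp : 1 ≤ p) (hq : 1 ≤ q)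
    (ha : 1 ≤ a) (hb : 1 ≤ b) (hc : 1 ≤ c) (s : ℂ) (k : ℤ × ℤ) (l : ℤ) :
    rootSummand x p q a b c s (k, l) =
      doubleSum (p + 1) (fun j => p - j + 1) (weightFst p a c)
        (fun j ω => torSummand (-1) (-x) (q + a + ω) s (p + b + c - j - ω) k *
          (x ^ l * poleTerm j l)) +
      doubleSum (c + 1) (fun j => c - j + 1) (weightLst p a c)
        (fun j ω => torSummand x (-1) q (s + a + ω) (p + b + c - j - ω) k *
          (x ^ (l + (k.1 + k.2)) * poleTerm j (l + (k.1 + k.2)))) +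
      doubleSum (a + 1) (fun _ => p) (weightMidFst p a c)
        (fun j ω => torSummand x (-x) (q + a - j + ω + 1) s (p + b + c - 1 - ω) k *
          (x ^ (l + k.1) * poleTerm j (l + k.1))) +
      doubleSum (a + 1) (fun _ => c) (weightMidLst p a c)
        (fun j ω => torSummand x (-x) q (s + a - j + ω + 1) (p + b + c - 1 - ω) k *
          (x ^ (l + k.1) * poleTerm j (l + k.1))) := by
  by_cases hk : k.1 = 0 ∨ k.1 + k.2 = 0
  · have h0 : rootSummand x p q a b c s (k, l) = 0 := by
      unfold rootSummand
      split_ifs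
      · rcases hk with h | h
        · simp [h, show q ≠ 0 by omega]
        · simp only [h]
          simp [show b ≠ 0 by omega]
      · rfl
    rw [h0, doubleSum_eq_zero, doubleSum_eq_zero, doubleSum_eq_zero, doubleSum_eq_zero]
    · ring
    all_goals
      intro j hj ω hω
      rw [torSummand_eq_zero (by omega) (by omega) _ hk, zero_mul]
  push Not at hk
  obtain ⟨m, n⟩ := k
  obtain ⟨hm, hmn⟩ : m ≠ 0 ∧ m + n ≠ 0 := hk
  by_cases hn : 1 ≤ n
  · have h3 := inv_pow_three_eq hp ha hc (l := l) hm (by omega : n ≠ 0) hmn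
    obtain ⟨e1, e2, e3⟩ := zpow_twist_eq hx l m n
    have hS : rootSummand x p q a b c s ((m, n), l) = x ^ (l + 2 * m + 3 * n) *
        ((m : ℂ)⁻¹) ^ q * (n : ℂ) ^ (-s) * (((m + n : ℤ) : ℂ)⁻¹) ^ b *
        (((l : ℂ)⁻¹) ^ p * (((l + m : ℤ) : ℂ)⁻¹) ^ a * (((l + m + n : ℤ) : ℂ)⁻¹) ^ c) := by
      rw [rootSummand, if_pos hn]
      ring
    rw [hS, h3, mul_add, mul_add, mul_add, mul_doubleSum, mul_doubleSum, mul_doubleSum,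
      mul_doubleSum]
    congr 1
    · congr 1
      · congr 1
        · refine doubleSum_congr fun j hj ω hω => ?_
          rw [torSummand, if_pos hn, show p + b + c - j - ω = p + c - j - ω + b by omega, e1,
            show q + a + ω = q + (a + ω) by ring, pow_add _ q, pow_add _ _ b]
          ring
        · refine doubleSum_congr fun j hj ω hω => ?_
          have : s + a + ω = s + ((a + ω : ℕ) : ℂ) := by push_cast; ring
          rw [torSummand, if_pos hn, show p + b + c - j - ω = p + c - j - ω + b by omega, e2,
            pow_add _ _ b, this, ← intCast_cpow_mul_inv_pow hn, add_assoc l]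
          ring
      · refine doubleSum_congr fun j hj ω hω => ?_
        rw [torSummand, if_pos hn, show p + b + c - 1 - ω = p + c - 1 - ω + b by omega, e3,
          show q + a - j + ω + 1 = q + (a - j + ω + 1) by omega, pow_add _ q, pow_add _ _ b]
        ring
    · refine doubleSum_congr fun j hj ω hω => ?_
      have : s + a - j + ω + 1 = s + ((a - j + ω + 1 : ℕ) : ℂ) := by
        push_cast [Nat.cast_sub (show j ≤ a by omega)]; ring
      rw [torSummand, if_pos hn, show p + b + c - 1 - ω = p + c - 1 - ω + b by omega, e3,
        pow_add _ _ b, this, ← intCast_cpow_mul_inv_pow hn]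
      ring
  · have h0 : ∀ (x y : ℂ) (p : ℕ) (s : ℂ) (q : ℕ), torSummand x y p s q (m, n) = 0 :=
      fun x y p s q => if_neg hn
    rw [rootSummand, if_neg hn]
    simp [h0, doubleSum]

theorem tendsto_sum_zpow_add_mul_poleTerm {x : ℂ} (hx : IsTwist x) (j : ℕ) (t : ℤ) :
    Tendsto (fun N : ℕ => ∑ l ∈ Icc (-(N : ℤ)) N, x ^ (l + t) * poleTerm j (l + t)) atTop
      (𝓝 (lambdaNumber x j)) := by
  have h := (tendsto_sum_poleTerm_add hx j t).const_mul (x ^ t)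
  rw [← mul_assoc, ← zpow_add₀ hx.ne_zero, add_neg_cancel, zpow_zero, one_mul] at h
  refine h.congr fun N => ?_
  rw [mul_sum]
  refine sum_congr rfl fun l _ => ?_
  rw [zpow_add₀ hx.ne_zero]
  ring

/-- Summing over `l` first evaluates the sum over all chambers. -/
theorem eq_rightSide_of_hasSum {x : ℂ} (hx : x = I ∨ x = -I) {p q a b c : ℕ} (hp : 1 ≤ p)
    (hq : 1 ≤ q) (ha : 1 ≤ a) (hb : 1 ≤ b) (hc : 1 ≤ c) {s S : ℂ} (hs : 1 < s.re)
    (hS : HasSum (rootSummand x p q a b c s) S) :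
    S = rightSide (lambdaNumber x) (torNumber (-1) (-x)) (torNumber x (-1)) (torNumber x (-x))
      p q a b c s := by
  have ht := isTwist_of_eq hx
  have ht' := isTwist_of_eq (neg_eq_of_eq hx)
  let V : ℤ × ℤ → ℂ := fun k =>
    doubleSum (p + 1) (fun j => p - j + 1) (weightFst p a c)
      (fun j ω => torSummand (-1) (-x) (q + a + ω) s (p + b + c - j - ω) k * lambdaNumber x j) +
    doubleSum (c + 1) (fun j => c - j + 1) (weightLst p a c)
      (fun j ω => torSummand x (-1) q (s + a + ω) (p + b + c - j - ω) k * lambdaNumber x j) +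
    doubleSum (a + 1) (fun _ => p) (weightMidFst p a c)
      (fun j ω => torSummand x (-x) (q + a - j + ω + 1) s (p + b + c - 1 - ω) k *
        lambdaNumber x j) +
    doubleSum (a + 1) (fun _ => c) (weightMidLst p a c)
      (fun j ω => torSummand x (-x) q (s + a - j + ω + 1) (p + b + c - 1 - ω) k *
        lambdaNumber x j)
  have hfib : ∀ k, HasSum (fun l => rootSummand x p q a b c s (k, l)) (V k) := by
    intro k
    have h1 := (hS.summable.prod_factor k).hasSum
    suffices hval : V k = ∑' l : ℤ, rootSummand x p q a b c s (k, l) by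
      rw [hval]
      exact h1
    refine tendsto_nhds_unique ?_ (tendsto_sum_Icc_of_hasSum h1)
    simp only [rootSummand_eq hx hp hq ha hb hc, sum_add_distrib, sum_doubleSum, ← mul_sum]
    refine Tendsto.add (Tendsto.add (Tendsto.add ?_ ?_) ?_) ?_ <;>
      refine tendsto_doubleSum fun j ω => Tendsto.const_mul _ ?_
    · exact tendsto_sum_poleTerm ht j
    all_goals exact tendsto_sum_zpow_add_mul_poleTerm ht j _
  refine (hS.prod_fiberwise hfib).unique ?_
  have hre : ∀ k : ℕ, 1 < (s + k).re := fun k => by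
    rw [add_re, natCast_re]
    have : (0 : ℝ) ≤ (k : ℝ) := Nat.cast_nonneg _
    linarith
  rw [rightSide_eq]
  refine HasSum.add (HasSum.add (HasSum.add ?_ ?_) ?_) ?_ <;>
    refine hasSum_doubleSum fun j hj ω hω => ?_ <;> rw [mul_comm (lambdaNumber x j)] <;>
    refine HasSum.mul_right _ ?_
  · refine hasSum_torSummand isTwist_neg_one ht' ?_ (by omega) (by omega) hs
    rw [mul_neg_one_inv, neg_neg]
    exact ht
  · refine hasSum_torSummand ht isTwist_neg_one ?_ (by omega) (by omega) ?_
    · rwa [neg_one_mul_inv_of_eq hx]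
    · have := hre (a + ω)
      push_cast at this
      rwa [add_assoc]
  · refine hasSum_torSummand ht ht' ?_ (by omega) (by omega) hs
    rw [neg_mul_inv_of_eq hx]
    exact isTwist_neg_one
  · refine hasSum_torSummand ht ht' ?_ (by omega) (by omega) ?_
    · rw [neg_mul_inv_of_eq hx]
      exact isTwist_neg_one
    · have := hre (a - j + ω + 1)
      push_cast [Nat.cast_sub (show j ≤ a by omega)] at this
      convert this using 2
      ring

/-! ### Decomposition into chambers -/

/-- The general term `x ^ (l + 2m + 3n) l ^ (-t₀) ⋯ (l + m + n) ^ (-t₅)` on the chamber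
`l, m, n ≥ 1`, extended by zero. -/
def chamberTerm (x t₀ t₁ t₂ t₃ t₄ t₅ : ℂ) (l m n : ℤ) : ℂ :=
  if 0 < l ∧ 0 < m ∧ 0 < n then
    x ^ (l + 2 * m + 3 * n) * ((l : ℂ) ^ (-t₀) * (m : ℂ) ^ (-t₁) * (n : ℂ) ^ (-t₂) *
      ((l + m : ℤ) : ℂ) ^ (-t₃) * ((m + n : ℤ) : ℂ) ^ (-t₄) * ((l + m + n : ℤ) : ℂ) ^ (-t₅))
  else 0

/-- The negative power `f ^ (-p)` of an integer, with the convention `0⁻¹ = 0`. -/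
def invPow (f : ℤ) (p : ℕ) : ℂ := ((f : ℂ)⁻¹) ^ p

theorem invPow_neg (f : ℤ) (p : ℕ) : invPow (-f) p = (-1) ^ p * invPow f p := by
  rw [invPow, invPow, Int.cast_neg, inv_neg, neg_pow]

theorem intCast_cpow_neg_natCast (f : ℤ) (p : ℕ) : (f : ℂ) ^ (-(p : ℂ)) = invPow f p := by
  rw [cpow_neg, cpow_natCast, invPow, inv_pow]

theorem zpow_eq_zpow_of_dvd {x : ℂ} (hx : IsTwist x) {e f : ℤ} (h : 4 ∣ e - f) :
    x ^ e = x ^ f := by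
  obtain ⟨k, hk⟩ := h
  have h4 : x ^ (4 : ℤ) = 1 := by exact_mod_cast hx.pow_four
  rw [show e = f + 4 * k by omega, zpow_add₀ hx.ne_zero, zpow_mul, h4, one_zpow, mul_one]

theorem rootSummand_eq_invPow {x : ℂ} (p q a b c : ℕ) (s : ℂ) {l m n : ℤ} (hn : 1 ≤ n) :
    rootSummand x p q a b c s ((m, n), l) = x ^ (l + 2 * m + 3 * n) * invPow l p * invPow m q *
      (n : ℂ) ^ (-s) * invPow (l + m) a * invPow (m + n) b * invPow (l + m + n) c :=
  if_pos hn

theorem mul_chamberTerm_eq_ite {x t₀ t₁ t₂ t₃ t₄ t₅ ε R : ℂ} {l m n d e f : ℤ} (hd : l + m = d)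
    (he : m + n = e) (hf : l + m + n = f)
    (h : 0 < l → 0 < m → 0 < n → ε * (x ^ (l + 2 * m + 3 * n) * ((l : ℂ) ^ (-t₀) * (m : ℂ) ^ (-t₁) *
      (n : ℂ) ^ (-t₂) * (d : ℂ) ^ (-t₃) * (e : ℂ) ^ (-t₄) * (f : ℂ) ^ (-t₅))) = R) :
    ε * chamberTerm x t₀ t₁ t₂ t₃ t₄ t₅ l m n = if 0 < l ∧ 0 < m ∧ 0 < n then R else 0 := by
  subst hd he hf
  unfold chamberTerm
  split_ifs with h0
  · exact h h0.1 h0.2.1 h0.2.2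
  · exact mul_zero _

/-- The points with `n ≥ 1` at which no linear form vanishes are divided into twelve chambers. -/
theorem eq_sum_ite_chamber {l m n : ℤ} {R : ℂ} (hR : n ≤ 0 ∨ l = 0 ∨ m = 0 ∨ l + m = 0 ∨
    m + n = 0 ∨ l + m + n = 0 → R = 0) :
    R = (if 0 < l ∧ 0 < m ∧ 0 < n then R else 0)
      + (if 0 < -l ∧ 0 < l + m ∧ 0 < n then R else 0)
      + (if 0 < m ∧ 0 < -(l + m) ∧ 0 < l + m + n then R else 0)
      + (if 0 < m ∧ 0 < n ∧ 0 < -(l + m + n) then R else 0)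
      + (if 0 < l + m ∧ 0 < -m ∧ 0 < m + n then R else 0)
      + (if 0 < l + m ∧ 0 < n ∧ 0 < -(m + n) then R else 0)
      + (if 0 < -(l + m) ∧ 0 < l ∧ 0 < m + n then R else 0)
      + (if 0 < -(l + m) ∧ 0 < l + m + n ∧ 0 < -(m + n) then R else 0)
      + (if 0 < n ∧ 0 < -(l + m + n) ∧ 0 < l then R else 0)
      + (if 0 < -m ∧ 0 < -l ∧ 0 < l + m + n then R else 0)
      + (if 0 < -m ∧ 0 < m + n ∧ 0 < -(l + m + n) then R else 0)
      + (if 0 < n ∧ 0 < -(m + n) ∧ 0 < -l then R else 0) := by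
  by_cases h : n ≤ 0 ∨ l = 0 ∨ m = 0 ∨ l + m = 0 ∨ m + n = 0 ∨ l + m + n = 0
  · simp [hR h]
  push Not at h
  obtain ⟨hn, h1, h2, h3, h4, h5⟩ := h
  rcases lt_or_gt_of_ne h1 with h1 | h1 <;> rcases lt_or_gt_of_ne h2 with h2 | h2 <;>
  rcases lt_or_gt_of_ne h3 with h3 | h3 <;> rcases lt_or_gt_of_ne h4 with h4 | h4 <;>
  rcases lt_or_gt_of_ne h5 with h5 | h5 <;> first
    | omega
    | simp (disch := omega) only [if_pos, if_neg, add_zero, zero_add]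

/-- On each chamber the general term is, up to sign, that of `ζ₃` at a permuted argument. -/
theorem sum_chamberTerm {x : ℂ} (hx : IsTwist x) {p q a b c : ℕ} (hp : 1 ≤ p) (hq : 1 ≤ q)
    (ha : 1 ≤ a) (hb : 1 ≤ b) (hc : 1 ≤ c) (s : ℂ) (l m n : ℤ) :
    rootSummand x p q a b c s ((m, n), l) =
      1 * chamberTerm x p q s a b c l m n
      + (-1) ^ p * chamberTerm x p a s q c b (-l) (l + m) n
      + (-1) ^ (p + a) * chamberTerm x q a c p s b m (-(l + m)) (l + m + n)
      + (-1) ^ (p + a + c) * chamberTerm x q s c b a p m n (-(l + m + n))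
      + (-1) ^ q * chamberTerm x a q b p s c (l + m) (-m) (m + n)
      + (-1) ^ (q + b) * chamberTerm x a s b c q p (l + m) n (-(m + n))
      + (-1) ^ (q + a) * chamberTerm x a p b q c s (-(l + m)) l (m + n)
      + (-1) ^ (q + a + b) * chamberTerm x a c b s p q (-(l + m)) (l + m + n) (-(m + n))
      + (-1) ^ (q + a + b + c) * chamberTerm x s c p a b q n (-(l + m + n)) l
      + (-1) ^ (p + q + a) * chamberTerm x q p c a b s (-m) (-l) (l + m + n)
      + (-1) ^ (p + q + a + c) * chamberTerm x q b c s p a (-m) (m + n) (-(l + m + n))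
      + (-1) ^ (p + q + a + b + c) * chamberTerm x s b p q c a n (-(m + n)) (-l) := by
  have hR : n ≤ 0 ∨ l = 0 ∨ m = 0 ∨ l + m = 0 ∨ m + n = 0 ∨ l + m + n = 0 →
      rootSummand x p q a b c s ((m, n), l) = 0 := by
    intro h
    by_cases hn : 1 ≤ n
    · rw [rootSummand_eq_invPow _ _ _ _ _ _ hn]
      have h0 : ∀ {p : ℕ}, 1 ≤ p → invPow 0 p = 0 := fun {p} hp => by
        rw [invPow, Int.cast_zero, inv_zero, zero_pow (by omega)]
      rcases h with h | h | h | h | h | h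
      · omega
      all_goals simp only [h, h0 hp, h0 hq, h0 ha, h0 hb, h0 hc, mul_zero, zero_mul]
    · exact if_neg hn
  have add_eq : ∀ {u u' v v' : ℂ}, u = u' → v = v' → u + v = u' + v' := fun h h' => by rw [h, h']
  -- `d`, `e`, `f` are the three composite roots in the coordinates of the respective chamber
  refine (eq_sum_ite_chamber hR).trans (Eq.symm ?_)
  refine add_eq (add_eq (add_eq (add_eq (add_eq (add_eq (add_eq (add_eq (add_eq (add_eq (add_eq
    (mul_chamberTerm_eq_ite (d := l + m) (e := m + n) (f := l + m + n) rfl rfl rfl ?_)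
    (mul_chamberTerm_eq_ite (d := m) (e := l + m + n) (f := m + n)
      (by ring) (by ring) (by ring) ?_))
    (mul_chamberTerm_eq_ite (d := -l) (e := n) (f := m + n) (by ring) (by ring) (by ring) ?_))
    (mul_chamberTerm_eq_ite (d := m + n) (e := -(l + m)) (f := -l)
      (by ring) (by ring) (by ring) ?_))
    (mul_chamberTerm_eq_ite (d := l) (e := n) (f := l + m + n) (by ring) (by ring) (by ring) ?_))
    (mul_chamberTerm_eq_ite (d := l + m + n) (e := -m) (f := l)
      (by ring) (by ring) (by ring) ?_))
    (mul_chamberTerm_eq_ite (d := -m) (e := l + m + n) (f := n)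
      (by ring) (by ring) (by ring) ?_))
    (mul_chamberTerm_eq_ite (d := n) (e := l) (f := -m) (by ring) (by ring) (by ring) ?_))
    (mul_chamberTerm_eq_ite (d := -(l + m)) (e := -(m + n)) (f := -m)
      (by ring) (by ring) (by ring) ?_))
    (mul_chamberTerm_eq_ite (d := -(l + m)) (e := m + n) (f := n)
      (by ring) (by ring) (by ring) ?_))
    (mul_chamberTerm_eq_ite (d := n) (e := -l) (f := -(l + m)) (by ring) (by ring) (by ring) ?_))
    (mul_chamberTerm_eq_ite (d := -m) (e := -(l + m + n)) (f := -(l + m))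
      (by ring) (by ring) (by ring) ?_)
  all_goals
    intro h₁ h₂ h₃
    rw [rootSummand_eq_invPow _ _ _ _ _ _ (by omega),
      zpow_eq_zpow_of_dvd hx (f := l + 2 * m + 3 * n) (by omega)]
    simp only [intCast_cpow_neg_natCast, invPow_neg]
    ring_nf
    -- the sign of the chamber meets the signs of the negative forms in squares
    try simp only [pow_mul', neg_one_sq, one_pow, mul_one]

/-- The twelve values of `ζ₃` add up to the sum over all chambers. -/
theorem hasSum_rootSummand {x : ℂ} (hx : IsTwist x) {Z : (Fin 6 → ℂ) → ℂ}
    (hZ : ∀ t₀ t₁ t₂ t₃ t₄ t₅ : ℂ, ![t₀, t₁, t₂, t₃, t₄, t₅] ∈ sixRegion →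
      HasSum (fun k : ℤ × ℤ × ℤ => chamberTerm x t₀ t₁ t₂ t₃ t₄ t₅ k.1 k.2.1 k.2.2)
        (Z ![t₀, t₁, t₂, t₃, t₄, t₅]))
    {p q a b c : ℕ} (hp : 1 ≤ p) (hq : 1 ≤ q) (ha : 1 ≤ a) (hb : 1 ≤ b) (hc : 1 ≤ c) {s : ℂ}
    (hs : 1 ≤ s.re) :
    HasSum (rootSummand x p q a b c s) (signedSum Z p q a b c s) := by
  -- each chamber has its own integral coordinates `u`, `v`, `w`, with inverse `g`
  have hcoord : ∀ {t₀ t₁ t₂ t₃ t₄ t₅ : ℂ} (u v w : (ℤ × ℤ) × ℤ → ℤ) (g : ℤ × ℤ × ℤ → (ℤ × ℤ) × ℤ),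
      (∀ k, g (u k, v k, w k) = k) → (∀ k, (u (g k), v (g k), w (g k)) = k) →
      1 ≤ t₀.re → 1 ≤ t₁.re → 1 ≤ t₂.re → 1 ≤ t₃.re → 1 ≤ t₄.re → 1 ≤ t₅.re →
      HasSum (fun k => chamberTerm x t₀ t₁ t₂ t₃ t₄ t₅ (u k) (v k) (w k))
        (Z ![t₀, t₁, t₂, t₃, t₄, t₅]) := by
    intro t₀ t₁ t₂ t₃ t₄ t₅ u v w g hg hg' r₀ r₁ r₂ r₃ r₄ r₅
    let e : (ℤ × ℤ) × ℤ ≃ ℤ × ℤ × ℤ := ⟨fun k => (u k, v k, w k), g, hg, hg'⟩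
    refine (e.hasSum_iff (f := fun k : ℤ × ℤ × ℤ =>
      chamberTerm x t₀ t₁ t₂ t₃ t₄ t₅ k.1 k.2.1 k.2.2)).2 (hZ _ _ _ _ _ _ ?_)
    intro j
    fin_cases j <;> assumption
  have hcast : ∀ {p : ℕ}, 1 ≤ p → 1 ≤ (p : ℂ).re := fun h => by
    rw [natCast_re]; exact_mod_cast h
  have hp' := hcast hp
  have hq' := hcast hq
  have ha' := hcast ha
  have hb' := hcast hb
  have hc' := hcast hc
  have h := ((((((((((((hcoord (t₀ := p) (t₁ := q) (t₂ := s) (t₃ := a) (t₄ := b) (t₅ := c)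
      (fun k => k.2) (fun k => k.1.1) (fun k => k.1.2) (fun k => ((k.2.1, k.2.2), k.1))
      ?_ ?_ ?_ ?_ ?_ ?_ ?_ ?_).mul_left 1).add
    ((hcoord (t₀ := p) (t₁ := a) (t₂ := s) (t₃ := q) (t₄ := c) (t₅ := b)
      (fun k => -k.2) (fun k => k.2 + k.1.1) (fun k => k.1.2)
      (fun k => ((k.1 + k.2.1, k.2.2), -k.1))
      ?_ ?_ ?_ ?_ ?_ ?_ ?_ ?_).mul_left ((-1) ^ p))).add
    ((hcoord (t₀ := q) (t₁ := a) (t₂ := c) (t₃ := p) (t₄ := s) (t₅ := b)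
      (fun k => k.1.1) (fun k => -(k.2 + k.1.1)) (fun k => k.2 + k.1.1 + k.1.2)
      (fun k => ((k.1, k.2.1 + k.2.2), -k.1 - k.2.1))
      ?_ ?_ ?_ ?_ ?_ ?_ ?_ ?_).mul_left ((-1) ^ (p + a)))).add
    ((hcoord (t₀ := q) (t₁ := s) (t₂ := c) (t₃ := b) (t₄ := a) (t₅ := p)
      (fun k => k.1.1) (fun k => k.1.2) (fun k => -(k.2 + k.1.1 + k.1.2))
      (fun k => ((k.1, k.2.1), -k.1 - k.2.1 - k.2.2))
      ?_ ?_ ?_ ?_ ?_ ?_ ?_ ?_).mul_left ((-1) ^ (p + a + c)))).add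
    ((hcoord (t₀ := a) (t₁ := q) (t₂ := b) (t₃ := p) (t₄ := s) (t₅ := c)
      (fun k => k.2 + k.1.1) (fun k => -k.1.1) (fun k => k.1.1 + k.1.2)
      (fun k => ((-k.2.1, k.2.1 + k.2.2), k.1 + k.2.1))
      ?_ ?_ ?_ ?_ ?_ ?_ ?_ ?_).mul_left ((-1) ^ q))).add
    ((hcoord (t₀ := a) (t₁ := s) (t₂ := b) (t₃ := c) (t₄ := q) (t₅ := p)
      (fun k => k.2 + k.1.1) (fun k => k.1.2) (fun k => -(k.1.1 + k.1.2))
      (fun k => ((-k.2.1 - k.2.2, k.2.1), k.1 + k.2.1 + k.2.2))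
      ?_ ?_ ?_ ?_ ?_ ?_ ?_ ?_).mul_left ((-1) ^ (q + b)))).add
    ((hcoord (t₀ := a) (t₁ := p) (t₂ := b) (t₃ := q) (t₄ := c) (t₅ := s)
      (fun k => -(k.2 + k.1.1)) (fun k => k.2) (fun k => k.1.1 + k.1.2)
      (fun k => ((-k.1 - k.2.1, k.1 + k.2.1 + k.2.2), k.2.1))
      ?_ ?_ ?_ ?_ ?_ ?_ ?_ ?_).mul_left ((-1) ^ (q + a)))).add
    ((hcoord (t₀ := a) (t₁ := c) (t₂ := b) (t₃ := s) (t₄ := p) (t₅ := q)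
      (fun k => -(k.2 + k.1.1)) (fun k => k.2 + k.1.1 + k.1.2) (fun k => -(k.1.1 + k.1.2))
      (fun k => ((-k.1 - k.2.1 - k.2.2, k.1 + k.2.1), k.2.1 + k.2.2))
      ?_ ?_ ?_ ?_ ?_ ?_ ?_ ?_).mul_left ((-1) ^ (q + a + b)))).add
    ((hcoord (t₀ := s) (t₁ := c) (t₂ := p) (t₃ := a) (t₄ := b) (t₅ := q)
      (fun k => k.1.2) (fun k => -(k.2 + k.1.1 + k.1.2)) (fun k => k.2)
      (fun k => ((-k.1 - k.2.1 - k.2.2, k.1), k.2.2))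
      ?_ ?_ ?_ ?_ ?_ ?_ ?_ ?_).mul_left ((-1) ^ (q + a + b + c)))).add
    ((hcoord (t₀ := q) (t₁ := p) (t₂ := c) (t₃ := a) (t₄ := b) (t₅ := s)
      (fun k => -k.1.1) (fun k => -k.2) (fun k => k.2 + k.1.1 + k.1.2)
      (fun k => ((-k.1, k.1 + k.2.1 + k.2.2), -k.2.1))
      ?_ ?_ ?_ ?_ ?_ ?_ ?_ ?_).mul_left ((-1) ^ (p + q + a)))).add
    ((hcoord (t₀ := q) (t₁ := b) (t₂ := c) (t₃ := s) (t₄ := p) (t₅ := a)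
      (fun k => -k.1.1) (fun k => k.1.1 + k.1.2) (fun k => -(k.2 + k.1.1 + k.1.2))
      (fun k => ((-k.1, k.1 + k.2.1), -k.2.1 - k.2.2))
      ?_ ?_ ?_ ?_ ?_ ?_ ?_ ?_).mul_left ((-1) ^ (p + q + a + c)))).add
    ((hcoord (t₀ := s) (t₁ := b) (t₂ := p) (t₃ := q) (t₄ := c) (t₅ := a)
      (fun k => k.1.2) (fun k => -(k.1.1 + k.1.2)) (fun k => -k.2)
      (fun k => ((-k.1 - k.2.1, k.1), -k.2.2))
      ?_ ?_ ?_ ?_ ?_ ?_ ?_ ?_).mul_left ((-1) ^ (p + q + a + b + c)))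
  · rw [one_mul] at h
    exact h.congr_fun fun k => sum_chamberTerm hx hp hq ha hb hc s k.2 k.1.1 k.1.2
  all_goals first
    | assumption
    | (intro k; ext <;> dsimp only <;> ring)

/-- The series of `ζ₃` over the positive octant as a series over `ℤ³`. -/
theorem hasSum_chamberTerm {x : ℂ} {u v w : ℕ}
    (hx : ∀ l m n : ℕ, I ^ (u * l + v * m + w * n) = x ^ (l + 2 * m + 3 * n))
    {t₀ t₁ t₂ t₃ t₄ t₅ S : ℂ}
    (h : HasSum (fun k => zetaTerm u v w k ![t₀, t₁, t₂, t₃, t₄, t₅]) S) :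
    HasSum (fun k : ℤ × ℤ × ℤ => chamberTerm x t₀ t₁ t₂ t₃ t₄ t₅ k.1 k.2.1 k.2.2) S := by
  let g : ℕ+ × ℕ+ × ℕ+ → ℤ × ℤ × ℤ := fun k => (k.1, k.2.1, k.2.2)
  have hg : Function.Injective g := by
    rintro ⟨a, b, c⟩ ⟨a', b', c'⟩ h
    simpa [g] using h
  rw [← hg.hasSum_iff]
  · refine h.congr_fun fun k => ?_
    obtain ⟨l, m, n⟩ := k
    have e : x ^ ((l : ℤ) + 2 * m + 3 * n) = x ^ ((l : ℕ) + 2 * m + 3 * n) := by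
      exact_mod_cast zpow_natCast x (l + 2 * m + 3 * n)
    simp only [Function.comp, g, chamberTerm, zetaTerm, hx, e]
    rw [if_pos ⟨by exact_mod_cast l.pos, by exact_mod_cast m.pos, by exact_mod_cast n.pos⟩,
      div_eq_mul_inv]
    simp only [mul_inv, cpow_neg, Matrix.cons_val]
    push_cast
    ring
  · rintro ⟨l, m, n⟩ hk
    refine if_neg fun h0 => hk ?_
    obtain ⟨h1, h2, h3⟩ := h0
    dsimp only at h1 h2 h3
    lift l to ℕ using h1.le
    lift m to ℕ using h2.le
    lift n to ℕ using h3.le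
    exact ⟨(⟨l, by exact_mod_cast h1⟩, ⟨m, by exact_mod_cast h2⟩, ⟨n, by exact_mod_cast h3⟩), rfl⟩

/-! ### The functional relations -/

theorem eq_of_eqOn_halfPlane {F G : ℂ → ℂ} (hF : Differentiable ℂ F) (hG : Differentiable ℂ G)
    (h : ∀ s : ℂ, 1 < s.re → F s = G s) : F = G := by
  refine IsEntireContinuation.unique (f := fun (_ : Unit) s => F s) halfPlane_interior_nonempty
    ⟨hF, fun s _ => hasSum_unique _⟩ ⟨hG, fun s hs => ?_⟩
  rw [← h s hs]
  exact hasSum_unique _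

theorem differentiable_signedSum {Z : (Fin 6 → ℂ) → ℂ} (hZ : Differentiable ℂ Z)
    (p q a b c : ℕ) : Differentiable ℂ (signedSum Z p q a b c) := by
  have hvec : ∀ {f₀ f₁ f₂ f₃ f₄ f₅ : ℂ → ℂ}, Differentiable ℂ f₀ → Differentiable ℂ f₁ →
      Differentiable ℂ f₂ → Differentiable ℂ f₃ → Differentiable ℂ f₄ → Differentiable ℂ f₅ →
      Differentiable ℂ fun s => Z ![f₀ s, f₁ s, f₂ s, f₃ s, f₄ s, f₅ s] := by
    intro f₀ f₁ f₂ f₃ f₄ f₅ h₀ h₁ h₂ h₃ h₄ h₅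
    refine hZ.comp (differentiable_pi.2 fun j => ?_)
    fin_cases j <;> assumption
  have hc : ∀ k : ℕ, Differentiable ℂ fun _ : ℂ => (k : ℂ) := fun k => differentiable_const _
  have hi : Differentiable ℂ fun s : ℂ => s := differentiable_id
  unfold signedSum
  refine Differentiable.add (Differentiable.add (Differentiable.add (Differentiable.add
    (Differentiable.add (Differentiable.add (Differentiable.add (Differentiable.add
    (Differentiable.add (Differentiable.add (Differentiable.add ?_ ?_) ?_) ?_) ?_) ?_) ?_) ?_) ?_)
    ?_) ?_) ?_
  · exact hvec (hc p) (hc q) hi (hc a) (hc b) (hc c)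
  all_goals refine Differentiable.const_mul (hvec ?_ ?_ ?_ ?_ ?_ ?_) _ <;>
    first | exact hi | exact hc _

theorem differentiable_doubleSum {J : ℕ} {W : ℕ → ℕ} {w : ℕ → ℕ → ℂ} {A : ℂ → ℕ → ℕ → ℂ}
    (h : ∀ j ω, Differentiable ℂ fun s => A s j ω) :
    Differentiable ℂ fun s => doubleSum J W w (A s) :=
  Differentiable.fun_sum fun j _ => Differentiable.fun_sum fun ω _ => (h j ω).const_mul _

theorem differentiable_rightSide (lam : ℕ → ℂ) {T₁ T₂ T₃ : ℕ → ℂ → ℕ → ℂ}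
    (h₁ : ∀ p q, Differentiable ℂ fun s => T₁ p s q)
    (h₂ : ∀ p q, Differentiable ℂ fun s => T₂ p s q)
    (h₃ : ∀ p q, Differentiable ℂ fun s => T₃ p s q) (p q a b c : ℕ) :
    Differentiable ℂ (rightSide lam T₁ T₂ T₃ p q a b c) := by
  have h : rightSide lam T₁ T₂ T₃ p q a b c = fun s => _ := funext fun s => rightSide_eq ..
  rw [h]
  refine Differentiable.add (Differentiable.add (Differentiable.add ?_ ?_) ?_) ?_ <;>
    refine differentiable_doubleSum fun j ω => Differentiable.const_mul ?_ _
  · exact h₁ _ _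
  · exact (h₂ q (p + b + c - j - ω)).comp ((differentiable_id.add_const _).add_const _)
  · exact h₃ _ _
  · exact (h₃ q (p + b + c - 1 - ω)).comp
      ((((differentiable_id.add_const _).sub_const _).add_const _).add_const _)

/-- The functional relation, first by summation for `Re s > 1` and then by continuation. -/
theorem signedSum_eq_rightSide {x : ℂ} (hx : x = I ∨ x = -I) {u v w : ℕ}
    (hphase : ∀ l m n : ℕ, I ^ (u * l + v * m + w * n) = x ^ (l + 2 * m + 3 * n))
    {Z : (Fin 6 → ℂ) → ℂ} (hZ : IsEntireContinuation (zetaTerm u v w) sixRegion Z)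
    {p q a b c : ℕ} (hp : 1 ≤ p) (hq : 1 ≤ q) (ha : 1 ≤ a) (hb : 1 ≤ b) (hc : 1 ≤ c) (s : ℂ) :
    signedSum Z p q a b c s = rightSide (lambdaNumber x) (torNumber (-1) (-x)) (torNumber x (-1))
      (torNumber x (-x)) p q a b c s := by
  refine congrFun (eq_of_eqOn_halfPlane (differentiable_signedSum hZ.1 p q a b c)
    (differentiable_rightSide _ (differentiable_torNumber _ _) (differentiable_torNumber _ _)
      (differentiable_torNumber _ _) p q a b c) fun s hs => ?_) s
  exact eq_rightSide_of_hasSum hx hp hq ha hb hc hs (hasSum_rootSummand (isTwist_of_eq hx)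
    (fun t₀ t₁ t₂ t₃ t₄ t₅ ht => hasSum_chamberTerm hphase (hZ.2 _ ht)) hp hq ha hb hc hs.le)

/-- The right side only involves `T₁`, `T₂`, `T₃` at positive integers. -/
theorem rightSide_congr {lam lam' : ℕ → ℂ} {T₁ T₂ T₃ T₁' T₂' T₃' : ℕ → ℂ → ℕ → ℂ}
    (hlam : ∀ j, lam j = lam' j) (h₁ : ∀ p q, 1 ≤ p → 1 ≤ q → ∀ s, T₁ p s q = T₁' p s q)
    (h₂ : ∀ p q, 1 ≤ p → 1 ≤ q → ∀ s, T₂ p s q = T₂' p s q)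
    (h₃ : ∀ p q, 1 ≤ p → 1 ≤ q → ∀ s, T₃ p s q = T₃' p s q) {p q a b c : ℕ}
    (hq : 1 ≤ q) (hb : 1 ≤ b) (s : ℂ) :
    rightSide lam T₁ T₂ T₃ p q a b c s = rightSide lam' T₁' T₂' T₃' p q a b c s := by
  rw [rightSide_eq, rightSide_eq]
  congr 1
  · congr 1
    · congr 1 <;> refine doubleSum_congr fun j hj ω hω => ?_
      · rw [hlam, h₁ _ _ (by omega) (by omega)]
      · rw [hlam, h₂ _ _ (by omega) (by omega)]
    · refine doubleSum_congr fun j hj ω hω => ?_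
      rw [hlam, h₃ _ _ (by omega) (by omega)]
  · refine doubleSum_congr fun j hj ω hω => ?_
    rw [hlam, h₃ _ _ (by omega) (by omega)]

/-- The three functions `𝔗` and their values by `ζ` and `L(·, χ₄)`. -/
theorem tor_eq_torValue {x : ℂ} (hx : x = I ∨ x = -I) {p q : ℕ} (hp : 1 ≤ p) (hq : 1 ≤ q) (s : ℂ) :
    tor (-1) x p s q = torValue₁ x p s q ∧ tor x (-1) p s q = torValue₂ x p s q ∧
      tor x (-x) p s q = torValue₃ x p s q := by
  have ht := isTwist_of_eq hx
  have ht' := isTwist_of_eq (neg_eq_of_eq hx)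
  refine ⟨?_, ?_, ?_⟩
  · rw [tor_eq_torNumber isTwist_neg_one ht (by rwa [mul_neg_one_inv]) hp hq,
      torNumber_neg_one_left hx]
  · rw [tor_eq_torNumber ht isTwist_neg_one (by rwa [neg_one_mul_inv_of_eq hx]) hp hq,
      torNumber_neg_one_right hx]
  · rw [tor_eq_torNumber ht ht' (by rw [neg_mul_inv_of_eq hx]; exact isTwist_neg_one) hp hq,
      torNumber_neg_right hx]

/-- The functional relation in both of its forms. -/
theorem functional_relation {x : ℂ} (hx : x = I ∨ x = -I) {u v w : ℕ}
    (hphase : ∀ l m n : ℕ, I ^ (u * l + v * m + w * n) = x ^ (l + 2 * m + 3 * n))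
    {Z : (Fin 6 → ℂ) → ℂ} (hZ : IsEntireContinuation (zetaTerm u v w) sixRegion Z)
    {p q a b c : ℕ} (hp : 1 ≤ p) (hq : 1 ≤ q) (ha : 1 ≤ a) (hb : 1 ≤ b) (hc : 1 ≤ c) (s : ℂ) :
    signedSum Z p q a b c s =
        rightSide (fun j => bigLambda x j) (tor (-1) (-x)) (tor x (-1)) (tor x (-x)) p q a b c s ∧
      rightSide (fun j => bigLambda x j) (tor (-1) (-x)) (tor x (-1)) (tor x (-x)) p q a b c s =
        rightSide (lambdaValue x) (torValue₁ (-x)) (torValue₂ x) (torValue₃ x) p q a b c s := by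
  have hx' := neg_eq_of_eq hx
  have h : rightSide (fun j => bigLambda x j) (tor (-1) (-x)) (tor x (-1)) (tor x (-x))
      p q a b c s =
      rightSide (lambdaValue x) (torValue₁ (-x)) (torValue₂ x) (torValue₃ x) p q a b c s :=
    rightSide_congr (fun j => by rw [bigLambda_natCast (isTwist_of_eq hx), lambdaNumber_of_eq hx])
      (fun p q hp hq s => (tor_eq_torValue hx' hp hq s).1)
      (fun p q hp hq s => (tor_eq_torValue hx hp hq s).2.1)
      (fun p q hp hq s => (tor_eq_torValue hx hp hq s).2.2) hq hb s
  refine ⟨?_, h⟩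
  rw [signedSum_eq_rightSide hx hphase hZ hp hq ha hb hc, h]
  refine rightSide_congr (lambdaNumber_of_eq hx)
    (fun p q _ _ s => torNumber_neg_one_left hx' p s q)
    (fun p q _ _ s => torNumber_neg_one_right hx p s q)
    (fun p q _ _ s => torNumber_neg_right hx p s q) hq hb s

theorem I_pow_three_ne_one : I ^ 3 ≠ 1 := by
  rw [I_pow_three]
  exact fun h => by simpa using congrArg Complex.im h

theorem I_pow_two_ne_one : I ^ 2 ≠ 1 := by
  rw [I_sq]
  norm_num

theorem I_pow_one_ne_one : I ^ 1 ≠ 1 := by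
  rw [pow_one]
  exact fun h => by simpa using congrArg Complex.im h

theorem I_pow_eq_neg_I_pow (l m n : ℕ) :
    I ^ (3 * l + 2 * m + 1 * n) = (-I) ^ (l + 2 * m + 3 * n) := by
  rw [← I_pow_three, ← pow_mul,
    show 3 * (l + 2 * m + 3 * n) = (3 * l + 2 * m + 1 * n) + 4 * (m + 2 * n) by ring,
    pow_add _ _ (4 * (m + 2 * n)), pow_mul I 4, I_pow_four, one_pow, mul_one]

end

theorem mainTheorem3 :
    -- the two zeta-functions exist as entire functions on `ℂ⁶`
    IsEntireContinuation (zetaTerm 3 2 1) sixRegion zetaLambda1 ∧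
    IsEntireContinuation (zetaTerm 1 2 3) sixRegion zetaLambda3 ∧
    -- so do `Λ(s; ± i)` and the functions `𝔗`, with explicit values by `ζ` and `L(·, χ₄)`
    (∀ x : ℂ, x = I ∨ x = -I →
      IsEntireContinuation (lambdaTerm x) halfPlane (bigLambda x) ∧
      (∀ j : ℕ, bigLambda x j = lambdaValue x j) ∧
      ∀ p q : ℕ, 1 ≤ p → 1 ≤ q →
        (IsEntireContinuation (torTerm (-1) x p q) halfPlane (fun s => tor (-1) x p s q) ∧
          ∀ s : ℂ, tor (-1) x p s q = torValue₁ x p s q) ∧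
        (IsEntireContinuation (torTerm x (-1) p q) halfPlane (fun s => tor x (-1) p s q) ∧
          ∀ s : ℂ, tor x (-1) p s q = torValue₂ x p s q) ∧
        (IsEntireContinuation (torTerm x (-x) p q) halfPlane (fun s => tor x (-x) p s q) ∧
          ∀ s : ℂ, tor x (-x) p s q = torValue₃ x p s q)) ∧
    -- the functional relations, and their right sides in terms of `ζ` and `L(·, χ₄)`
    ∀ p q a b c : ℕ, 1 ≤ p → 1 ≤ q → 1 ≤ a → 1 ≤ b → 1 ≤ c → ∀ s : ℂ,
      (signedSum zetaLambda1 p q a b c s =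
          rightSide (fun j => bigLambda (-I) j) (tor (-1) I) (tor (-I) (-1)) (tor (-I) I)
            p q a b c s ∧
        rightSide (fun j => bigLambda (-I) j) (tor (-1) I) (tor (-I) (-1)) (tor (-I) I)
            p q a b c s =
          rightSide (lambdaValue (-I)) (torValue₁ I) (torValue₂ (-I)) (torValue₃ (-I))
            p q a b c s) ∧
      (signedSum zetaLambda3 p q a b c s =
          rightSide (fun j => bigLambda I j) (tor (-1) (-I)) (tor I (-1)) (tor I (-I))
            p q a b c s ∧
        rightSide (fun j => bigLambda I j) (tor (-1) (-I)) (tor I (-1)) (tor I (-I))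
            p q a b c s =
          rightSide (lambdaValue I) (torValue₁ (-I)) (torValue₂ I) (torValue₃ I)
            p q a b c s) := by
  have h1 : IsEntireContinuation (zetaTerm 3 2 1) sixRegion zetaLambda1 :=
    isEntireContinuation_entireContinuation (exists_isEntireContinuation_zetaTerm
      I_pow_three_ne_one I_pow_two_ne_one I_pow_one_ne_one)
  have h3 : IsEntireContinuation (zetaTerm 1 2 3) sixRegion zetaLambda3 :=
    isEntireContinuation_entireContinuation (exists_isEntireContinuation_zetaTerm
      I_pow_one_ne_one I_pow_two_ne_one I_pow_three_ne_one)
  refine ⟨h1, h3, fun x hx => ⟨isEntireContinuation_entireContinuation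
    ⟨_, isEntireContinuation_lambdaTerm (isTwist_of_eq hx)⟩, fun j => ?_, fun p q hp hq => ?_⟩,
    fun p q a b c hp hq ha hb hc s => ⟨?_, ?_⟩⟩
  · rw [bigLambda_natCast (isTwist_of_eq hx), lambdaNumber_of_eq hx]
  · have ht := isTwist_of_eq hx
    have ht' := isTwist_of_eq (neg_eq_of_eq hx)
    exact ⟨⟨isEntireContinuation_entireContinuation ⟨_, isEntireContinuation_torTerm
          isTwist_neg_one ht (by rwa [mul_neg_one_inv]) hp hq⟩,
        fun s => (tor_eq_torValue hx hp hq s).1⟩,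
      ⟨isEntireContinuation_entireContinuation ⟨_, isEntireContinuation_torTerm
          ht isTwist_neg_one (by rwa [neg_one_mul_inv_of_eq hx]) hp hq⟩,
        fun s => (tor_eq_torValue hx hp hq s).2.1⟩,
      ⟨isEntireContinuation_entireContinuation ⟨_, isEntireContinuation_torTerm
          ht ht' (by rw [neg_mul_inv_of_eq hx]; exact isTwist_neg_one) hp hq⟩,
        fun s => (tor_eq_torValue hx hp hq s).2.2⟩⟩
  · simpa only [neg_neg] using
      functional_relation (Or.inr rfl) I_pow_eq_neg_I_pow h1 hp hq ha hb hc s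
  · exact functional_relation (Or.inl rfl) (fun l m n => by rw [one_mul]) h3 hp hq ha hb hc s
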